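/- For $v\in\mathbb R^3$ put $\langle v\rangle=\sqrt{1+|v|^2}$, and for $g:\mathbb R^3\to\mathbb R$ let $$A[g](v)=\frac1{8\pi}\int_{\mathbb R^3}\frac{1}{|v-z|}\Big(I-\frac{(v-z)\otimes(v-z)}{|v-z|^2}\Big)g(z)\,dz,\qquad a[g]=\operatorname{Tr}A[g].$$ Let $k>18/5$. There are constants $C,\kappa>0$ and $N\in\mathbb N$, depending only on $k$, with the following property. Let $T>0$ and let $f\ge 0$ be a classical solution of the homogeneous Landau–Coulomb equation $$\partial_t f=\nabla_v\cdot\big(A[f]\nabla_v f-f\,\nabla_v a[f]\big)\quad\text{on }(0,T)\times\mathbb R^3,\qquad f\in C^2((0,T)\times\mathbb R^3),$$ such that $\langle v\rangle^k f\in C([0,T];L^{3/2}(\mathbb R^3))$. Then $f^{3/4}(t,\cdot)$ is differentiable for every $t\in(0,T)$, and $$\langle v\rangle^{-\frac32+\frac{3k}4}\,\nabla_v f^{3/4}\in L^2((0,T)\times\mathbb R^3).$$ Moreover the bound depends algebraically on $M=\sup_{t\in[0,T]}\|\langle v\rangle^k f(t)\|_{L^{3/2}}<\infty$, in the following sense.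 Suppose $m=\int_{\mathbb R^3} f(0,v)\,dv>0$, and let $\eta_\delta=\delta^{-3}\eta(\cdot/\delta)$, where $\eta\in C^\infty(\mathbb R^3)$ satisfies $0\le\eta\le1$, $\int\eta=1$ and vanishes outside the closed unit ball. Put $X=(1+M)(1+1/m)$. Then there is $\delta\in(0,1]$ with $$\sup_{t\in[0,T]}\big\|\langle v\rangle^k\big(f(t)-f(t)*\eta_\delta\big)\big\|_{L^{3/2}}\le\kappa X^{-N},\tag{1}$$ and for every $\delta\in(0,1]$ satisfying (1), $$\int_0^T\!\!\int_{\mathbb R^3}\Big|\langle v\rangle^{-\frac32+\frac{3k}4}\nabla_v f^{3/4}\Big|^2dv\,dt\le C\,(1+T)\,\Big(\frac{X}{\delta}\Big)^{N}.$$ -/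

import Mathlib

open MeasureTheory Filter Topology
open scoped ENNReal Matrix

namespace Landau

/-- Velocity space, three-dimensional Euclidean space with Lebesgue measure. -/
abbrev V : Type := EuclideanSpace ℝ (Fin 3)

/-- The Japanese bracket of a velocity. -/
noncomputable def bracket (v : V) : ℝ := Real.sqrt (1 + ‖v‖ ^ 2)

/-- The matrix `P(z) = I - (z ⊗ z) / |z|^2`. -/
noncomputable def proj (z : V) : Matrix (Fin 3) (Fin 3) ℝ :=
  Matrix.of fun i j => (if i = j then 1 else 0) - z i * z j / ‖z‖ ^ 2

/-- The diffusion matrix `A[g](v) = (1/8π) ∫ P(v-z) / |v-z| g(z) dz`, entry by entry. -/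
noncomputable def matA (g : V → ℝ) (v : V) : Matrix (Fin 3) (Fin 3) ℝ :=
  Matrix.of fun i j =>
    1 / (8 * Real.pi) * ∫ z : V, proj (v - z) i j / ‖v - z‖ * g z

/-- The scalar `a[g] = Tr A[g]`. -/
noncomputable def scalA (g : V → ℝ) (v : V) : ℝ := (matA g v).trace

/-- The divergence of a vector field on velocity space. -/
noncomputable def divergence (F : V → V) (v : V) : ℝ :=
  ∑ i : Fin 3, fderiv ℝ (fun w => F w i) v (EuclideanSpace.single i 1)

/-- The flux `A[g] ∇g - g ∇a[g]`. -/
noncomputable def flux (g : V → ℝ) (v : V) : V :=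
  WithLp.toLp 2 (matA g v *ᵥ (fun i => gradient g v i)) - g v • gradient (scalA g) v

/-- A nonnegative classical solution of the homogeneous Landau-Coulomb equation
`∂ₜ f = ∇ · (A[f] ∇f - f ∇a[f])` on `(0,T) × ℝ³`: it is twice continuously differentiable in
`(t,v)` at positive times, with no smoothness asked at the initial time. -/
structure IsClassicalSolution (T : ℝ) (f : ℝ → V → ℝ) : Prop where
  smooth : ContDiffOn ℝ 2 (fun p : ℝ × V => f p.1 p.2) (Set.Ioo 0 T ×ˢ Set.univ)
  nonneg : ∀ t ∈ Set.Ioo 0 T, ∀ v, 0 ≤ f t v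
  equation : ∀ t ∈ Set.Ioo 0 T, ∀ v, deriv (fun s => f s v) t = divergence (flux (f t)) v

/-- The weighted norm of `g`, namely the `L^{3/2}` norm of `⟨v⟩^k g`. -/
noncomputable def wNorm (k : ℝ) (g : V → ℝ) : ℝ≥0∞ :=
  eLpNorm (fun v => bracket v ^ k * g v) (3 / 2) volume

/-- `⟨v⟩^k f` belongs to `C([0,T]; L^{3/2}(ℝ³))`. -/
structure WeightedContinuous (k T : ℝ) (f : ℝ → V → ℝ) : Prop where
  memLp : ∀ t ∈ Set.Icc 0 T, MemLp (fun v => bracket v ^ k * f t v) (3 / 2) volume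
  tendsto : ∀ t₀ ∈ Set.Icc 0 T,
    Tendsto (fun t => wNorm k (fun v => f t v - f t₀ v)) (𝓝[Set.Icc 0 T] t₀) (𝓝 0)

/-- The supremum over `[0,T]` of the weighted norm. -/
noncomputable def wSup (k T : ℝ) (f : ℝ → V → ℝ) : ℝ≥0∞ :=
  ⨆ t ∈ Set.Icc 0 T, wNorm k (f t)

/-- The initial mass. -/
noncomputable def mass (f : ℝ → V → ℝ) : ℝ := ∫ v, f 0 v

/-- Profiles of the usual mollifiers: smooth, with values in `[0,1]`, supported in the unit ball,
of integral one. -/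
structure IsMollifier (η : V → ℝ) : Prop where
  smooth : ContDiff ℝ (⊤ : ℕ∞) η
  nonneg : ∀ v, 0 ≤ η v
  le_one : ∀ v, η v ≤ 1
  support : ∀ v, 1 < ‖v‖ → η v = 0
  integral : ∫ v, η v = 1

/-- The mollification `g ∗ η_δ`, where `η_δ = δ^{-3} η(· / δ)`. -/
noncomputable def mollify (η : V → ℝ) (δ : ℝ) (g : V → ℝ) (v : V) : ℝ :=
  ∫ z, (δ ^ 3)⁻¹ * η (δ⁻¹ • (v - z)) * g z

/-- The function `⟨v⟩^{-3/2 + 3k/4} ∇ᵥ (f^{3/4})` of `(t,v)`. -/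
noncomputable def wGrad (k : ℝ) (f : ℝ → V → ℝ) (p : ℝ × V) : V :=
  bracket p.2 ^ (-3 / 2 + 3 * k / 4) • gradient (fun v => f p.1 v ^ (3 / 4 : ℝ)) p.2

/-- Lebesgue measure on `(0,T) × ℝ³`. -/
noncomputable def slab (T : ℝ) : Measure (ℝ × V) :=
  volume.restrict (Set.Ioo 0 T ×ˢ Set.univ)

/-- The quantity `(1 + sup_{[0,T]} ‖⟨v⟩^k f‖_{L^{3/2}}) (1 + 1 / mass)`. -/
noncomputable def size (k T : ℝ) (f : ℝ → V → ℝ) : ℝ :=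
  (1 + (wSup k T f).toReal) * (1 + 1 / mass f)

end Landau

/-! Put g = f^{3/4}, and let φ be the weight ⟨v⟩^{3k/2} cut off at radius R. Testing the equation
with (3/2) f^{1/2} φ and using ∇·A[f] = ∇a[f] and −Δa[f] = c f in weak form gives d/dt ∫ φ f^{3/2} =
−(4/3) ∫ φ A∇g·∇g − 4 ∫ g A∇g·∇φ + (c/2) ∫ φ f^{5/2} − ∫ f^{3/2} A:D²φ (`energy_identity`).
Everything then rests on comparing the right-hand side with the dissipation D = ∫ φ ⟨v⟩^{-3} |∇g|²,
which is a truncation of the quantity to be bounded.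

Coercivity. Mass is conserved (`integral_slice_eq_mass`): for a test function whose gradient has
Lipschitz constant L, symmetrising the double integral bounds the rate of change by L times the
interaction energy, and L is O(R^{-2}) for a cutoff at radius R. A moment bound keeps most of the
mass in a ball, and the L^{3/2} bound prevents it from concentrating near a line. Half of the mass
therefore contributes to A[f] in every direction, and A[f] ≥ c X^{-8} ⟨v⟩^{-3} (`coercive`).

Localisation errors. Cauchy–Schwarz for the form A[f] absorbs a quarter of the dissipative term and
leaves ∫ φ̃ f^{3/2} a[f], where φ̃ is the same weight with a weaker truncation
(`energy_inequality`). The part of a[f] coming from distance at least one is bounded by the mass.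
For the near part h, Young's inequality bounds f^{3/2} h by f^{5/2} + f^{1/2} h², and the last term
is controlled by M^{5/2} through the convolution inequality L^{3/2} * L^{3/2} ⊆ L³
(`integral_loc_le`).

The critical term. By Hölder and Sobolev, ∫ φ f^{5/2} = ∫ φ f g² is bounded by ‖⟨v⟩^k f‖_{3/2} times
a quantity of the order of D: this has the same scaling as D, so only smallness of the factor helps.
Splitting f = (f − f*η_δ) + f*η_δ, the first part is small in the weighted norm by hypothesis (1),
and the second is at most δ^{-3} times the mass (`integral_cutoff_mul_rpow_le`). With the threshold
κ X^{-12} half of the coercive term survives (`energyRate_le`).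

Integrating in time drops a nonnegative final energy and costs M^{3/2} from the initial one; Fatou's
lemma removes the truncation in v and the restriction to compact subintervals of (0,T)
(`lintegral_dissip_le`, `eLpNorm_wGrad_sq_le`). A δ as in (1) exists because t ↦ ⟨v⟩^k f(t) has
compact image in L^{3/2} (`exists_forall_wNorm_sub_mollify_le`). If the mass is zero, f vanishes on
the open slab.

Regularity. At a zero of f the gradient vanishes and f = O(|y − v|²), so f^{3/4} is differentiable
there; |∇f|² ≤ K f locally makes it C¹. The singular kernels are replaced by powers of (|u|² +
ε²)^{-1/2}, for which the differential identities are classical, and ε → 0 is taken after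
integrating by parts. -/

namespace Landau

/-! ### Coordinate calculus and the Japanese bracket -/

/-- The `i`-th partial derivative. -/
noncomputable def pd (i : Fin 3) (f : V → ℝ) (v : V) : ℝ :=
  fderiv ℝ f v (EuclideanSpace.single i 1)

lemma gradient_apply (g : V → ℝ) (v : V) (i : Fin 3) : gradient g v i = pd i g v := by
  have h : inner ℝ (gradient g v) (EuclideanSpace.single i (1 : ℝ)) = pd i g v := by
    rw [gradient, InnerProductSpace.toDual_symm_apply, pd]
  rw [← h, EuclideanSpace.inner_single_right]; simp

lemma divergence_eq (F : V → V) (v : V) : divergence F v = ∑ i, pd i (fun w => F w i) v := rfl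

lemma flux_apply (g : V → ℝ) (v : V) (i : Fin 3) :
    flux g v i = ∑ j, matA g v i j * pd j g v - g v * pd i (scalA g) v := by
  simp [flux, Matrix.mulVec, dotProduct, gradient_apply]

lemma norm_sq_eq_sum (v : V) : ‖v‖ ^ 2 = ∑ i, v i ^ 2 := by
  rw [EuclideanSpace.norm_sq_eq]; simp

lemma norm_fderiv_sq (g : V → ℝ) (v : V) : ‖fderiv ℝ g v‖ ^ 2 = ∑ i, pd i g v ^ 2 := by
  have : ‖gradient g v‖ = ‖fderiv ℝ g v‖ := by
    rw [gradient]; simp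
  rw [← this, norm_sq_eq_sum]; simp [gradient_apply]

lemma norm_gradient_sq (g : V → ℝ) (v : V) : ‖gradient g v‖ ^ 2 = ∑ i, pd i g v ^ 2 := by
  rw [norm_sq_eq_sum]; simp [gradient_apply]

lemma contDiff_pd {n m : WithTop ℕ∞} {f : V → ℝ} (hf : ContDiff ℝ n f) (h : m + 1 ≤ n)
    (i : Fin 3) : ContDiff ℝ m (pd i f) :=
  (hf.fderiv_right h).clm_apply contDiff_const

lemma continuous_pd {f : V → ℝ} (hf : ContDiff ℝ 1 f) (i : Fin 3) : Continuous (pd i f) :=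
  (contDiff_pd (m := 0) hf (by simp) i).continuous

lemma HasCompactSupport.pd {f : V → ℝ} (hf : HasCompactSupport f) (i : Fin 3) :
    HasCompactSupport (pd i f) :=
  hf.fderiv_apply (𝕜 := ℝ) _

lemma pd_mul {f g : V → ℝ} {v : V} (hf : DifferentiableAt ℝ f v) (hg : DifferentiableAt ℝ g v)
    (i : Fin 3) : pd i (fun w => f w * g w) v = pd i f v * g v + f v * pd i g v := by
  simp only [pd]; rw [fderiv_fun_mul hf hg]; simp; ring

lemma pd_add {f g : V → ℝ} {v : V} (hf : DifferentiableAt ℝ f v) (hg : DifferentiableAt ℝ g v)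
    (i : Fin 3) : pd i (fun w => f w + g w) v = pd i f v + pd i g v := by
  simp only [pd]; rw [fderiv_fun_add hf hg]; simp

lemma pd_sub {f g : V → ℝ} {v : V} (hf : DifferentiableAt ℝ f v) (hg : DifferentiableAt ℝ g v)
    (i : Fin 3) : pd i (fun w => f w - g w) v = pd i f v - pd i g v := by
  simp only [pd]; rw [fderiv_fun_sub hf hg]; simp

lemma pd_const (c : ℝ) (i : Fin 3) (v : V) : pd i (fun _ => c) v = 0 := by simp [pd]

lemma pd_const_mul {f : V → ℝ} {v : V} (hf : DifferentiableAt ℝ f v) (c : ℝ) (i : Fin 3) :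
    pd i (fun w => c * f w) v = c * pd i f v := by
  simp only [pd]; rw [fderiv_const_mul hf]; simp

lemma pd_comp {f : V → ℝ} {v : V} {h : ℝ → ℝ} {h' : ℝ} (hh : HasDerivAt h h' (f v))
    (hf : DifferentiableAt ℝ f v) (i : Fin 3) : pd i (fun w => h (f w)) v = h' * pd i f v := by
  have := (hh.comp_hasFDerivAt v hf.hasFDerivAt).fderiv
  simp only [pd, Function.comp_def] at this ⊢
  rw [this]; simp

lemma pd_coord (i j : Fin 3) (v : V) : pd i (fun w => w j) v = if i = j then 1 else 0 := by
  have : HasFDerivAt (fun w : V => w j) (EuclideanSpace.proj j : V →L[ℝ] ℝ) v :=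
    (EuclideanSpace.proj j : V →L[ℝ] ℝ).hasFDerivAt
  simp only [pd]; rw [this.fderiv]
  simp [eq_comm]

lemma contDiff_coord {n : WithTop ℕ∞} (j : Fin 3) : ContDiff ℝ n (fun w : V => w j) :=
  (EuclideanSpace.proj j : V →L[ℝ] ℝ).contDiff

lemma pd_normSq (i : Fin 3) (v : V) : pd i (fun w => ‖w‖ ^ 2) v = 2 * v i := by
  simp only [pd]
  rw [fderiv_norm_sq_apply]
  simp [EuclideanSpace.inner_single_right]

lemma contDiff_normSq {n : WithTop ℕ∞} : ContDiff ℝ n (fun w : V => ‖w‖ ^ 2) := contDiff_norm_sq ℝ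

lemma pd_comp_sub (f : V → ℝ) (z v : V) (i : Fin 3) : pd i (fun w => f (w - z)) v = pd i f (v - z) := by
  simp only [pd]; rw [fderiv_comp_sub]

/-- Integration by parts in a coordinate direction. -/
lemma integral_mul_pd {f g : V → ℝ} (hf : ContDiff ℝ 1 f) (hg : ContDiff ℝ 1 g)
    (hc : HasCompactSupport g) (i : Fin 3) : ∫ v, f v * pd i g v = - ∫ v, pd i f v * g v := by
  have h1 : Integrable (fun v => pd i f v * g v) :=
    ((continuous_pd hf i).mul hg.continuous).integrable_of_hasCompactSupport hc.mul_left
  have h2 : Integrable (fun v => f v * pd i g v) :=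
    (hf.continuous.mul (continuous_pd hg i)).integrable_of_hasCompactSupport
      (HasCompactSupport.pd hc i).mul_left
  have h3 : Integrable (fun v => f v * g v) :=
    (hf.continuous.mul hg.continuous).integrable_of_hasCompactSupport hc.mul_left
  exact integral_mul_fderiv_eq_neg_fderiv_mul_of_integrable h1 h2 h3
    (fun x _ => hf.differentiable (by simp) x) (fun x _ => hg.differentiable (by simp) x)

lemma bracket_sq (v : V) : bracket v ^ 2 = 1 + ‖v‖ ^ 2 := Real.sq_sqrt (by positivity)

lemma one_le_bracket (v : V) : 1 ≤ bracket v := by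
  rw [bracket]; exact Real.one_le_sqrt.2 (by nlinarith [sq_nonneg ‖v‖])

lemma bracket_pos (v : V) : 0 < bracket v := zero_lt_one.trans_le (one_le_bracket v)

lemma norm_le_bracket (v : V) : ‖v‖ ≤ bracket v := by
  rw [bracket]; exact Real.le_sqrt_of_sq_le (by linarith)

lemma continuous_bracket : Continuous bracket := by unfold bracket; fun_prop

lemma continuous_bracket_rpow (p : ℝ) : Continuous fun v => bracket v ^ p :=
  continuous_bracket.rpow_const fun v => Or.inl (bracket_pos v).ne'

lemma bracket_le_two_mul {v z : V} (h : ‖v - z‖ ≤ 1) : bracket v ≤ 2 * bracket z := by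
  have h1 : ‖v‖ ≤ ‖z‖ + 1 := by
    have := norm_add_le (v - z) z
    simp only [sub_add_cancel] at this; linarith
  have h2 := bracket_sq v
  have h3 := bracket_sq z
  have h4 := bracket_pos z
  have : bracket v ^ 2 ≤ (2 * bracket z) ^ 2 := by
    nlinarith [norm_nonneg v, norm_nonneg z, sq_nonneg (‖z‖ - 1)]
  exact (pow_le_pow_iff_left₀ (bracket_pos v).le (by positivity) two_ne_zero).1 this

lemma bracket_rpow_eq (v : V) (p : ℝ) : bracket v ^ p = (1 + ‖v‖ ^ 2) ^ (p / 2) := by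
  rw [← bracket_sq, ← Real.rpow_natCast, ← Real.rpow_mul (bracket_pos v).le]
  congr 1; push_cast; ring

/-! ### Homogeneous kernels and the regularity of their potentials -/

lemma integrableOn_norm_rpow_neg {p : ℝ} (hp : p < 3) {r : ℝ} (hr : 0 < r) :
    IntegrableOn (fun u : V => ‖u‖ ^ (-p)) (Metric.ball 0 r) := by
  have h := (integrableOn_fun_norm_addHaar (E := V) (volume : Measure V)
    (f := fun y : ℝ => y ^ (-p)) (r := r)).2
  refine h ?_
  have h2 := (intervalIntegral.integrableOn_Ioo_rpow_iff (s := 2 - p) hr).2 (by linarith)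
  refine h2.congr_fun (fun y hy => ?_) measurableSet_Ioo
  simp only [finrank_euclideanSpace, Fintype.card_fin, smul_eq_mul]
  rw [show (2 : ℝ) - p = 2 + -p by ring, Real.rpow_add hy.1]
  norm_num

lemma integrableOn_norm_inv {r : ℝ} (hr : 0 < r) :
    IntegrableOn (fun u : V => ‖u‖⁻¹) (Metric.ball 0 r) := by
  have := integrableOn_norm_rpow_neg (p := 1) (by norm_num) hr
  simpa [Real.rpow_neg_one] using this

lemma locallyIntegrable_norm_inv : LocallyIntegrable (fun u : V => ‖u‖⁻¹) := by
  intro x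
  refine ⟨Metric.ball 0 (‖x‖ + 1), Metric.isOpen_ball.mem_nhds (by simp), ?_⟩
  exact integrableOn_norm_inv (by positivity)

/-- Kernels that are smooth and homogeneous of degree `-a` away from the origin. -/
structure IsHomKernel {E : Type*} [NormedAddCommGroup E] [NormedSpace ℝ E] (a : ℕ) (H : V → E) :
    Prop where
  smooth : ContDiffOn ℝ (⊤ : ℕ∞) H {0}ᶜ
  hom : ∀ c : ℝ, 0 < c → ∀ u : V, u ≠ 0 → H (c • u) = (c ^ a)⁻¹ • H u

section Hom

variable {E : Type*} [NormedAddCommGroup E] [NormedSpace ℝ E] {a : ℕ} {H : V → E}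

/-- Homogeneity reduces the bound to the unit sphere, where compactness and continuity give it. -/
lemma IsHomKernel.exists_bound (hH : IsHomKernel a H) :
    ∃ C, 0 ≤ C ∧ ∀ u, u ≠ 0 → ‖H u‖ ≤ C * (‖u‖ ^ a)⁻¹ := by
  obtain ⟨C, hC⟩ := (isCompact_sphere (0 : V) 1).exists_bound_of_continuousOn
    (hH.smooth.continuousOn.mono (fun u hu => by
      simp only [Set.mem_compl_iff, Set.mem_singleton_iff]
      rintro rfl; simp at hu))
  refine ⟨max C 0, le_max_right _ _, fun u hu => ?_⟩
  have hn : 0 < ‖u‖ := norm_pos_iff.2 hu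
  have h1 : ‖H (‖u‖⁻¹ • u)‖ ≤ C := hC _ (by
    simp only [mem_sphere_iff_norm, sub_zero, norm_smul, norm_inv, norm_norm]
    exact inv_mul_cancel₀ hn.ne')
  have h2 := hH.hom ‖u‖ hn (‖u‖⁻¹ • u) (smul_ne_zero (inv_ne_zero hn.ne') hu)
  rw [smul_smul, mul_inv_cancel₀ hn.ne', one_smul] at h2
  rw [h2, norm_smul, mul_comm, norm_inv, norm_pow, norm_norm]
  gcongr
  exact h1.trans (le_max_left _ _)

lemma IsHomKernel.differentiableAt (hH : IsHomKernel a H) {u : V} (hu : u ≠ 0) :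
    DifferentiableAt ℝ H u :=
  (hH.smooth.contDiffAt (isOpen_compl_singleton.mem_nhds hu)).differentiableAt (by simp)

/-- Differentiating the scaling relation lowers the degree by one. The class is thus closed under
differentiation, which is what the induction in `IsHomKernel.contDiffOn_far` runs on. -/
lemma IsHomKernel.fderiv_kernel (hH : IsHomKernel a H) : IsHomKernel (a + 1) (fderiv ℝ H) where
  smooth := hH.smooth.fderiv_of_isOpen isOpen_compl_singleton (by simp)
  hom c hc u hu := by
    have h1 : (fun x => H (c • x)) =ᶠ[𝓝 u] fun x => (c ^ a)⁻¹ • H x := by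
      filter_upwards [isOpen_compl_singleton.mem_nhds hu] with x hx using hH.hom c hc x hx
    have h2 := h1.fderiv_eq (𝕜 := ℝ)
    have h3 : fderiv ℝ (fun x => (c ^ a)⁻¹ • H x) u = (c ^ a)⁻¹ • fderiv ℝ H u :=
      (((hH.differentiableAt hu).hasFDerivAt).const_smul ((c ^ a)⁻¹)).fderiv
    rw [fderiv_comp_smul, h3] at h2
    rw [pow_succ, mul_inv, mul_comm, mul_smul, ← h2, smul_smul, inv_mul_cancel₀ hc.ne', one_smul]

lemma IsHomKernel.aestronglyMeasurable (hH : IsHomKernel a H) : AEStronglyMeasurable H := by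
  have := hH.smooth.continuousOn.aestronglyMeasurable (μ := volume)
    (measurableSet_singleton (0 : V)).compl
  rwa [Measure.restrict_eq_self_of_ae_mem (by simp [ae_iff])] at this

lemma IsHomKernel.aestronglyMeasurable_sub (hH : IsHomKernel a H) (v : V) :
    AEStronglyMeasurable (fun z => H (v - z)) :=
  hH.aestronglyMeasurable.comp_measurePreserving (Measure.measurePreserving_sub_left volume v)

/-- The density vanishes on the ball of radius 2, so points of the ball of radius 1 stay at distance
at least 1 from its support. There the kernel and its derivative are bounded by constants, and
differentiation under the integral is dominated by a multiple of |f|. -/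
lemma IsHomKernel.hasFDerivAt_far (hH : IsHomKernel a H) {f : V → ℝ} (hf : Integrable f) {v₀ : V}
    (h0 : ∀ z ∈ Metric.ball v₀ 2, f z = 0) {v : V} (hv : v ∈ Metric.ball v₀ 1) :
    HasFDerivAt (fun v => ∫ z, f z • H (v - z)) (∫ z, f z • fderiv ℝ H (v - z)) v := by
  obtain ⟨C, hC0, hC⟩ := hH.exists_bound
  obtain ⟨C', hC0', hC'⟩ := hH.fderiv_kernel.exists_bound
  have far : ∀ z, f z ≠ 0 → ∀ x ∈ Metric.ball v₀ 1, 1 ≤ ‖x - z‖ := by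
    intro z hz x hx
    by_contra! hlt
    refine hz (h0 z ?_)
    rw [Metric.mem_ball, dist_eq_norm] at hx ⊢
    calc ‖z - v₀‖ = ‖(x - v₀) - (x - z)‖ := by congr 1; abel
      _ ≤ _ := norm_sub_le _ _
      _ < 2 := by linarith
  have bd : ∀ (n : ℕ) (r : ℝ), 1 ≤ r → (r ^ n)⁻¹ ≤ 1 := fun n r hr =>
    inv_le_one_of_one_le₀ (one_le_pow₀ hr)
  have ne : ∀ u : V, 1 ≤ ‖u‖ → u ≠ 0 := by rintro u hu rfl; norm_num at hu
  refine hasFDerivAt_integral_of_dominated_of_fderiv_le (𝕜 := ℝ) (H := V)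
    (F := fun v z => f z • H (v - z)) (F' := fun v z => f z • fderiv ℝ H (v - z)) (s := Metric.ball v₀ 1)
    (bound := fun z => ‖f z‖ * C') (Metric.isOpen_ball.mem_nhds hv) ?_ ?_ ?_ ?_ ?_ ?_
  · exact Eventually.of_forall fun x => hf.1.smul (hH.aestronglyMeasurable_sub x)
  · refine Integrable.mono' (hf.norm.mul_const C) (hf.1.smul (hH.aestronglyMeasurable_sub v))
      (Eventually.of_forall fun z => ?_)
    rw [norm_smul]
    by_cases hz : f z = 0
    · simp [hz]
    have := far z hz v hv
    refine mul_le_mul_of_nonneg_left ((hC _ (ne _ this)).trans ?_) (norm_nonneg _)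
    exact mul_le_of_le_one_right hC0 (bd _ _ this)
  · exact hf.1.smul (hH.fderiv_kernel.aestronglyMeasurable_sub v)
  · refine Eventually.of_forall fun z x hx => ?_
    rw [norm_smul]
    by_cases hz : f z = 0
    · simp [hz]
    have := far z hz x hx
    refine mul_le_mul_of_nonneg_left ((hC' _ (ne _ this)).trans ?_) (norm_nonneg _)
    exact mul_le_of_le_one_right hC0' (bd _ _ this)
  · exact hf.norm.mul_const _
  · refine Eventually.of_forall fun z x hx => ?_
    by_cases hz : f z = 0
    · simpa [hz] using hasFDerivAt_const (0 : E) x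
    have h1 := (hH.differentiableAt (ne _ (far z hz x hx))).hasFDerivAt
    have h2 : HasFDerivAt (fun x : V => x - z) (ContinuousLinearMap.id ℝ V) x :=
      (hasFDerivAt_id x).sub_const z
    exact (h1.comp x h2).const_smul (f z)

end Hom

/-- The derivative of a potential is the potential of the derivative kernel, which takes values in a
space of linear maps and has a lower degree. The codomain, the degree and the kernel must therefore
all vary in the induction. -/
lemma IsHomKernel.contDiffOn_far {f : V → ℝ} (hf : Integrable f) {v₀ : V}
    (h0 : ∀ z ∈ Metric.ball v₀ 2, f z = 0) (n : ℕ) :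
    ∀ {E : Type} [NormedAddCommGroup E] [NormedSpace ℝ E] {a : ℕ} {H : V → E},
      IsHomKernel a H → ContDiffOn ℝ n (fun v => ∫ z, f z • H (v - z)) (Metric.ball v₀ 1) := by
  induction n with
  | zero =>
    intro E _ _ a H hH
    exact contDiffOn_zero.2 fun v hv =>
      (hH.hasFDerivAt_far hf h0 hv).continuousAt.continuousWithinAt
  | succ n ih =>
    intro E _ _ a H hH
    rw [Nat.cast_succ, contDiffOn_succ_iff_fderiv_of_isOpen Metric.isOpen_ball]
    refine ⟨fun v hv => (hH.hasFDerivAt_far hf h0 hv).differentiableAt.differentiableWithinAt,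
      by simp, ?_⟩
    exact (ih hH.fderiv_kernel).congr fun v hv => (hH.hasFDerivAt_far hf h0 hv).fderiv

lemma IsHomKernel.locallyIntegrable {H : V → ℝ} (hH : IsHomKernel 1 H) : LocallyIntegrable H := by
  obtain ⟨C, hC0, hC⟩ := hH.exists_bound
  have h1 : LocallyIntegrable (fun u : V => C * ‖u‖⁻¹) := locallyIntegrable_norm_inv.smul C
  refine h1.mono hH.aestronglyMeasurable ?_
  have h2 : ∀ᵐ u : V, u ≠ 0 := by simp [ae_iff]
  filter_upwards [h2] with u hu
  rw [Real.norm_eq_abs (C * _), abs_of_nonneg (by positivity)]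
  simpa using hC u hu

/-- Within distance one the kernel is integrable and the density bounded; beyond it the kernel is
bounded and the density integrable. -/
lemma integrable_kernel_mul {H : V → ℝ} (hH : IsHomKernel 1 H) {f : V → ℝ}
    (hc : Continuous f) (hf : Integrable f) (v : V) : Integrable fun z => H (v - z) * f z := by
  obtain ⟨C, hC0, hC⟩ := hH.exists_bound
  have hm : AEStronglyMeasurable (fun z => H (v - z) * f z) :=
    (hH.aestronglyMeasurable_sub v).mul hf.1
  rw [← integrableOn_univ, ← Set.union_compl_self (Metric.closedBall v 1)]
  refine IntegrableOn.union ?_ ?_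
  · have h1 : LocallyIntegrable (fun z => H (v - z)) := by
      intro x
      obtain ⟨s, hs, h⟩ := hH.locallyIntegrable (v - x)
      refine ⟨(fun z => v - z) ⁻¹' s, (by fun_prop : Continuous fun z : V => v - z).continuousAt hs, ?_⟩
      exact ((Measure.measurePreserving_sub_left volume v).integrableOn_comp_preimage
        (Homeomorph.subLeft v).measurableEmbedding).2 h
    exact (h1.integrableOn_isCompact (isCompact_closedBall v 1)).mul_continuousOn hc.continuousOn
      (isCompact_closedBall v 1)
  · refine Integrable.mono' (hf.norm.const_mul C).integrableOn hm.restrict ?_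
    refine (ae_restrict_iff' Metric.isClosed_closedBall.measurableSet.compl).2
      (Eventually.of_forall fun z hz => ?_)
    have h1 : 1 < ‖v - z‖ := by
      simpa [Metric.mem_closedBall, dist_eq_norm, norm_sub_rev] using hz
    rw [norm_mul]
    refine mul_le_mul_of_nonneg_right ((hC _ ?_).trans ?_) (norm_nonneg _)
    · intro h; rw [h] at h1; norm_num at h1
    · exact mul_le_of_le_one_right hC0 (inv_le_one_of_one_le₀ (one_le_pow₀ h1.le))

/-- Potentials of an integrable `C²` density with a kernel of degree `-1` are `C²`. -/
lemma contDiff_potential {H : V → ℝ} (hH : IsHomKernel 1 H) {f : V → ℝ}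
    (hc : ContDiff ℝ 2 f) (hf : Integrable f) : ContDiff ℝ 2 fun v => ∫ z, H (v - z) * f z := by
  rw [contDiff_iff_contDiffAt]
  intro v₀
  -- The bump splits the density. On χ f, which is C² with compact support, the derivatives fall on
  -- the density; (1 − χ) f vanishes on the ball of radius 2, so there they fall on the kernel.
  let χ : ContDiffBump v₀ := ⟨2, 3, by norm_num, by norm_num⟩
  have hχ : ContDiff ℝ 2 χ := χ.contDiff
  have hc1 : ContDiff ℝ 2 (fun z => χ z * f z) := hχ.mul hc
  have hs1 : HasCompactSupport (fun z => χ z * f z) := χ.hasCompactSupport.mul_right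
  have hi1 : Integrable (fun z => χ z * f z) := hc1.continuous.integrable_of_hasCompactSupport hs1
  have hc2 : Continuous (fun z => f z - χ z * f z) := hc.continuous.sub hc1.continuous
  have hi2 : Integrable (fun z => f z - χ z * f z) := hf.sub hi1
  have h0 : ∀ z ∈ Metric.ball v₀ 2, f z - χ z * f z = 0 := by
    intro z hz
    rw [χ.one_of_mem_closedBall (Metric.ball_subset_closedBall hz)]; ring
  have near := hs1.contDiff_convolution_left (n := 2) (ContinuousLinearMap.mul ℝ ℝ) hc1
    hH.locallyIntegrable
  have far := (IsHomKernel.contDiffOn_far hi2 h0 2 hH).contDiffAt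
    (Metric.ball_mem_nhds v₀ one_pos)
  refine (near.contDiffAt.add far).congr_of_eventuallyEq (Eventually.of_forall fun v => ?_)
  simp only [convolution_def, ContinuousLinearMap.mul_apply']
  rw [← integral_add]
  · congr 1 with z; simp; ring
  · simpa [mul_comm] using integrable_kernel_mul hH hc1.continuous hi1 v
  · simpa [mul_comm] using integrable_kernel_mul hH hc2 hi2 v

/-! ### The Landau kernel and smoothness of the coefficients -/

/-- The `(i,j)` entry of the Landau kernel. -/
noncomputable def ker (i j : Fin 3) (u : V) : ℝ := proj u i j / ‖u‖

lemma isHomKernel_ker (i j : Fin 3) : IsHomKernel 1 (ker i j) where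
  smooth := by
    intro u hu
    have hu' : u ≠ 0 := hu
    have h1 : ContDiffAt ℝ (⊤ : ℕ∞) (fun u : V => ‖u‖) u := contDiffAt_norm ℝ hu'
    have hn : ‖u‖ ≠ 0 := norm_ne_zero_iff.2 hu'
    refine ContDiffAt.contDiffWithinAt ?_
    unfold ker proj
    exact ((contDiffAt_const.sub (((contDiff_coord i).contDiffAt.mul
      (contDiff_coord j).contDiffAt).div (h1.pow 2) (pow_ne_zero 2 hn)))).div h1 hn
  hom c hc u hu := by
    have hn : ‖u‖ ≠ 0 := norm_ne_zero_iff.2 hu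
    simp only [ker, proj, Matrix.of_apply, norm_smul, PiLp.smul_apply, smul_eq_mul, pow_one,
      Real.norm_eq_abs, abs_of_pos hc]
    have : c * u i * (c * u j) / (c * ‖u‖) ^ 2 = u i * u j / ‖u‖ ^ 2 := by
      field_simp
    rw [this]; field_simp

lemma matA_eq (g : V → ℝ) (v : V) (i j : Fin 3) :
    matA g v i j = 1 / (8 * Real.pi) * ∫ z, ker i j (v - z) * g z := rfl

lemma contDiff_matA {f : V → ℝ} (hc : ContDiff ℝ 2 f) (hf : Integrable f) (i j : Fin 3) :
    ContDiff ℝ 2 fun v => matA f v i j := by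
  simp only [matA_eq]
  exact contDiff_const.mul (contDiff_potential (isHomKernel_ker i j) hc hf)

lemma scalA_eq_sum (f : V → ℝ) (v : V) : scalA f v = ∑ i, matA f v i i := rfl

lemma contDiff_scalA {f : V → ℝ} (hc : ContDiff ℝ 2 f) (hf : Integrable f) :
    ContDiff ℝ 2 (scalA f) := by
  have : scalA f = fun v => ∑ i, matA f v i i := funext fun v => scalA_eq_sum f v
  rw [this]
  exact ContDiff.sum fun i _ => contDiff_matA hc hf i i

lemma contDiff_flux {f : V → ℝ} (hc : ContDiff ℝ 2 f) (hf : Integrable f) (i : Fin 3) :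
    ContDiff ℝ 1 fun v => flux f v i := by
  simp only [flux_apply]
  refine ContDiff.sub (ContDiff.sum fun j _ => ?_) ?_
  · exact ((contDiff_matA hc hf i j).of_le (by norm_num)).mul (contDiff_pd hc (by norm_num) j)
  · exact (hc.of_le (by norm_num)).mul (contDiff_pd (contDiff_scalA hc hf) (by norm_num) i)

/-! ### Regularised kernels and their differential identities -/

/-- The regularised Newtonian kernel `(|u|² + ε²)^{-1/2}`. -/
noncomputable def regNewton (ε : ℝ) (u : V) : ℝ := (‖u‖ ^ 2 + ε ^ 2) ^ (-(1 / 2) : ℝ)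

/-- The regularised Landau kernel. -/
noncomputable def regKer (ε : ℝ) (i j : Fin 3) (u : V) : ℝ :=
  (if i = j then 1 else 0) * regNewton ε u - u i * u j * regNewton ε u ^ 3

lemma abs_coord_le (u : V) (i : Fin 3) : |u i| ≤ ‖u‖ := by
  have := PiLp.norm_apply_le u i; simpa using this

section Reg

variable {ε : ℝ} (hε : 0 < ε)
include hε

lemma regNewton_pos (u : V) : 0 < regNewton ε u := by
  unfold regNewton; positivity

lemma regNewton_sq (u : V) : regNewton ε u ^ 2 = (‖u‖ ^ 2 + ε ^ 2)⁻¹ := by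
  unfold regNewton
  rw [← Real.rpow_natCast, ← Real.rpow_mul (by positivity), ← Real.rpow_neg_one]
  norm_num

lemma contDiff_regNewton {n : WithTop ℕ∞} : ContDiff ℝ n (regNewton ε) := by
  unfold regNewton
  exact (contDiff_normSq.add contDiff_const).rpow_const_of_ne fun u => by positivity

lemma pd_regNewton (i : Fin 3) (u : V) : pd i (regNewton ε) u = - (u i * regNewton ε u ^ 3) := by
  have hs : 0 < ‖u‖ ^ 2 + ε ^ 2 := by positivity
  have h1 : HasDerivAt (fun s : ℝ => s ^ (-(1 / 2) : ℝ)) (-(1 / 2) * (‖u‖ ^ 2 + ε ^ 2) ^ (-(1 / 2) - 1 : ℝ))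
      (‖u‖ ^ 2 + ε ^ 2) := Real.hasDerivAt_rpow_const (Or.inl hs.ne')
  have hd : DifferentiableAt ℝ (fun w : V => ‖w‖ ^ 2) u :=
    (contDiff_normSq (n := 1)).differentiable (by simp) u
  have h2 := pd_comp (f := fun w : V => ‖w‖ ^ 2 + ε ^ 2) (v := u) h1 (hd.add_const _) i
  have h3 : pd i (fun w : V => ‖w‖ ^ 2 + ε ^ 2) u = 2 * u i := by
    rw [pd_add hd (by fun_prop), pd_normSq, pd_const, add_zero]
  have h4 : regNewton ε u ^ 3 = (‖u‖ ^ 2 + ε ^ 2) ^ (-(1 / 2) - 1 : ℝ) := by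
    unfold regNewton
    rw [← Real.rpow_natCast, ← Real.rpow_mul hs.le]; norm_num
  change pd i (fun w : V => (‖w‖ ^ 2 + ε ^ 2) ^ (-(1 / 2) : ℝ)) u = _
  rw [h2, h3, h4]; ring

lemma differentiableAt_regNewton (u : V) : DifferentiableAt ℝ (regNewton ε) u :=
  (contDiff_regNewton hε (n := 1)).differentiable (by simp) u

lemma pd_regNewton_pow (n : ℕ) (i : Fin 3) (u : V) :
    pd i (fun w => regNewton ε w ^ n) u = - (n * u i * regNewton ε u ^ (n + 2)) := by
  rw [pd_comp (hasDerivAt_pow n _) (differentiableAt_regNewton hε u), pd_regNewton hε]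
  rcases n with _ | n
  · simp
  · simp only [Nat.add_sub_cancel]; push_cast; ring

lemma contDiff_regKer {n : WithTop ℕ∞} (i j : Fin 3) : ContDiff ℝ n (regKer ε i j) := by
  unfold regKer
  exact (contDiff_const.mul (contDiff_regNewton hε)).sub
    (((contDiff_coord i).mul (contDiff_coord j)).mul ((contDiff_regNewton hε).pow 3))

lemma pd_regKer (l i j : Fin 3) (u : V) : pd l (regKer ε i j) u =
    - (if i = j then 1 else 0) * u l * regNewton ε u ^ 3
      - ((if l = i then 1 else 0) * u j + u i * (if l = j then 1 else 0)) * regNewton ε u ^ 3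
      + 3 * u i * u j * u l * regNewton ε u ^ 5 := by
  have hq := differentiableAt_regNewton hε u
  have hi : DifferentiableAt ℝ (fun w : V => w i) u :=
    (contDiff_coord (n := 1) i).differentiable (by simp) u
  have hj : DifferentiableAt ℝ (fun w : V => w j) u :=
    (contDiff_coord (n := 1) j).differentiable (by simp) u
  unfold regKer
  have hq3 : DifferentiableAt ℝ (fun w => regNewton ε w ^ 3) u := hq.pow 3
  have hij : DifferentiableAt ℝ (fun w : V => w i * w j) u := hi.mul hj
  rw [pd_sub (hq.const_mul _) (hij.fun_mul hq3), pd_const_mul hq, pd_regNewton hε,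
    pd_mul hij hq3, pd_mul hi hj, pd_coord, pd_coord, pd_regNewton_pow hε]
  push_cast; ring

/-- The regularised kernel is the Hessian of (|u|² + ε²)^{1/2}, so its divergence is the gradient of
its trace. This is the source of ∇·A[f] = ∇a[f]. -/
lemma sum_pd_regKer (i : Fin 3) (u : V) :
    ∑ j, pd j (regKer ε i j) u = ∑ l, pd i (regKer ε l l) u := by
  simp only [pd_regKer hε, Fin.sum_univ_three]
  fin_cases i <;> simp <;> ring

/-- The right-hand side is minus an approximate Dirac mass: it concentrates at scale ε with total
mass independent of ε. -/
lemma laplace_regNewton (u : V) :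
    ∑ i, pd i (pd i (regNewton ε)) u = - (3 * ε ^ 2 * regNewton ε u ^ 5) := by
  have hq := differentiableAt_regNewton hε u
  have h : ∀ i, pd i (pd i (regNewton ε)) u
      = - regNewton ε u ^ 3 + 3 * u i ^ 2 * regNewton ε u ^ 5 := by
    intro i
    have hi : DifferentiableAt ℝ (fun w : V => w i) u :=
      (contDiff_coord (n := 1) i).differentiable (by simp) u
    have h1 : pd i (regNewton ε) = fun w => (-1) * (w i * regNewton ε w ^ 3) := by
      funext w; rw [pd_regNewton hε]; ring
    have hq3 : DifferentiableAt ℝ (fun w => regNewton ε w ^ 3) u := hq.pow 3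
    rw [h1, pd_const_mul (hi.fun_mul hq3), pd_mul hi hq3,
      pd_coord, pd_regNewton_pow hε, if_pos rfl]
    push_cast; ring
  have hs : (‖u‖ ^ 2 + ε ^ 2) * regNewton ε u ^ 2 = 1 := by
    rw [regNewton_sq hε]; exact mul_inv_cancel₀ (by positivity)
  simp only [h, Finset.sum_add_distrib, ← Finset.sum_mul, ← Finset.mul_sum]
  rw [← norm_sq_eq_sum]
  simp only [Finset.sum_const, Finset.card_univ, Fintype.card_fin, nsmul_eq_mul]
  push_cast
  linear_combination 3 * regNewton ε u ^ 3 * hs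

lemma norm_mul_regNewton_le (u : V) : ‖u‖ * regNewton ε u ≤ 1 := by
  have h1 := regNewton_sq hε u
  have h2 : (‖u‖ * regNewton ε u) ^ 2 ≤ 1 ^ 2 := by
    rw [mul_pow, h1, one_pow, ← div_eq_mul_inv, div_le_one (by positivity)]
    nlinarith
  exact (pow_le_pow_iff_left₀ (mul_nonneg (norm_nonneg _) (regNewton_pos hε u).le) one_pos.le
    two_ne_zero).1 h2

lemma regNewton_le_norm_inv {u : V} (hu : u ≠ 0) : regNewton ε u ≤ ‖u‖⁻¹ := by
  have := norm_mul_regNewton_le hε u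
  rw [← one_div, le_div_iff₀ (norm_pos_iff.2 hu), mul_comm]; exact this

lemma regNewton_le_inv (u : V) : regNewton ε u ≤ ε⁻¹ := by
  have h1 := regNewton_sq hε u
  have h2 : (ε * regNewton ε u) ^ 2 ≤ 1 ^ 2 := by
    rw [mul_pow, h1, one_pow, ← div_eq_mul_inv, div_le_one (by positivity)]
    nlinarith [sq_nonneg ‖u‖]
  have := (pow_le_pow_iff_left₀ (mul_nonneg hε.le (regNewton_pos hε u).le) one_pos.le
    two_ne_zero).1 h2
  rw [← one_div, le_div_iff₀ hε, mul_comm]; exact this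

/-- A bound uniform in ε by an integrable singularity, so that dominated convergence applies as ε →
0. -/
lemma abs_regKer_le {u : V} (hu : u ≠ 0) (i j : Fin 3) : |regKer ε i j u| ≤ 2 * ‖u‖⁻¹ := by
  have hq := regNewton_pos hε u
  have h1 := regNewton_le_norm_inv hε hu
  have h2 := norm_mul_regNewton_le hε u
  have h3 : |u i * u j * regNewton ε u ^ 3| ≤ regNewton ε u := by
    rw [abs_mul, abs_mul, abs_of_pos (pow_pos hq 3)]
    calc |u i| * |u j| * regNewton ε u ^ 3 ≤ ‖u‖ * ‖u‖ * regNewton ε u ^ 3 := by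
          gcongr <;> exact abs_coord_le u _
      _ = (‖u‖ * regNewton ε u) ^ 2 * regNewton ε u := by ring
      _ ≤ 1 * regNewton ε u := by
          gcongr; exact pow_le_one₀ (mul_nonneg (norm_nonneg _) hq.le) h2
      _ = _ := one_mul _
  have h4 : |(if i = j then (1 : ℝ) else 0) * regNewton ε u| ≤ regNewton ε u := by
    split_ifs <;> simp [abs_of_pos hq, hq.le]
  unfold regKer
  refine (abs_sub _ _).trans ?_
  linarith

end Reg

lemma tendsto_regNewton {u : V} (hu : u ≠ 0) :
    Tendsto (fun ε => regNewton ε u) (𝓝[>] 0) (𝓝 ‖u‖⁻¹) := by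
  have hc : ContinuousAt (fun ε : ℝ => regNewton ε u) 0 := by
    unfold regNewton
    refine ContinuousAt.rpow_const (by fun_prop) (Or.inl ?_)
    have := norm_pos_iff.2 hu; positivity
  have h0 : regNewton 0 u = ‖u‖⁻¹ := by
    unfold regNewton
    rw [zero_pow two_ne_zero, add_zero, ← Real.rpow_natCast, ← Real.rpow_mul (norm_nonneg _),
      ← Real.rpow_neg_one]
    norm_num
  rw [← h0]
  exact hc.tendsto.mono_left nhdsWithin_le_nhds

lemma tendsto_regKer {u : V} (hu : u ≠ 0) (i j : Fin 3) :
    Tendsto (fun ε => regKer ε i j u) (𝓝[>] 0) (𝓝 (ker i j u)) := by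
  have h := tendsto_regNewton hu
  have h2 : ker i j u = (if i = j then 1 else 0) * ‖u‖⁻¹ - u i * u j * (‖u‖⁻¹) ^ 3 := by
    have hn : ‖u‖ ≠ 0 := norm_ne_zero_iff.2 hu
    unfold ker proj
    simp only [Matrix.of_apply]
    field_simp
  rw [h2]
  exact (h.const_mul _).sub ((h.pow 3).const_mul _)

lemma isHomKernel_newton : IsHomKernel 1 (fun u : V => ‖u‖⁻¹) where
  smooth := by
    intro u hu
    have hu' : u ≠ 0 := hu
    exact ((contDiffAt_norm ℝ hu').inv (norm_ne_zero_iff.2 hu')).contDiffWithinAt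
  hom c hc u hu := by
    simp [norm_smul, abs_of_pos hc, mul_comm]

lemma sum_ker_diag (u : V) : ∑ l, ker l l u = 2 * ‖u‖⁻¹ := by
  by_cases hu : u = 0
  · simp [hu, ker]
  have hn : ‖u‖ ≠ 0 := norm_ne_zero_iff.2 hu
  have hs := norm_sq_eq_sum u
  unfold ker proj
  simp only [Matrix.of_apply, Fin.sum_univ_three, if_true] at hs ⊢
  field_simp
  rw [hs]; ring

lemma integrable_newton_mul {f : V → ℝ} (hc : Continuous f) (hf : Integrable f) (v : V) :
    Integrable fun z => ‖v - z‖⁻¹ * f z :=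
  integrable_kernel_mul isHomKernel_newton hc hf v

lemma scalA_eq {f : V → ℝ} (hc : Continuous f) (hf : Integrable f) (v : V) :
    scalA f v = 1 / (4 * Real.pi) * ∫ z, ‖v - z‖⁻¹ * f z := by
  simp only [scalA_eq_sum, matA_eq]
  rw [← Finset.mul_sum, ← integral_finsetSum _ fun i _ =>
    integrable_kernel_mul (isHomKernel_ker i i) hc hf v]
  simp only [← Finset.sum_mul, sum_ker_diag]
  simp only [mul_assoc, integral_const_mul]
  have := Real.pi_ne_zero
  set I := ∫ z, ‖v - z‖⁻¹ * f z
  field_simp; ring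

lemma measurable_ker (i j : Fin 3) : Measurable (ker i j) := by
  unfold ker proj
  simp only [Matrix.of_apply]
  refine Measurable.div ?_ measurable_norm
  refine measurable_const.sub (Measurable.div ?_ (measurable_norm.pow_const 2))
  exact ((contDiff_coord (n := 0) i).continuous.measurable).mul
    ((contDiff_coord (n := 0) j).continuous.measurable)

/-! ### Weak forms of ∇·A = ∇a and −Δa = cf -/

section Fubini

variable {f : V → ℝ} (hf2 : ContDiff ℝ 2 f) (h0 : ∀ v, 0 ≤ f v) (hf : Integrable f)
  {Y : V → ℝ} (hY : Continuous Y) (hYc : HasCompactSupport Y)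
include hf2 h0 hf hY hYc

/-- By Tonelli: the inner integral is a continuous potential, and the outer factor has compact
support. -/
lemma integrable_prod_newton :
    Integrable (fun p : V × V => ‖p.1 - p.2‖⁻¹ * f p.2 * Y p.1) (volume.prod volume) := by
  have hpot := (contDiff_potential isHomKernel_newton hf2 hf).continuous
  rw [integrable_prod_iff]
  · refine ⟨Eventually.of_forall fun v =>
      (integrable_newton_mul hf2.continuous hf v).mul_const (Y v), ?_⟩
    have : (fun v => ∫ z, ‖‖v - z‖⁻¹ * f z * Y v‖) = fun v => (∫ z, ‖v - z‖⁻¹ * f z) * ‖Y v‖ := by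
      funext v
      rw [← integral_mul_const]
      congr 1 with z
      rw [norm_mul, norm_mul, norm_inv, norm_norm, Real.norm_of_nonneg (h0 z)]
    simp only [this]
    exact (hpot.mul hY.norm).integrable_of_hasCompactSupport hYc.norm.mul_left
  · refine Measurable.aestronglyMeasurable ?_
    have := hf2.continuous
    fun_prop

lemma integrable_prod_kernel {H : V → ℝ} (hH : IsHomKernel 1 H) (hm : Measurable H) :
    Integrable (fun p : V × V => H (p.1 - p.2) * f p.2 * Y p.1) (volume.prod volume) := by
  obtain ⟨C, hC0, hC⟩ := hH.exists_bound
  have hi := (integrable_prod_newton hf2 h0 hf hY hYc).norm.const_mul (max C ‖H 0‖)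
  have hne : ∀ᵐ p : V × V ∂(volume.prod volume), p.1 - p.2 ≠ 0 := by
    have h1 : MeasurableSet {p : V × V | p.1 - p.2 ≠ 0} :=
      ((measurable_fst.sub measurable_snd) (measurableSet_singleton 0)).compl
    rw [Measure.ae_prod_iff_ae_ae h1]
    refine Eventually.of_forall fun v => ?_
    have : ∀ᵐ z : V, z ≠ v := by simp [ae_iff]
    filter_upwards [this] with z hz using sub_ne_zero.2 hz.symm
  refine hi.mono' ?_ ?_
  · refine Measurable.aestronglyMeasurable ?_
    have := hf2.continuous
    fun_prop
  · filter_upwards [hne] with p hp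
    rw [norm_mul, norm_mul, norm_mul, norm_mul, ← mul_assoc, ← mul_assoc]
    gcongr
    rw [norm_inv, norm_norm]
    refine (hC _ hp).trans ?_
    rw [pow_one]
    gcongr
    exact le_max_left _ _

/-- Fubini exchanges the potential of f against a test function for the potential of the test
function against f. Identities for a[f] and A[f] thus reduce to identities for a fixed centre z. -/
lemma integral_potential_mul {H : V → ℝ} (hH : IsHomKernel 1 H) (hm : Measurable H) :
    ∫ v, (∫ z, H (v - z) * f z) * Y v = ∫ z, f z * ∫ v, H (v - z) * Y v := by
  have hi := integrable_prod_kernel hf2 h0 hf hY hYc hH hm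
  have h1 : ∫ v, (∫ z, H (v - z) * f z) * Y v = ∫ v, ∫ z, H (v - z) * f z * Y v := by
    congr 1 with v; rw [integral_mul_const]
  rw [h1, integral_integral_swap (f := fun v z => H (v - z) * f z * Y v) hi]
  congr 1 with z
  rw [← integral_const_mul]
  congr 1 with v; ring

end Fubini

lemma integrable_kernel_mul' {H : V → ℝ} (hH : IsHomKernel 1 H) {Y : V → ℝ} (hY : Continuous Y)
    (hYc : HasCompactSupport Y) (z : V) : Integrable fun v => H (v - z) * Y v := by
  have hi : Integrable (fun u => H u * Y (u + z)) := by
    have hc : HasCompactSupport (fun u => Y (u + z)) := hYc.comp_homeomorph (Homeomorph.addRight z)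
    have h1 := hH.locallyIntegrable.integrable_smul_right_of_hasCompactSupport
      (g := fun u => Y (u + z)) (by fun_prop) hc
    simpa [smul_eq_mul] using h1
  simpa using hi.comp_sub_right z

section Kernel

variable {Y : V → ℝ} (hY : Continuous Y) (hYc : HasCompactSupport Y)
include hY hYc

/-- Removes the regularisation at a fixed centre, with dominating function C |v − z|⁻¹ |Y|. -/
lemma tendsto_integral_regular {H : V → ℝ} {K : ℝ → V → ℝ} {C : ℝ}
    (hKc : ∀ ε, 0 < ε → Continuous (K ε)) (hKb : ∀ ε, 0 < ε → ∀ u, u ≠ 0 → |K ε u| ≤ C * ‖u‖⁻¹)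
    (hKt : ∀ u, u ≠ 0 → Tendsto (fun ε => K ε u) (𝓝[>] 0) (𝓝 (H u))) (z : V) :
    Tendsto (fun ε => ∫ v, K ε (v - z) * Y v) (𝓝[>] 0) (𝓝 (∫ v, H (v - z) * Y v)) := by
  have hne : ∀ᵐ v : V, v ≠ z := by simp [ae_iff]
  refine tendsto_integral_filter_of_dominated_convergence (fun v => C * (‖v - z‖⁻¹ * ‖Y v‖)) ?_ ?_ ?_ ?_
  · filter_upwards [self_mem_nhdsWithin] with ε hε
    exact (((hKc ε hε).comp (continuous_sub_right z)).mul hY).aestronglyMeasurable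
  · filter_upwards [self_mem_nhdsWithin] with ε hε
    filter_upwards [hne] with v hv
    rw [norm_mul, ← mul_assoc]
    gcongr
    exact hKb ε hε _ (sub_ne_zero.2 hv)
  · exact (integrable_kernel_mul' isHomKernel_newton hY.norm hYc.norm z).const_mul C
  · filter_upwards [hne] with v hv
    exact (hKt _ (sub_ne_zero.2 hv)).mul_const _

end Kernel

/-- For ε > 0 both sides can be integrated by parts and agree pointwise by `sum_pd_regKer`. Both
then converge as ε → 0, since the derivatives lie on the test field again. -/
lemma integral_ker_div_eq {X : Fin 3 → V → ℝ} (hX : ∀ i, ContDiff ℝ 1 (X i))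
    (hXc : ∀ i, HasCompactSupport (X i)) (z : V) :
    ∑ i, ∑ l, ∫ v, ker l l (v - z) * pd i (X i) v = ∑ i, ∑ j, ∫ v, ker i j (v - z) * pd j (X i) v := by
  have lim : ∀ a b i j : Fin 3, Tendsto (fun ε => ∫ v, regKer ε a b (v - z) * pd i (X j) v) (𝓝[>] 0)
      (𝓝 (∫ v, ker a b (v - z) * pd i (X j) v)) := fun a b i j =>
    tendsto_integral_regular (continuous_pd (hX j) i) (HasCompactSupport.pd (hXc j) i)
      (fun ε hε => (contDiff_regKer hε a b (n := 1)).continuous)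
      (fun ε hε u hu => abs_regKer_le hε hu a b) (fun u hu => tendsto_regKer hu a b) z
  refine tendsto_nhds_unique_of_eventuallyEq
    (tendsto_finsetSum _ fun i _ => tendsto_finsetSum _ fun l _ => lim l l i i)
    (tendsto_finsetSum _ fun i _ => tendsto_finsetSum _ fun j _ => lim i j j i) ?_
  filter_upwards [self_mem_nhdsWithin] with ε hε
  have hε : 0 < ε := hε
  have ibp : ∀ a b i j : Fin 3, ∫ v, regKer ε a b (v - z) * pd i (X j) v
      = - ∫ v, pd i (regKer ε a b) (v - z) * X j v := by
    intro a b i j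
    rw [integral_mul_pd (f := fun v => regKer ε a b (v - z))
      ((contDiff_regKer hε a b).comp (contDiff_id.sub contDiff_const)) (hX j) (hXc j)]
    simp only [pd_comp_sub]
  have int : ∀ a b i j : Fin 3, Integrable fun v => pd i (regKer ε a b) (v - z) * X j v := by
    intro a b i j
    exact (((continuous_pd (contDiff_regKer hε a b) i).comp (continuous_sub_right z)).mul
      (hX j).continuous).integrable_of_hasCompactSupport (hXc j).mul_left
  simp only [ibp, Finset.sum_neg_distrib]
  congr 1
  refine Finset.sum_congr rfl fun i _ => ?_
  rw [← integral_finsetSum _ fun l _ => int l l i i, ← integral_finsetSum _ fun j _ => int i j j i]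
  congr 1 with v
  rw [← Finset.sum_mul, ← Finset.sum_mul, sum_pd_regKer hε]

section Weak

variable {f : V → ℝ} (hf2 : ContDiff ℝ 2 f) (h0 : ∀ v, 0 ≤ f v) (hf : Integrable f)
include hf2 h0 hf

lemma integral_matA_mul {Y : V → ℝ} (hY : Continuous Y) (hYc : HasCompactSupport Y) (i j : Fin 3) :
    ∫ v, matA f v i j * Y v = 1 / (8 * Real.pi) * ∫ z, f z * ∫ v, ker i j (v - z) * Y v := by
  rw [← integral_potential_mul hf2 h0 hf hY hYc (isHomKernel_ker i j) (measurable_ker i j),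
    ← integral_const_mul]
  congr 1 with v
  rw [matA_eq, mul_assoc]

lemma integrable_mul_inner {Y : V → ℝ} (hY : Continuous Y) (hYc : HasCompactSupport Y)
    (i j : Fin 3) : Integrable fun z => f z * ∫ v, ker i j (v - z) * Y v := by
  have := (integrable_prod_kernel hf2 h0 hf hY hYc (isHomKernel_ker i j)
    (measurable_ker i j)).integral_prod_right
  refine this.congr (Eventually.of_forall fun z => ?_)
  simp only
  rw [← integral_const_mul]
  congr 1 with v; ring

/-- Weak form of `∇ · A[f] = ∇ a[f]`. -/
lemma integral_grad_scalA_mul {X : Fin 3 → V → ℝ} (hX : ∀ i, ContDiff ℝ 1 (X i))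
    (hXc : ∀ i, HasCompactSupport (X i)) :
    ∑ i, ∫ v, pd i (scalA f) v * X i v = - ∑ i, ∑ j, ∫ v, matA f v i j * pd j (X i) v := by
  have ha : ContDiff ℝ 1 (scalA f) := (contDiff_scalA hf2 hf).of_le (by norm_num)
  have h1 : ∀ i, ∫ v, pd i (scalA f) v * X i v = - ∑ l, ∫ v, matA f v l l * pd i (X i) v := by
    intro i
    have := integral_mul_pd ha (hX i) (hXc i) i
    rw [eq_neg_iff_add_eq_zero, add_comm, ← eq_neg_iff_add_eq_zero, ← this,
      ← integral_finsetSum]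
    · congr 1 with v
      rw [scalA_eq_sum, Finset.sum_mul]
    · intro l _
      exact ((contDiff_matA hf2 hf l l).continuous.mul
        (continuous_pd (hX i) i)).integrable_of_hasCompactSupport (HasCompactSupport.pd (hXc i) i).mul_left
  simp only [h1, Finset.sum_neg_distrib]
  congr 1
  have c : ∀ i j, Continuous (pd i (X j)) := fun i j => continuous_pd (hX j) i
  have cc : ∀ i j, HasCompactSupport (pd i (X j)) := fun i j => HasCompactSupport.pd (hXc j) i
  simp only [integral_matA_mul hf2 h0 hf (c _ _) (cc _ _), ← Finset.mul_sum]
  congr 1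
  have int := fun i j a b => integrable_mul_inner hf2 h0 hf (c a b) (cc a b) i j
  simp only [← integral_finsetSum _ fun l _ => int l l _ _,
    ← integral_finsetSum _ fun j _ => int _ j j _]
  rw [← integral_finsetSum _ fun i _ => integrable_finsetSum _ fun l _ => int l l i i,
    ← integral_finsetSum _ fun i _ => integrable_finsetSum _ fun j _ => int i j j i]
  congr 1 with z
  simp only [← Finset.mul_sum]
  rw [integral_ker_div_eq hX hXc z]

end Weak

lemma regNewton_smul {ε : ℝ} (hε : 0 < ε) (x : V) : regNewton ε (ε • x) = ε⁻¹ * regNewton 1 x := by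
  unfold regNewton
  rw [norm_smul, Real.norm_of_nonneg hε.le,
    show (ε * ‖x‖) ^ 2 + ε ^ 2 = ε ^ 2 * (‖x‖ ^ 2 + 1 ^ 2) by ring,
    Real.mul_rpow (by positivity) (by positivity), ← Real.rpow_natCast, ← Real.rpow_mul hε.le,
    ← Real.rpow_neg_one]
  norm_num

lemma integrable_regNewton_pow : Integrable fun x => 3 * regNewton 1 x ^ 5 := by
  have h := integrable_rpow_neg_one_add_norm_sq (E := V) (μ := volume) (r := 5) (by simp; norm_num)
  refine (h.const_mul 3).congr (Eventually.of_forall fun x => ?_)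
  simp only [regNewton]
  rw [← Real.rpow_natCast (_ ^ (-(1 / 2) : ℝ)) 5, ← Real.rpow_mul (by positivity)]
  norm_num [add_comm]

/-- The constant in `-Δ |·|⁻¹ = c δ₀`. -/
noncomputable def newtonConst : ℝ := ∫ x, 3 * regNewton 1 x ^ 5

lemma newtonConst_nonneg : 0 ≤ newtonConst :=
  integral_nonneg fun x => by have := regNewton_pos one_pos x; positivity

/-- Two integrations by parts put the Laplacian on the regularised kernel. The substitution v = z +
εx turns the result into an average of Ψ(z + εx) against a fixed integrable profile, whose limit is
the value at z. The constant is 4π, but only its sign is used later. -/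
lemma integral_newton_laplace {Ψ : V → ℝ} (hΨ : ContDiff ℝ 2 Ψ) (hc : HasCompactSupport Ψ) (z : V) :
    ∫ v, ‖v - z‖⁻¹ * ∑ i, pd i (pd i Ψ) v = - newtonConst * Ψ z := by
  have hp : ∀ i, ContDiff ℝ 1 (pd i Ψ) := fun i => contDiff_pd hΨ (by norm_num) i
  have hpc : ∀ i, HasCompactSupport (pd i Ψ) := fun i => HasCompactSupport.pd hc i
  have hY : Continuous fun v => ∑ i, pd i (pd i Ψ) v :=
    continuous_finsetSum _ fun i _ => continuous_pd (hp i) i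
  have hYc : HasCompactSupport fun v => ∑ i, pd i (pd i Ψ) v := by
    refine HasCompactSupport.intro hc fun x hx => ?_
    refine Finset.sum_eq_zero fun i _ => ?_
    have h1 := (HasCompactSupport.pd (hpc i) i)
    have h2 : tsupport (pd i Ψ) ⊆ tsupport Ψ := tsupport_fderiv_apply_subset ℝ _
    have h3 : tsupport (pd i (pd i Ψ)) ⊆ tsupport (pd i Ψ) := tsupport_fderiv_apply_subset ℝ _
    exact image_eq_zero_of_notMem_tsupport fun h => hx (h2 (h3 h))
  have lim1 := tendsto_integral_regular hY hYc (H := fun u => ‖u‖⁻¹) (K := regNewton) (C := 1)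
    (fun ε hε => (contDiff_regNewton hε (n := 1)).continuous)
    (fun ε hε u hu => by
      rw [abs_of_pos (regNewton_pos hε u), one_mul]; exact regNewton_le_norm_inv hε hu)
    (fun u hu => tendsto_regNewton hu) z
  have lim2 : Tendsto (fun ε : ℝ => - ∫ x, 3 * regNewton 1 x ^ 5 * Ψ (ε • x + z)) (𝓝[>] 0)
      (𝓝 (- ∫ x, 3 * regNewton 1 x ^ 5 * Ψ ((0 : ℝ) • x + z))) := by
    obtain ⟨B, hB⟩ := hΨ.continuous.bounded_above_of_compact_support hc
    refine (tendsto_integral_filter_of_dominated_convergence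
      (fun x => 3 * regNewton 1 x ^ 5 * B) ?_ ?_ ?_ ?_).neg
    · refine Eventually.of_forall fun ε => Continuous.aestronglyMeasurable ?_
      have := hΨ.continuous
      have := (contDiff_regNewton one_pos (n := 1)).continuous
      fun_prop
    · refine Eventually.of_forall fun ε => Eventually.of_forall fun x => ?_
      have := regNewton_pos one_pos x
      rw [norm_mul, Real.norm_of_nonneg (by positivity)]
      gcongr; exact hB _
    · exact integrable_regNewton_pow.mul_const _
    · refine Eventually.of_forall fun x => ?_
      have : Continuous fun ε : ℝ => 3 * regNewton 1 x ^ 5 * Ψ (ε • x + z) := by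
        have := hΨ.continuous
        fun_prop
      exact this.continuousAt.tendsto.mono_left nhdsWithin_le_nhds
  have h := tendsto_nhds_unique_of_eventuallyEq lim1 lim2 ?_
  · rw [h]
    simp only [zero_smul, zero_add, integral_mul_const, newtonConst, neg_mul]
  filter_upwards [self_mem_nhdsWithin] with ε hε
  have hε : 0 < ε := hε
  have hq2 : ContDiff ℝ 2 (fun v => regNewton ε (v - z)) :=
    (contDiff_regNewton hε).comp (contDiff_id.sub contDiff_const)
  have e1 : ∫ v, regNewton ε (v - z) * ∑ i, pd i (pd i Ψ) v
      = ∑ i, ∫ v, regNewton ε (v - z) * pd i (pd i Ψ) v := by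
    rw [← integral_finsetSum]
    · simp only [Finset.mul_sum]
    · intro i _
      exact (hq2.continuous.mul (continuous_pd (hp i) i)).integrable_of_hasCompactSupport
        (HasCompactSupport.pd (hpc i) i).mul_left
  have e2 : ∀ i, ∫ v, regNewton ε (v - z) * pd i (pd i Ψ) v
      = ∫ v, pd i (pd i (regNewton ε)) (v - z) * Ψ v := by
    intro i
    have hq1 : ContDiff ℝ 1 (pd i (fun v => regNewton ε (v - z))) :=
      contDiff_pd hq2 (by norm_num) i
    rw [integral_mul_pd (hq2.of_le (by norm_num)) (hp i) (hpc i),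
      integral_mul_pd hq1 (hΨ.of_le (by norm_num)) hc, neg_neg]
    have : pd i (fun v => regNewton ε (v - z)) = fun v => pd i (regNewton ε) (v - z) := by
      funext v; exact pd_comp_sub _ _ _ _
    rw [this]; simp only [pd_comp_sub]
  have e3 : ∑ i, ∫ v, pd i (pd i (regNewton ε)) (v - z) * Ψ v
      = - ∫ v, 3 * ε ^ 2 * regNewton ε (v - z) ^ 5 * Ψ v := by
    rw [← integral_finsetSum, ← integral_neg]
    · congr 1 with v
      rw [← Finset.sum_mul, laplace_regNewton hε]; ring
    · intro i _
      have hq1 : ContDiff ℝ 1 (pd i (regNewton ε)) :=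
        contDiff_pd (contDiff_regNewton hε (n := 2)) (by norm_num) i
      exact (((continuous_pd hq1 i).comp (continuous_sub_right z)).mul
        hΨ.continuous).integrable_of_hasCompactSupport hc.mul_left
  rw [e1, Finset.sum_congr rfl fun i _ => e2 i, e3]
  congr 1
  have e4 : ∫ v, 3 * ε ^ 2 * regNewton ε (v - z) ^ 5 * Ψ v
      = ∫ u, 3 * ε ^ 2 * regNewton ε u ^ 5 * Ψ (u + z) := by
    rw [← integral_sub_right_eq_self (fun u => 3 * ε ^ 2 * regNewton ε u ^ 5 * Ψ (u + z)) z]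
    simp
  have e5 := Measure.integral_comp_smul (volume : Measure V)
    (fun u => 3 * ε ^ 2 * regNewton ε u ^ 5 * Ψ (u + z)) ε
  simp only [finrank_euclideanSpace, Fintype.card_fin, smul_eq_mul] at e5
  rw [e4]
  have e6 : ∫ u, 3 * ε ^ 2 * regNewton ε u ^ 5 * Ψ (u + z)
      = ε ^ 3 * ∫ x, 3 * ε ^ 2 * regNewton ε (ε • x) ^ 5 * Ψ (ε • x + z) := by
    rw [e5, abs_of_pos (by positivity), ← mul_assoc, mul_inv_cancel₀ (by positivity), one_mul]
  rw [e6, ← integral_const_mul]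
  congr 1 with x
  rw [regNewton_smul hε]
  field_simp

section Weak

variable {f : V → ℝ} (hf2 : ContDiff ℝ 2 f) (h0 : ∀ v, 0 ≤ f v) (hf : Integrable f)
include hf2 h0 hf

lemma integral_scalA_mul {Y : V → ℝ} (hY : Continuous Y) (hYc : HasCompactSupport Y) :
    ∫ v, scalA f v * Y v = 1 / (4 * Real.pi) * ∫ z, f z * ∫ v, ‖v - z‖⁻¹ * Y v := by
  rw [← integral_potential_mul hf2 h0 hf hY hYc isHomKernel_newton (by fun_prop),
    ← integral_const_mul]
  congr 1 with v
  rw [scalA_eq hf2.continuous hf, mul_assoc]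

omit h0 in
lemma integral_grad_scalA_mul_eq {X : Fin 3 → V → ℝ} (hX : ∀ i, ContDiff ℝ 1 (X i))
    (hXc : ∀ i, HasCompactSupport (X i)) :
    ∑ i, ∫ v, pd i (scalA f) v * X i v = - ∫ v, scalA f v * ∑ i, pd i (X i) v := by
  have ha : ContDiff ℝ 1 (scalA f) := (contDiff_scalA hf2 hf).of_le (by norm_num)
  simp only [Finset.mul_sum]
  rw [integral_finsetSum]
  · rw [← Finset.sum_neg_distrib]
    refine Finset.sum_congr rfl fun i _ => ?_
    rw [integral_mul_pd ha (hX i) (hXc i), neg_neg]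
  · intro i _
    exact (ha.continuous.mul (continuous_pd (hX i) i)).integrable_of_hasCompactSupport
      (HasCompactSupport.pd (hXc i) i).mul_left

/-- Weak form of `-Δ a[f] = c f`. -/
lemma integral_grad_scalA_mul_grad {Ψ : V → ℝ} (hΨ : ContDiff ℝ 2 Ψ) (hc : HasCompactSupport Ψ) :
    ∑ i, ∫ v, pd i (scalA f) v * pd i Ψ v = newtonConst / (4 * Real.pi) * ∫ v, f v * Ψ v := by
  have hp : ∀ i, ContDiff ℝ 1 (pd i Ψ) := fun i => contDiff_pd hΨ (by norm_num) i
  have hpc : ∀ i, HasCompactSupport (pd i Ψ) := fun i => HasCompactSupport.pd hc i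
  have hY : Continuous fun v => ∑ i, pd i (pd i Ψ) v :=
    continuous_finsetSum _ fun i _ => continuous_pd (hp i) i
  have hYc : HasCompactSupport fun v => ∑ i, pd i (pd i Ψ) v := by
    simp only [Fin.sum_univ_three]
    exact ((HasCompactSupport.pd (hpc 0) 0).add (HasCompactSupport.pd (hpc 1) 1)).add
      (HasCompactSupport.pd (hpc 2) 2)
  rw [integral_grad_scalA_mul_eq hf2 hf hp hpc, integral_scalA_mul hf2 h0 hf hY hYc]
  simp only [integral_newton_laplace hΨ hc]
  have : ∀ z, f z * (-newtonConst * Ψ z) = -newtonConst * (f z * Ψ z) := fun z => by ring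
  simp only [this, integral_const_mul]
  ring

/-- The drift term against a gradient, bounded after symmetrisation. -/
lemma abs_integral_grad_scalA_le {φ : V → ℝ} (hφ : ContDiff ℝ 2 φ) (hc : HasCompactSupport φ)
    {L : ℝ} (hL : ∀ i v z, |pd i φ v - pd i φ z| ≤ L * ‖v - z‖)
    (hQ : Integrable (fun p : V × V => ‖p.1 - p.2‖⁻¹ * f p.2 * f p.1) (volume.prod volume)) :
    |∑ i, ∫ v, pd i (scalA f) v * (f v * pd i φ v)| ≤
      3 * L * ∫ p : V × V, ‖p.1 - p.2‖⁻¹ * f p.2 * f p.1 ∂(volume.prod volume) := by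
  have hp : ∀ i, ContDiff ℝ 1 (pd i φ) := fun i => contDiff_pd hφ (by norm_num) i
  have hpc : ∀ i, HasCompactSupport (pd i φ) := fun i => HasCompactSupport.pd hc i
  set X : Fin 3 → V → ℝ := fun i v => f v * pd i φ v with hXdef
  have hX : ∀ i, ContDiff ℝ 1 (X i) := fun i => (hf2.of_le (by norm_num)).mul (hp i)
  have hXc : ∀ i, HasCompactSupport (X i) := fun i => (hpc i).mul_left
  set Y : V → ℝ := fun v => ∑ i, pd i (X i) v with hYdef
  have hY : Continuous Y := continuous_finsetSum _ fun i _ => continuous_pd (hX i) i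
  have hYc : HasCompactSupport Y := by
    simp only [hYdef, Fin.sum_univ_three]
    exact ((HasCompactSupport.pd (hXc 0) 0).add (HasCompactSupport.pd (hXc 1) 1)).add
      (HasCompactSupport.pd (hXc 2) 2)
  set Q := ∫ p : V × V, ‖p.1 - p.2‖⁻¹ * f p.2 * f p.1 ∂(volume.prod volume) with hQdef
  have hL0 : 0 ≤ L := by
    have := (abs_nonneg _).trans (hL 0 (EuclideanSpace.single 0 1) 0)
    simpa using this
  have hQ0 : 0 ≤ Q := integral_nonneg fun p => by
    have := h0 p.1; have := h0 p.2; positivity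
  have hne : ∀ᵐ p : V × V ∂(volume.prod volume), p.1 - p.2 ≠ 0 := by
    have h1 : MeasurableSet {p : V × V | p.1 - p.2 ≠ 0} :=
      ((measurable_fst.sub measurable_snd) (measurableSet_singleton 0)).compl
    rw [Measure.ae_prod_iff_ae_ae h1]
    refine Eventually.of_forall fun v => ?_
    have : ∀ᵐ z : V, z ≠ v := by simp [ae_iff]
    filter_upwards [this] with z hz using sub_ne_zero.2 hz.symm
  -- Symmetrisation requires an absolutely integrable double integral involving ∇ of the kernel, so
  -- it is done for the regularised kernel, with a bound independent of ε.
  have key : ∀ ε, 0 < ε →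
      |∫ p : V × V, regNewton ε (p.1 - p.2) * f p.2 * Y p.1 ∂(volume.prod volume)| ≤ 3 * L * Q := by
    intro ε hε
    have hqc : Continuous (regNewton ε) := (contDiff_regNewton hε (n := 1)).continuous
    have bint : ∀ (q : V → ℝ) (B : ℝ), Continuous q → (∀ u, ‖q u‖ ≤ B) → ∀ (x y : V → ℝ),
        Integrable x → Integrable y →
        Integrable (fun p : V × V => q (p.1 - p.2) * (x p.1 * y p.2)) (volume.prod volume) := by
      intro q B hq hB x y hx hy
      exact (hx.mul_prod hy).bdd_mul (c := B)
        (hq.comp (continuous_fst.sub continuous_snd)).aestronglyMeasurable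
        (Eventually.of_forall fun p => hB _)
    have hq3 : ∀ i u, |pd i (regNewton ε) u| ≤ ε⁻¹ ^ 2 := by
      intro i u
      have hqp := regNewton_pos hε u
      rw [pd_regNewton hε, abs_neg, abs_mul, abs_of_pos (pow_pos hqp 3)]
      calc |u i| * regNewton ε u ^ 3 ≤ ‖u‖ * regNewton ε u ^ 3 := by
            gcongr; exact abs_coord_le u i
        _ = (‖u‖ * regNewton ε u) * regNewton ε u ^ 2 := by ring
        _ ≤ 1 * ε⁻¹ ^ 2 := by
            gcongr
            · exact norm_mul_regNewton_le hε u
            · exact regNewton_le_inv hε u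
        _ = _ := one_mul _
    have hqi : ∀ i, Continuous (pd i (regNewton ε)) :=
      fun i => continuous_pd (contDiff_regNewton hε) i
    have hXi : ∀ i, Integrable (X i) := fun i =>
      (hX i).continuous.integrable_of_hasCompactSupport (hXc i)
    have hYi : Integrable Y := hY.integrable_of_hasCompactSupport hYc
    have i1 := fun i => bint (pd i (regNewton ε)) _ (hqi i) (hq3 i) (X i) f (hXi i) hf
    have i2 := fun i => bint (pd i (regNewton ε)) _ (hqi i) (hq3 i) f (X i) hf (hXi i)
    have step1 : ∫ p : V × V, regNewton ε (p.1 - p.2) * f p.2 * Y p.1 ∂(volume.prod volume)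
        = - ∑ i, ∫ p : V × V, pd i (regNewton ε) (p.1 - p.2) * (X i p.1 * f p.2)
            ∂(volume.prod volume) := by
      have hb := bint (regNewton ε) ε⁻¹ hqc (fun u => by
        rw [Real.norm_of_nonneg (regNewton_pos hε u).le]; exact regNewton_le_inv hε u) Y f hYi hf
      have hb' : Integrable (fun p : V × V => regNewton ε (p.1 - p.2) * f p.2 * Y p.1)
          (volume.prod volume) := by
        refine hb.congr (Eventually.of_forall fun p => ?_)
        simp only; ring
      rw [integral_prod_symm _ hb', ← integral_finsetSum _ fun i _ => i1 i,
        integral_prod_symm _ (integrable_finsetSum _ fun i _ => i1 i), ← integral_neg]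
      congr 1 with z
      simp only
      have hs : ∀ i, Integrable fun v => regNewton ε (v - z) * pd i (X i) v := fun i =>
        ((hqc.comp (continuous_sub_right z)).mul
          (continuous_pd (hX i) i)).integrable_of_hasCompactSupport
          (HasCompactSupport.pd (hXc i) i).mul_left
      have hs' : ∀ i, Integrable fun v => pd i (regNewton ε) (v - z) * X i v := fun i =>
        (((hqi i).comp (continuous_sub_right z)).mul
          (hX i).continuous).integrable_of_hasCompactSupport (hXc i).mul_left
      have : ∀ i, ∫ v, regNewton ε (v - z) * pd i (X i) v
          = - ∫ v, pd i (regNewton ε) (v - z) * X i v := by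
        intro i
        rw [integral_mul_pd (f := fun v => regNewton ε (v - z))
          ((contDiff_regNewton hε).comp (contDiff_id.sub contDiff_const)) (hX i) (hXc i)]
        simp only [pd_comp_sub]
      calc ∫ v, regNewton ε (v - z) * f z * Y v
          = f z * ∑ i, ∫ v, regNewton ε (v - z) * pd i (X i) v := by
            rw [← integral_finsetSum _ fun i _ => hs i, ← integral_const_mul]
            congr 1 with v
            rw [hYdef, ← Finset.mul_sum]; ring
        _ = - (f z * ∑ i, ∫ v, pd i (regNewton ε) (v - z) * X i v) := by
            simp only [this, Finset.sum_neg_distrib]; ring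
        _ = _ := by
            rw [← integral_finsetSum _ fun i _ => hs' i, ← integral_const_mul]
            congr 2 with v
            rw [Finset.mul_sum]
            exact Finset.sum_congr rfl fun i _ => by ring
    -- The gradient of an even kernel is odd, so exchanging the two variables changes the sign.
    have step2 : ∀ i, ∫ p : V × V, pd i (regNewton ε) (p.1 - p.2) * (X i p.1 * f p.2)
          ∂(volume.prod volume)
        = - ∫ p : V × V, pd i (regNewton ε) (p.1 - p.2) * (f p.1 * X i p.2) ∂(volume.prod volume) := by
      intro i
      rw [← integral_prod_swap, ← integral_neg]
      congr 1 with p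
      simp only [Prod.fst_swap, Prod.snd_swap]
      have : pd i (regNewton ε) (p.2 - p.1) = - pd i (regNewton ε) (p.1 - p.2) := by
        rw [pd_regNewton hε, pd_regNewton hε]
        have h1 : regNewton ε (p.2 - p.1) = regNewton ε (p.1 - p.2) := by
          unfold regNewton; rw [norm_sub_rev]
        rw [h1]; simp only [PiLp.sub_apply]; ring
      rw [this]; ring
    -- Averaging the two forms leaves f(v) f(z) (∂ᵢφ(v) − ∂ᵢφ(z)). The Lipschitz bound on ∂ᵢφ gains
    -- a factor |v − z| and reduces the |v − z|⁻² singularity to |v − z|⁻¹.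
    have step3 : 2 * ∑ i, ∫ p : V × V, pd i (regNewton ε) (p.1 - p.2) * (X i p.1 * f p.2)
          ∂(volume.prod volume)
        = ∫ p : V × V, ∑ i, pd i (regNewton ε) (p.1 - p.2) * (X i p.1 * f p.2 - f p.1 * X i p.2)
          ∂(volume.prod volume) := by
      rw [integral_finsetSum, Finset.mul_sum]
      · refine Finset.sum_congr rfl fun i _ => ?_
        simp only [mul_sub]
        rw [integral_sub (i1 i) (i2 i)]
        linarith [step2 i]
      · intro i _
        simp only [mul_sub]
        exact (i1 i).sub (i2 i)
    have step4 : |∫ p : V × V, ∑ i, pd i (regNewton ε) (p.1 - p.2) *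
        (X i p.1 * f p.2 - f p.1 * X i p.2) ∂(volume.prod volume)| ≤ 3 * L * Q := by
      rw [← Real.norm_eq_abs, hQdef, ← integral_const_mul]
      refine norm_integral_le_of_norm_le (hQ.const_mul (3 * L)) ?_
      filter_upwards [hne] with p hp
      have hfp : 0 ≤ f p.1 * f p.2 := mul_nonneg (h0 _) (h0 _)
      have hnp := norm_pos_iff.2 hp
      have hqp := regNewton_pos hε (p.1 - p.2)
      have term : ∀ i, ‖pd i (regNewton ε) (p.1 - p.2) * (X i p.1 * f p.2 - f p.1 * X i p.2)‖
          ≤ L * (‖p.1 - p.2‖⁻¹ * f p.2 * f p.1) := by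
        intro i
        have e : X i p.1 * f p.2 - f p.1 * X i p.2
            = (f p.1 * f p.2) * (pd i φ p.1 - pd i φ p.2) := by simp only [hXdef]; ring
        have hq : |pd i (regNewton ε) (p.1 - p.2)| * ‖p.1 - p.2‖ ≤ ‖p.1 - p.2‖⁻¹ := by
          rw [pd_regNewton hε, abs_neg, abs_mul, abs_of_pos (pow_pos hqp 3)]
          calc |(p.1 - p.2) i| * regNewton ε (p.1 - p.2) ^ 3 * ‖p.1 - p.2‖
              ≤ ‖p.1 - p.2‖ * regNewton ε (p.1 - p.2) ^ 3 * ‖p.1 - p.2‖ := by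
                gcongr; exact abs_coord_le _ i
            _ = (‖p.1 - p.2‖ * regNewton ε (p.1 - p.2)) ^ 2 * regNewton ε (p.1 - p.2) := by ring
            _ ≤ 1 * ‖p.1 - p.2‖⁻¹ := by
                gcongr
                · exact pow_le_one₀ (by positivity) (norm_mul_regNewton_le hε _)
                · exact regNewton_le_norm_inv hε hp
            _ = _ := one_mul _
        rw [e, Real.norm_eq_abs, abs_mul, abs_mul, abs_of_nonneg hfp]
        calc |pd i (regNewton ε) (p.1 - p.2)| * (f p.1 * f p.2 * |pd i φ p.1 - pd i φ p.2|)
            ≤ |pd i (regNewton ε) (p.1 - p.2)| * (f p.1 * f p.2 * (L * ‖p.1 - p.2‖)) := by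
              gcongr; exact hL i _ _
          _ = (|pd i (regNewton ε) (p.1 - p.2)| * ‖p.1 - p.2‖) * (L * (f p.1 * f p.2)) := by ring
          _ ≤ ‖p.1 - p.2‖⁻¹ * (L * (f p.1 * f p.2)) := by gcongr
          _ = _ := by ring
      refine (norm_sum_le _ _).trans ((Finset.sum_le_sum fun i _ => term i).trans ?_)
      simp only [Finset.sum_const, Finset.card_univ, Fintype.card_fin, nsmul_eq_mul]
      push_cast; exact (by ring : _ = _).le
    rw [step1, abs_neg]
    rw [← step3, abs_mul, abs_two] at step4
    have : 0 ≤ 3 * L * Q := by positivity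
    linarith [abs_nonneg (∑ i, ∫ p : V × V, pd i (regNewton ε) (p.1 - p.2) * (X i p.1 * f p.2)
          ∂(volume.prod volume))]
  have hi := integrable_prod_newton hf2 h0 hf hY hYc
  have lim : Tendsto (fun ε => ∫ p : V × V, regNewton ε (p.1 - p.2) * f p.2 * Y p.1
      ∂(volume.prod volume)) (𝓝[>] 0)
      (𝓝 (∫ p : V × V, ‖p.1 - p.2‖⁻¹ * f p.2 * Y p.1 ∂(volume.prod volume))) := by
    refine tendsto_integral_filter_of_dominated_convergence
      (fun p => ‖‖p.1 - p.2‖⁻¹ * f p.2 * Y p.1‖) ?_ ?_ hi.norm ?_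
    · filter_upwards [self_mem_nhdsWithin] with ε hε
      have := (contDiff_regNewton (show 0 < ε from hε) (n := 1)).continuous
      have := hf2.continuous
      exact Continuous.aestronglyMeasurable (by fun_prop)
    · filter_upwards [self_mem_nhdsWithin] with ε hε
      filter_upwards [hne] with p hp
      rw [norm_mul, norm_mul, norm_mul, norm_mul, norm_inv, norm_norm,
        Real.norm_of_nonneg (regNewton_pos hε _).le]
      gcongr
      exact regNewton_le_norm_inv hε hp
    · filter_upwards [hne] with p hp
      exact ((tendsto_regNewton hp).mul_const _).mul_const _
  have hI : |∫ p : V × V, ‖p.1 - p.2‖⁻¹ * f p.2 * Y p.1 ∂(volume.prod volume)| ≤ 3 * L * Q := by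
    refine le_of_tendsto lim.abs ?_
    filter_upwards [self_mem_nhdsWithin] with ε hε using key ε hε
  have hfin : ∑ i, ∫ v, pd i (scalA f) v * X i v
      = - (1 / (4 * Real.pi) * ∫ p : V × V, ‖p.1 - p.2‖⁻¹ * f p.2 * Y p.1 ∂(volume.prod volume)) := by
    rw [integral_grad_scalA_mul_eq hf2 hf hX hXc, integral_prod _ hi, ← integral_const_mul]
    congr 2 with v
    rw [scalA_eq hf2.continuous hf, mul_assoc]
    simp only [integral_mul_const, hYdef]
  rw [hfin, abs_neg, abs_mul]
  have hpi : |1 / (4 * Real.pi)| ≤ 1 := by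
    rw [abs_of_pos (by positivity), div_le_one (by positivity)]
    linarith [Real.pi_gt_three]
  calc _ ≤ 1 * (3 * L * Q) := by gcongr
    _ = _ := one_mul _

end Weak

/-! ### Regularity of f^{3/4} for nonnegative C² functions -/

lemma exists_bound_fderiv {E : Type*} [NormedAddCommGroup E] [NormedSpace ℝ E] {G : V → E}
    (hG : ContDiff ℝ 1 G) {K : Set V} (hK : IsCompact K) : ∃ B, ∀ v ∈ K, ‖fderiv ℝ G v‖ ≤ B :=
  hK.exists_bound_of_continuousOn (hG.continuous_fderiv (by simp)).continuousOn

section NonnegRpow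

variable {f : V → ℝ} (hf : ContDiff ℝ 2 f) (h0 : ∀ v, 0 ≤ f v)
include hf

/-- The ball of radius 2 contains the unit ball about each v near v₀, so one constant bounds both
the gradient and the second-order Taylor remainder at all these points. -/
lemma exists_taylor_bound (v₀ : V) : ∃ K, 1 ≤ K ∧ (∀ v ∈ Metric.closedBall v₀ 1, ‖fderiv ℝ f v‖ ≤ K) ∧
    ∀ v ∈ Metric.closedBall v₀ 1, ∀ y ∈ Metric.closedBall v 1,
      |f y - f v - fderiv ℝ f v (y - v)| ≤ K * ‖y - v‖ ^ 2 := by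
  have hf' : ContDiff ℝ 1 (fderiv ℝ f) := hf.fderiv_right (by norm_num)
  obtain ⟨B, hB⟩ := (isCompact_closedBall v₀ 2).exists_bound_of_continuousOn
    hf'.continuous.continuousOn
  obtain ⟨B', hB'⟩ := exists_bound_fderiv hf' (isCompact_closedBall v₀ 2)
  refine ⟨max 1 (max B B'), le_max_left _ _, fun v hv => (hB v ?_).trans ?_, ?_⟩
  · exact Metric.closedBall_subset_closedBall (by norm_num) hv
  · exact (le_max_left _ _).trans (le_max_right _ _)
  intro v hv y hy
  have hsub : Metric.closedBall v ‖y - v‖ ⊆ Metric.closedBall v₀ 2 := by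
    intro z hz
    rw [Metric.mem_closedBall, dist_eq_norm] at *
    calc ‖z - v₀‖ = ‖(z - v) + (v - v₀)‖ := by congr 1; abel
      _ ≤ _ := norm_add_le _ _
      _ ≤ 2 := by linarith
  have hconv : Convex ℝ (Metric.closedBall v ‖y - v‖) := convex_closedBall _ _
  have hd1 : ∀ z ∈ Metric.closedBall v ‖y - v‖,
      ‖fderiv ℝ f z - fderiv ℝ f v‖ ≤ max 1 (max B B') * ‖y - v‖ := by
    intro z hz
    have := hconv.norm_image_sub_le_of_norm_fderiv_le (𝕜 := ℝ) (f := fderiv ℝ f) (C := B')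
      (x := v) (y := z) (fun x _ => hf'.differentiable (by simp) x)
      (fun x hx => hB' x (hsub hx)) (Metric.mem_closedBall_self (norm_nonneg _)) hz
    refine this.trans ?_
    rw [Metric.mem_closedBall, dist_eq_norm] at hz
    gcongr
    exact (le_max_right _ _).trans (le_max_right _ _)
  have := hconv.norm_image_sub_le_of_norm_hasFDerivWithin_le' (f := f) (f' := fderiv ℝ f)
    (φ := fderiv ℝ f v) (C := max 1 (max B B') * ‖y - v‖) (x := v) (y := y)
    (fun x _ => ((hf.differentiable (by simp)) x).hasFDerivAt.hasFDerivWithinAt) hd1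
    (Metric.mem_closedBall_self (norm_nonneg _)) (by simp [dist_eq_norm])
  rw [Real.norm_eq_abs] at this
  calc _ ≤ _ := this
    _ = _ := by ring

include h0

/-- The gradient of a nonnegative `C²` function is locally controlled by its square root. -/
lemma exists_norm_fderiv_sq_le (v₀ : V) :
    ∃ K, 0 ≤ K ∧ ∀ v ∈ Metric.closedBall v₀ 1, ‖fderiv ℝ f v‖ ^ 2 ≤ K * f v := by
  obtain ⟨K, hK1, hKb, hK⟩ := exists_taylor_bound hf v₀
  refine ⟨4 * K, by positivity, fun v hv => ?_⟩
  have hK0 : 0 < K := by linarith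
  -- This t minimises f(v) − t|∇f|² + K t²|∇f|², the Taylor upper bound after a gradient step;
  -- nonnegativity of f at the new point yields the claim. Since |∇f| ≤ K, the step has length at
  -- most 1/2 and stays where the expansion is valid.
  set t := 1 / (2 * K) with ht
  have ht0 : 0 < t := by positivity
  have htK : K * t = 1 / 2 := by rw [ht]; field_simp
  have hgn : ‖gradient f v‖ = ‖fderiv ℝ f v‖ := by rw [gradient]; simp
  have hn : ‖(v - t • gradient f v) - v‖ = t * ‖fderiv ℝ f v‖ := by
    rw [sub_sub_cancel_left, norm_neg, norm_smul, hgn, Real.norm_of_nonneg ht0.le]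
  have hmem : v - t • gradient f v ∈ Metric.closedBall v 1 := by
    rw [Metric.mem_closedBall, dist_eq_norm, hn]
    have := hKb v hv
    nlinarith
  have h1 := (abs_le.1 (hK v hv _ hmem)).2
  rw [hn, sub_sub_cancel_left, map_neg, map_smul, smul_eq_mul] at h1
  have h2 : fderiv ℝ f v (gradient f v) = ‖fderiv ℝ f v‖ ^ 2 := by
    have : inner ℝ (gradient f v) (gradient f v) = fderiv ℝ f v (gradient f v) := by
      conv_lhs => enter [2]; rw [gradient]
      rw [InnerProductSpace.toDual_symm_apply]
    rw [← this, real_inner_self_eq_norm_sq, hgn]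
  rw [h2] at h1
  have h3 := h0 (v - t • gradient f v)
  have h4 : K * (t * ‖fderiv ℝ f v‖) ^ 2 = (1 / 2) * t * ‖fderiv ℝ f v‖ ^ 2 := by
    rw [← htK]; ring
  rw [h4] at h1
  have h5 : t * ‖fderiv ℝ f v‖ ^ 2 ≤ 2 * f v := by linarith
  have h6 : ‖fderiv ℝ f v‖ ^ 2 = (2 * K) * (t * ‖fderiv ℝ f v‖ ^ 2) := by
    rw [← mul_assoc, mul_assoc 2, htK]; ring
  rw [h6]; nlinarith

lemma fderiv_eq_zero_of_eq_zero {v : V} (hv : f v = 0) : fderiv ℝ f v = 0 := by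
  obtain ⟨K, -, hK⟩ := exists_norm_fderiv_sq_le hf h0 v
  have := hK v (Metric.mem_closedBall_self zero_le_one)
  rw [hv, mul_zero] at this
  exact norm_eq_zero.1 (pow_eq_zero_iff two_ne_zero |>.1 (le_antisymm this (sq_nonneg _)))

lemma pd_eq_zero_of_eq_zero {v : V} (hv : f v = 0) (i : Fin 3) : pd i f v = 0 := by
  rw [pd, fderiv_eq_zero_of_eq_zero hf h0 hv]; simp

/-- Only zeros of f need care. There ∇f = 0 and f = O(|y − v|²), hence f^{3/4} = O(|y − v|^{3/2}),
and the stated derivative vanishes together with ∇f. -/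
lemma hasFDerivAt_rpow_three_quarters (v : V) :
    HasFDerivAt (fun v => f v ^ (3 / 4 : ℝ)) ((3 / 4 * f v ^ (-(1 / 4) : ℝ)) • fderiv ℝ f v) v := by
  rcases (h0 v).eq_or_lt with hv | hv
  · have hv : f v = 0 := hv.symm
    rw [fderiv_eq_zero_of_eq_zero hf h0 hv, smul_zero]
    obtain ⟨K, hK1, -, hK⟩ := exists_taylor_bound hf v
    have hK := hK v (Metric.mem_closedBall_self zero_le_one)
    rw [fderiv_eq_zero_of_eq_zero hf h0 hv, hv] at hK
    rw [hasFDerivAt_iff_isLittleO, Asymptotics.isLittleO_iff]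
    intro c hc
    have hcont : Continuous fun y : V => K ^ (3 / 4 : ℝ) * ‖y - v‖ ^ (1 / 2 : ℝ) :=
      continuous_const.mul ((by fun_prop : Continuous fun y : V => ‖y - v‖).rpow_const
        fun _ => Or.inr (by norm_num))
    have hlt : ∀ᶠ y in 𝓝 v, K ^ (3 / 4 : ℝ) * ‖y - v‖ ^ (1 / 2 : ℝ) < c := by
      have := hcont.tendsto v
      simp only [sub_self, norm_zero] at this
      rw [Real.zero_rpow (by norm_num), mul_zero] at this
      exact this.eventually (gt_mem_nhds hc)
    filter_upwards [hlt, Metric.closedBall_mem_nhds v one_pos] with y hy hyb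
    have h1 := (abs_le.1 (hK y hyb)).2
    simp only [zero_apply, sub_zero] at h1
    rw [hv, Real.zero_rpow (by norm_num)]
    simp only [zero_apply, sub_zero]
    rw [Real.norm_of_nonneg (Real.rpow_nonneg (h0 y) _)]
    calc f y ^ (3 / 4 : ℝ) ≤ (K * ‖y - v‖ ^ 2) ^ (3 / 4 : ℝ) :=
          Real.rpow_le_rpow (h0 y) h1 (by norm_num)
      _ = (K ^ (3 / 4 : ℝ) * ‖y - v‖ ^ (1 / 2 : ℝ)) * ‖y - v‖ := by
          rw [Real.mul_rpow (by linarith) (by positivity), mul_assoc, ← Real.rpow_natCast,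
            ← Real.rpow_mul (norm_nonneg _)]
          congr 1
          rcases (norm_nonneg (y - v)).eq_or_lt with h | h
          · rw [← h, Real.zero_rpow (by norm_num), mul_zero]
          · conv_rhs => rw [← Real.rpow_add_one h.ne']
            norm_num
      _ ≤ c * ‖y - v‖ := by gcongr
  · have := ((hf.differentiable (by simp)) v).hasFDerivAt.rpow_const (p := 3 / 4) (Or.inl hv.ne')
    norm_num at this ⊢
    exact this

lemma pd_rpow_three_quarters (i : Fin 3) (v : V) :
    pd i (fun v => f v ^ (3 / 4 : ℝ)) v = 3 / 4 * f v ^ (-(1 / 4) : ℝ) * pd i f v := by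
  rw [pd, (hasFDerivAt_rpow_three_quarters hf h0 v).fderiv]; rfl

/-- Near a zero, |∇f|² ≤ K f gives f^{-1/4} |∇f| ≤ K^{1/2} f^{1/4}, which tends to 0. -/
lemma contDiff_rpow_three_quarters : ContDiff ℝ 1 fun v => f v ^ (3 / 4 : ℝ) := by
  rw [contDiff_one_iff_hasFDerivAt]
  refine ⟨_, ?_, hasFDerivAt_rpow_three_quarters hf h0⟩
  rw [continuous_iff_continuousAt]
  intro v
  rcases (h0 v).eq_or_lt with hv | hv
  · have hv : f v = 0 := hv.symm
    obtain ⟨K, hK0, hK⟩ := exists_norm_fderiv_sq_le hf h0 v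
    rw [ContinuousAt, fderiv_eq_zero_of_eq_zero hf h0 hv, smul_zero]
    have hlim : Tendsto (fun y => 3 / 4 * (K ^ (1 / 2 : ℝ) * f y ^ (1 / 4 : ℝ))) (𝓝 v) (𝓝 0) := by
      have : Continuous fun y => 3 / 4 * (K ^ (1 / 2 : ℝ) * f y ^ (1 / 4 : ℝ)) :=
        continuous_const.mul (continuous_const.mul
          (hf.continuous.rpow_const fun _ => Or.inr (by norm_num)))
      have := this.tendsto v
      rwa [hv, Real.zero_rpow (by norm_num), mul_zero, mul_zero] at this
    refine squeeze_zero_norm' ?_ hlim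
    filter_upwards [Metric.closedBall_mem_nhds v one_pos] with y hy
    rw [norm_smul, Real.norm_of_nonneg (mul_nonneg (by norm_num) (Real.rpow_nonneg (h0 y) _)),
      mul_assoc]
    refine mul_le_mul_of_nonneg_left ?_ (by norm_num)
    rcases (h0 y).eq_or_lt with hy0 | hy0
    · rw [← hy0, Real.zero_rpow (by norm_num), Real.zero_rpow (by norm_num)]; simp
    have h1 : ‖fderiv ℝ f y‖ ≤ K ^ (1 / 2 : ℝ) * f y ^ (1 / 2 : ℝ) := by
      rw [← Real.mul_rpow hK0 hy0.le, ← Real.sqrt_eq_rpow]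
      exact Real.le_sqrt_of_sq_le (hK y hy)
    calc f y ^ (-(1 / 4) : ℝ) * ‖fderiv ℝ f y‖
        ≤ f y ^ (-(1 / 4) : ℝ) * (K ^ (1 / 2 : ℝ) * f y ^ (1 / 2 : ℝ)) := by gcongr
      _ = K ^ (1 / 2 : ℝ) * (f y ^ (-(1 / 4) : ℝ) * f y ^ (1 / 2 : ℝ)) := by ring
      _ = _ := by rw [← Real.rpow_add hy0]; norm_num
  · have h1 : ContinuousAt (fun y => f y ^ (-(1 / 4) : ℝ)) v :=
      hf.continuous.continuousAt.rpow_const (Or.inl hv.ne')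
    exact (continuousAt_const.mul h1).smul (hf.continuous_fderiv (by simp)).continuousAt

lemma rpow_mul_pd_rpow (i : Fin 3) (v : V) :
    f v ^ (3 / 4 : ℝ) * pd i (fun v => f v ^ (3 / 4 : ℝ)) v = 3 / 4 * (f v ^ (1 / 2 : ℝ) * pd i f v) := by
  rw [pd_rpow_three_quarters hf h0]
  rcases (h0 v).eq_or_lt with hv | hv
  · rw [pd_eq_zero_of_eq_zero hf h0 hv.symm]; ring
  · have : f v ^ (1 / 2 : ℝ) = f v ^ (3 / 4 : ℝ) * f v ^ (-(1 / 4) : ℝ) := by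
      rw [← Real.rpow_add hv]; norm_num
    rw [this]; ring

/-- Rewrites the dissipation through f^{3/4}. It holds on the zero set too, because the gradient
vanishes there. -/
lemma pd_rpow_mul_pd_rpow (i j : Fin 3) (v : V) :
    pd i (fun v => f v ^ (3 / 4 : ℝ)) v * pd j (fun v => f v ^ (3 / 4 : ℝ)) v
      = 9 / 16 * (f v ^ (-(1 / 2) : ℝ) * (pd i f v * pd j f v)) := by
  rw [pd_rpow_three_quarters hf h0, pd_rpow_three_quarters hf h0]
  rcases (h0 v).eq_or_lt with hv | hv
  · rw [pd_eq_zero_of_eq_zero hf h0 hv.symm]; ring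
  · have : f v ^ (-(1 / 2) : ℝ) = f v ^ (-(1 / 4) : ℝ) * f v ^ (-(1 / 4) : ℝ) := by
      rw [← Real.rpow_add hv]; norm_num
    rw [this]; ring

end NonnegRpow

/-! ### The localised energy identity -/

lemma ker_symm (i j : Fin 3) (u : V) : ker i j u = ker j i u := by
  unfold ker proj
  simp only [Matrix.of_apply, mul_comm (u i), eq_comm (a := i)]

lemma matA_symm (f : V → ℝ) (v : V) (i j : Fin 3) : matA f v i j = matA f v j i := by
  simp only [matA_eq, ker_symm i j]

lemma integrable_of_zero_outside {K : Set V} (hK : IsCompact K) {h : V → ℝ} (hc : Continuous h)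
    (hz : ∀ v, v ∉ K → h v = 0) : Integrable h :=
  hc.integrable_of_hasCompactSupport (HasCompactSupport.intro hK hz)

lemma pd_eq_zero_of_notMem {φ : V → ℝ} {v : V} (hv : v ∉ tsupport φ) (i : Fin 3) :
    pd i φ v = 0 := by
  have h : tsupport (pd i φ) ⊆ tsupport φ := tsupport_fderiv_apply_subset ℝ _
  exact image_eq_zero_of_notMem_tsupport fun hh => hv (h hh)

lemma pd_pd_eq_zero_of_notMem {φ : V → ℝ} {v : V} (hv : v ∉ tsupport φ) (i j : Fin 3) :
    pd i (pd j φ) v = 0 := by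
  have h : tsupport (pd j φ) ⊆ tsupport φ := tsupport_fderiv_apply_subset ℝ _
  exact pd_eq_zero_of_notMem (fun hh => hv (h hh)) i

section Energy

variable {f : V → ℝ} (hf2 : ContDiff ℝ 2 f) (h0 : ∀ v, 0 ≤ f v) (hf : Integrable f)
  {φ : V → ℝ} (hφ : ContDiff ℝ 2 φ) (hc : HasCompactSupport φ)
include hf2 h0 hf hφ hc

/-- The energy identity with the regularised test function `φ (f + ε)^{1/2}`. -/
lemma energy_identity_reg {ε : ℝ} (hε : 0 < ε) :
    ∫ v, φ v * (3 / 2 * (f v + ε) ^ (1 / 2 : ℝ)) * divergence (flux f) v =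
      - (3 / 4) * (∫ v, φ v * ((f v + ε) ^ (-(1 / 2) : ℝ) *
          ∑ i, ∑ j, matA f v i j * (pd i f v * pd j f v)))
      - 3 * (∫ v, ∑ i, ∑ j, (f v + ε) ^ (1 / 2 : ℝ) * (matA f v i j * (pd j f v * pd i φ v)))
      + newtonConst / (4 * Real.pi) * (∫ v, f v * (φ v *
          (1 / 2 * (f v + ε) ^ (3 / 2 : ℝ) - 3 / 2 * ε * (f v + ε) ^ (1 / 2 : ℝ))))
      - ∫ v, ∑ i, ∑ j, (f v + ε) ^ (3 / 2 : ℝ) * (matA f v i j * pd j (pd i φ) v) := by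
  have hpos : ∀ v, 0 < f v + ε := fun v => by linarith [h0 v]
  have hfd : ∀ v, DifferentiableAt ℝ f v := hf2.differentiable (by simp)
  have hφd : ∀ v, DifferentiableAt ℝ φ v := hφ.differentiable (by simp)
  have hF2 : ContDiff ℝ 2 fun v => f v + ε := hf2.add contDiff_const
  have hFd : ∀ v, DifferentiableAt ℝ (fun v => f v + ε) v := hF2.differentiable (by simp)
  have hFp : ∀ (p : ℝ), ContDiff ℝ 2 fun v => (f v + ε) ^ p := fun p =>
    hF2.rpow_const_of_ne fun v => (hpos v).ne'
  have hFpd : ∀ (p : ℝ) v, DifferentiableAt ℝ (fun v => (f v + ε) ^ p) v := fun p =>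
    (hFp p).differentiable (by simp)
  have pF : ∀ (p : ℝ) i v, pd i (fun v => (f v + ε) ^ p) v = p * (f v + ε) ^ (p - 1) * pd i f v := by
    intro p i v
    rw [pd_comp (f := fun v => f v + ε) (Real.hasDerivAt_rpow_const (Or.inl (hpos v).ne')) (hFd v),
      pd_add (hfd v) (by fun_prop), pd_const, add_zero]
  have cA : ∀ i j, Continuous fun v => matA f v i j := fun i j => (contDiff_matA hf2 hf i j).continuous
  have cf := hf2.continuous
  have cφ := hφ.continuous
  have cFp : ∀ p : ℝ, Continuous fun v => (f v + ε) ^ p := fun p => (hFp p).continuous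
  have cpf : ∀ i, Continuous (pd i f) := fun i => continuous_pd (hf2.of_le (by norm_num)) i
  have cpφ : ∀ i, Continuous (pd i φ) := fun i => continuous_pd (hφ.of_le (by norm_num)) i
  have cppφ : ∀ i j, Continuous (pd i (pd j φ)) := fun i j =>
    continuous_pd (contDiff_pd hφ (by norm_num) j) i
  have cpa : ∀ i, Continuous (pd i (scalA f)) := fun i =>
    continuous_pd ((contDiff_scalA hf2 hf).of_le (by norm_num)) i
  set ψ : V → ℝ := fun v => φ v * (3 / 2 * (f v + ε) ^ (1 / 2 : ℝ)) with hψ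
  have hψ2 : ContDiff ℝ 2 ψ := hφ.mul (contDiff_const.mul (hFp _))
  have hψc : HasCompactSupport ψ := hc.mul_right
  have pψ : ∀ i v, pd i ψ v = pd i φ v * (3 / 2 * (f v + ε) ^ (1 / 2 : ℝ))
      + φ v * (3 / 4 * (f v + ε) ^ (-(1 / 2) : ℝ) * pd i f v) := by
    intro i v
    rw [hψ, pd_mul (hφd v) ((hFpd _ v).const_mul _), pd_const_mul (hFpd _ v), pF,
      show (1 / 2 : ℝ) - 1 = -(1 / 2) by norm_num]
    ring
  -- γ is the primitive of (3/4) s (s + ε)^{-1/2} evaluated at s = f. It makes the part of the drift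
  -- containing φ∇f a piece of ∇a · ∇(φγ), to which −Δa = cf applies.
  set γ : V → ℝ := fun v => 1 / 2 * (f v + ε) ^ (3 / 2 : ℝ) - 3 / 2 * ε * (f v + ε) ^ (1 / 2 : ℝ)
    with hγ
  have hγ2 : ContDiff ℝ 2 γ := (contDiff_const.mul (hFp _)).sub (contDiff_const.mul (hFp _))
  have hm : ∀ v, (f v + ε) ^ (1 / 2 : ℝ) = (f v + ε) * (f v + ε) ^ (-(1 / 2) : ℝ) := by
    intro v
    conv_rhs => rw [← Real.rpow_one_add' (hpos v).le (by norm_num)]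
    norm_num
  have hm3 : ∀ v, (f v + ε) ^ (3 / 2 : ℝ) = (f v + ε) * (f v + ε) ^ (1 / 2 : ℝ) := by
    intro v
    conv_rhs => rw [← Real.rpow_one_add' (hpos v).le (by norm_num)]
    norm_num
  have pγ : ∀ i v, pd i γ v = 3 / 4 * f v * (f v + ε) ^ (-(1 / 2) : ℝ) * pd i f v := by
    intro i v
    rw [hγ, pd_sub ((hFpd _ v).const_mul _) ((hFpd _ v).const_mul _), pd_const_mul (hFpd _ v),
      pd_const_mul (hFpd _ v), pF, pF, show (1 / 2 : ℝ) - 1 = -(1 / 2) by norm_num,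
      show (3 / 2 : ℝ) - 1 = 1 / 2 by norm_num, hm]
    ring
  set Ψ : V → ℝ := fun v => φ v * γ v with hΨ
  have hΨ2 : ContDiff ℝ 2 Ψ := hφ.mul hγ2
  have hΨc : HasCompactSupport Ψ := hc.mul_right
  have pΨ : ∀ i v, pd i Ψ v = pd i φ v * γ v
      + φ v * (3 / 4 * f v * (f v + ε) ^ (-(1 / 2) : ℝ) * pd i f v) := by
    intro i v
    rw [hΨ, pd_mul (hφd v) (hγ2.differentiable (by simp) v), pγ]
  -- What remains of the drift is exactly this field: (3/2) f (f + ε)^{1/2} − γ = (f + ε)^{3/2}. It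
  -- is handled by ∇·A = ∇a.
  set X : Fin 3 → V → ℝ := fun i v => (f v + ε) ^ (3 / 2 : ℝ) * pd i φ v with hX
  have hX1 : ∀ i, ContDiff ℝ 1 (X i) := fun i =>
    ((hFp _).of_le (by norm_num)).mul (contDiff_pd hφ (by norm_num) i)
  have hXc : ∀ i, HasCompactSupport (X i) := fun i => (HasCompactSupport.pd hc i).mul_left
  have pX : ∀ i j v, pd j (X i) v = 3 / 2 * (f v + ε) ^ (1 / 2 : ℝ) * pd j f v * pd i φ v
      + (f v + ε) ^ (3 / 2 : ℝ) * pd j (pd i φ) v := by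
    intro i j v
    change pd j (fun v => (f v + ε) ^ (3 / 2 : ℝ) * pd i φ v) v = _
    rw [pd_mul (hFpd _ v) ((contDiff_pd hφ (m := 1) (by norm_num) i).differentiable (by simp) v), pF,
      show (3 / 2 : ℝ) - 1 = 1 / 2 by norm_num]
  have W1 := integral_grad_scalA_mul_grad hf2 h0 hf hΨ2 hΨc
  have W2 := integral_grad_scalA_mul hf2 h0 hf hX1 hXc
  have int : ∀ h : V → ℝ, Continuous h → (∀ v, v ∉ tsupport φ → h v = 0) → Integrable h :=
    fun h hh hz => integrable_of_zero_outside hc hh hz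
  have z0 : ∀ v, v ∉ tsupport φ → φ v = 0 := fun v hv => image_eq_zero_of_notMem_tsupport hv
  have z1 : ∀ i v, v ∉ tsupport φ → pd i φ v = 0 := fun i v hv => pd_eq_zero_of_notMem hv i
  have z2 : ∀ i j v, v ∉ tsupport φ → pd i (pd j φ) v = 0 := fun i j v hv =>
    pd_pd_eq_zero_of_notMem hv i j
  set P1 : V → ℝ := fun v => φ v * ((f v + ε) ^ (-(1 / 2) : ℝ) *
      ∑ i, ∑ j, matA f v i j * (pd i f v * pd j f v)) with hP1
  set P2 : V → ℝ := fun v => ∑ i, ∑ j, (f v + ε) ^ (1 / 2 : ℝ) * (matA f v i j * (pd j f v * pd i φ v))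
    with hP2
  set P4 : V → ℝ := fun v => ∑ i, ∑ j, (f v + ε) ^ (3 / 2 : ℝ) * (matA f v i j * pd j (pd i φ) v)
    with hP4
  have i1 : Integrable P1 := int _ (by fun_prop) fun v hv => by simp [hP1, z0 v hv]
  have i2 : Integrable P2 := int _ (by fun_prop) fun v hv => by simp [hP2, z1 _ v hv]
  have i4 : Integrable P4 := int _ (by fun_prop) fun v hv => by simp [hP4, z2 _ _ v hv]
  have cpΨ : ∀ i, Continuous (pd i Ψ) := fun i => continuous_pd (hΨ2.of_le (by norm_num)) i
  have cX : ∀ i, Continuous (X i) := fun i => (hX1 i).continuous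
  have iΨ : ∀ i, Integrable fun v => pd i (scalA f) v * pd i Ψ v := fun i =>
    int _ (by fun_prop) fun v hv => by simp [pΨ, z0 v hv, z1 _ v hv]
  have iX : ∀ i, Integrable fun v => pd i (scalA f) v * X i v := fun i =>
    int _ (by fun_prop) fun v hv => by simp [hX, z1 _ v hv]
  -- the left-hand side, integrated by parts
  have lhs : ∫ v, ψ v * divergence (flux f) v = - ∫ v, ∑ i, flux f v i * pd i ψ v := by
    have cfl : ∀ i, ContDiff ℝ 1 fun v => flux f v i := fun i => contDiff_flux hf2 hf i
    have cpψ : ∀ i, Continuous (pd i ψ) := fun i => continuous_pd (hψ2.of_le (by norm_num)) i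
    have ia : ∀ i, Integrable fun v => flux f v i * pd i ψ v := fun i =>
      int _ ((cfl i).continuous.mul (cpψ i)) fun v hv => by simp [pψ, z0 v hv, z1 _ v hv]
    have ib : ∀ i, Integrable fun v => pd i (fun w => flux f w i) v * ψ v := fun i =>
      int _ ((continuous_pd (cfl i) i).mul hψ2.continuous) fun v hv => by simp [hψ, z0 v hv]
    rw [integral_finsetSum _ fun i _ => ia i, ← Finset.sum_neg_distrib]
    have : ∀ v, ψ v * divergence (flux f) v = ∑ i, pd i (fun w => flux f w i) v * ψ v := by
      intro v; rw [divergence_eq, Finset.mul_sum]; exact Finset.sum_congr rfl fun i _ => mul_comm _ _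
    simp only [this]
    rw [integral_finsetSum _ fun i _ => ib i]
    refine Finset.sum_congr rfl fun i _ => ?_
    rw [integral_mul_pd (cfl i) (hψ2.of_le (by norm_num)) hψc, neg_neg]
  have rhs2 : ∑ i, ∑ j, ∫ v, matA f v i j * pd j (X i) v = 3 / 2 * (∫ v, P2 v) + ∫ v, P4 v := by
    have ia : ∀ i j, Integrable fun v => matA f v i j * pd j (X i) v := fun i j =>
      int _ ((cA i j).mul (continuous_pd (hX1 i) j)) fun v hv => by simp [pX, z1 _ v hv, z2 _ _ v hv]
    simp only [← integral_finsetSum _ fun j _ => ia _ j]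
    rw [← integral_finsetSum _ fun i _ => integrable_finsetSum _ fun j _ => ia i j,
      ← integral_const_mul, ← integral_add (i2.const_mul _) i4]
    congr 1 with v
    simp only [hP2, hP4, pX, Fin.sum_univ_three]
    ring
  -- The cross term appears here with coefficient 3/2, and once more with 3/2 from ∇a · X; together
  -- they give the 3 of the statement.
  have point : ∀ v, - ∑ i, flux f v i * pd i ψ v = (-(3 / 4) * P1 v + (-(3 / 2)) * P2 v)
      + (∑ i, pd i (scalA f) v * pd i Ψ v + ∑ i, pd i (scalA f) v * X i v) := by
    intro v
    simp only [flux_apply, pψ, pΨ, hP1, hP2, hX, hγ, Fin.sum_univ_three]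
    rw [hm3 v, hm v]
    ring
  rw [lhs, ← integral_neg]
  simp only [point]
  have j1 : Integrable fun v => -(3 / 4) * P1 v + (-(3 / 2)) * P2 v :=
    (i1.const_mul _).add (i2.const_mul _)
  have j2 : Integrable fun v => ∑ i, pd i (scalA f) v * pd i Ψ v + ∑ i, pd i (scalA f) v * X i v :=
    (integrable_finsetSum _ fun i _ => iΨ i).add (integrable_finsetSum _ fun i _ => iX i)
  rw [integral_add j1 j2, integral_add (i1.const_mul _) (i2.const_mul _),
    integral_add (integrable_finsetSum _ fun i _ => iΨ i) (integrable_finsetSum _ fun i _ => iX i),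
    integral_finsetSum _ fun i _ => iΨ i, integral_finsetSum _ fun i _ => iX i, W1, W2, rhs2,
    integral_const_mul, integral_const_mul]
  ring

end Energy

lemma tendsto_integral_of_zero_outside {K : Set V} (hK : IsCompact K) {h : ℝ → V → ℝ} {h₀ B : V → ℝ}
    (hB : Continuous B) (hc : ∀ ε, 0 < ε → Continuous (h ε))
    (hz : ∀ ε, 0 < ε → ∀ v, v ∉ K → h ε v = 0)
    (hb : ∀ ε, 0 < ε → ε < 1 → ∀ v, |h ε v| ≤ B v)
    (ht : ∀ v, Tendsto (fun ε => h ε v) (𝓝[>] 0) (𝓝 (h₀ v))) :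
    Tendsto (fun ε => ∫ v, h ε v) (𝓝[>] 0) (𝓝 (∫ v, h₀ v)) := by
  refine tendsto_integral_filter_of_dominated_convergence (K.indicator B) ?_ ?_ ?_
    (Eventually.of_forall ht)
  · filter_upwards [self_mem_nhdsWithin] with ε hε using (hc ε hε).aestronglyMeasurable
  · filter_upwards [self_mem_nhdsWithin, Ioo_mem_nhdsGT zero_lt_one] with ε hε hε1
    refine Eventually.of_forall fun v => ?_
    by_cases hv : v ∈ K
    · rw [Set.indicator_of_mem hv]; exact hb ε hε hε1.2 v
    · rw [Set.indicator_of_notMem hv, hz ε hε v hv, norm_zero]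
  · rw [integrable_indicator_iff hK.measurableSet]
    exact hB.continuousOn.integrableOn_compact hK

lemma tendsto_add_rpow (a : ℝ) {p : ℝ} (hp : 0 ≤ p) :
    Tendsto (fun ε : ℝ => (a + ε) ^ p) (𝓝[>] 0) (𝓝 (a ^ p)) := by
  have h : Continuous fun ε : ℝ => (a + ε) ^ p :=
    (continuous_const.add continuous_id).rpow_const fun _ => Or.inr hp
  have := h.tendsto 0
  rw [add_zero] at this
  exact this.mono_left nhdsWithin_le_nhds

section Energy

variable {f : V → ℝ} (hf2 : ContDiff ℝ 2 f) (h0 : ∀ v, 0 ≤ f v) (hf : Integrable f)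
  {φ : V → ℝ} (hφ : ContDiff ℝ 2 φ) (hc : HasCompactSupport φ)
include hf2 h0 hf hφ hc

/-- The localised energy identity for `∫ φ f^{3/2}`. -/
lemma energy_identity :
    ∫ v, φ v * (3 / 2 * f v ^ (1 / 2 : ℝ)) * divergence (flux f) v =
      - (4 / 3) * (∫ v, φ v * ∑ i, ∑ j, matA f v i j *
          (pd i (fun w => f w ^ (3 / 4 : ℝ)) v * pd j (fun w => f w ^ (3 / 4 : ℝ)) v))
      - 4 * (∫ v, ∑ i, ∑ j, matA f v i j *
          (f v ^ (3 / 4 : ℝ) * pd j (fun w => f w ^ (3 / 4 : ℝ)) v * pd i φ v))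
      + newtonConst / (8 * Real.pi) * (∫ v, φ v * f v ^ (5 / 2 : ℝ))
      - ∫ v, ∑ i, ∑ j, f v ^ (3 / 2 : ℝ) * (matA f v i j * pd j (pd i φ) v) := by
  have cA : ∀ i j, Continuous fun v => matA f v i j := fun i j => (contDiff_matA hf2 hf i j).continuous
  have cf := hf2.continuous
  have cφ := hφ.continuous
  have cpf : ∀ i, Continuous (pd i f) := fun i => continuous_pd (hf2.of_le (by norm_num)) i
  have cpφ : ∀ i, Continuous (pd i φ) := fun i => continuous_pd (hφ.of_le (by norm_num)) i
  have cppφ : ∀ i j, Continuous (pd i (pd j φ)) := fun i j =>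
    continuous_pd (contDiff_pd hφ (by norm_num) j) i
  have cdiv : Continuous (divergence (flux f)) := by
    have : divergence (flux f) = fun v => ∑ i, pd i (fun w => flux f w i) v := rfl
    rw [this]
    exact continuous_finsetSum _ fun i _ => continuous_pd (contDiff_flux hf2 hf i) i
  have cg := contDiff_rpow_three_quarters hf2 h0
  have cpg : ∀ i, Continuous (pd i fun w => f w ^ (3 / 4 : ℝ)) := fun i => continuous_pd cg i
  have hpos : ∀ v, ∀ ε, 0 < ε → 0 < f v + ε := fun v ε hε => by linarith [h0 v]
  have cFp : ∀ p : ℝ, ∀ ε, 0 < ε → Continuous fun v => (f v + ε) ^ p := fun p ε hε =>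
    (cf.add continuous_const).rpow_const fun v => Or.inl (hpos v ε hε).ne'
  have cF1 : ∀ p : ℝ, Continuous fun v => (f v + 1) ^ p := fun p => cFp p 1 one_pos
  have bF : ∀ (p : ℝ), 0 ≤ p → ∀ ε, 0 < ε → ε < 1 → ∀ v, (f v + ε) ^ p ≤ (f v + 1) ^ p :=
    fun p hp ε hε hε1 v => Real.rpow_le_rpow (hpos v ε hε).le (by linarith) hp
  have nF : ∀ (p : ℝ), ∀ ε, 0 < ε → ∀ v, 0 ≤ (f v + ε) ^ p :=
    fun p ε hε v => Real.rpow_nonneg (hpos v ε hε).le p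
  have z0 : ∀ v, v ∉ tsupport φ → φ v = 0 := fun v hv => image_eq_zero_of_notMem_tsupport hv
  have z1 : ∀ i v, v ∉ tsupport φ → pd i φ v = 0 := fun i v hv => pd_eq_zero_of_notMem hv i
  have z2 : ∀ i j v, v ∉ tsupport φ → pd i (pd j φ) v = 0 := fun i j v hv =>
    pd_pd_eq_zero_of_notMem hv i j
  have hK : IsCompact (tsupport φ) := hc
  have l0 : Tendsto (fun ε => ∫ v, φ v * (3 / 2 * (f v + ε) ^ (1 / 2 : ℝ)) * divergence (flux f) v)
      (𝓝[>] 0) (𝓝 (∫ v, φ v * (3 / 2 * f v ^ (1 / 2 : ℝ)) * divergence (flux f) v)) := by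
    refine tendsto_integral_of_zero_outside hK
      (B := fun v => |φ v| * (3 / 2 * (f v + 1) ^ (1 / 2 : ℝ)) * |divergence (flux f) v|) ?_ ?_ ?_ ?_ ?_
    · have := cF1 (1 / 2); fun_prop
    · intro ε hε; have := cFp (1 / 2) ε hε; fun_prop
    · intro ε _ v hv; rw [z0 v hv]; ring
    · intro ε hε hε1 v
      have := nF (1 / 2) ε hε v
      rw [abs_mul, abs_mul, abs_of_nonneg (show 0 ≤ 3 / 2 * (f v + ε) ^ (1 / 2 : ℝ) by positivity)]
      gcongr |φ v| * (3 / 2 * ?_) * _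
      exact bF _ (by norm_num) ε hε hε1 v
    · intro v
      exact (((tendsto_add_rpow (f v) (by norm_num)).const_mul _).const_mul _).mul_const _
  have hS : ∀ v, f v ^ (-(1 / 2) : ℝ) * ∑ i, ∑ j, matA f v i j * (pd i f v * pd j f v)
      = 16 / 9 * ∑ i, ∑ j, matA f v i j *
          (pd i (fun w => f w ^ (3 / 4 : ℝ)) v * pd j (fun w => f w ^ (3 / 4 : ℝ)) v) := by
    intro v
    simp only [Finset.mul_sum, pd_rpow_mul_pd_rpow hf2 h0]
    refine Finset.sum_congr rfl fun i _ => Finset.sum_congr rfl fun j _ => ?_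
    ring
  have l1 : Tendsto (fun ε => ∫ v, φ v * ((f v + ε) ^ (-(1 / 2) : ℝ) *
          ∑ i, ∑ j, matA f v i j * (pd i f v * pd j f v)))
      (𝓝[>] 0) (𝓝 (∫ v, 16 / 9 * (φ v * ∑ i, ∑ j, matA f v i j *
          (pd i (fun w => f w ^ (3 / 4 : ℝ)) v * pd j (fun w => f w ^ (3 / 4 : ℝ)) v)))) := by
    refine tendsto_integral_of_zero_outside hK
      (B := fun v => |φ v| * |16 / 9 * ∑ i, ∑ j, matA f v i j *
          (pd i (fun w => f w ^ (3 / 4 : ℝ)) v * pd j (fun w => f w ^ (3 / 4 : ℝ)) v)|) ?_ ?_ ?_ ?_ ?_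
    · fun_prop
    · intro ε hε; have := cFp (-(1 / 2)) ε hε; fun_prop
    · intro ε _ v hv; rw [z0 v hv]; ring
    · intro ε hε hε1 v
      rw [abs_mul, ← hS v]
      gcongr |φ v| * ?_
      -- The only negative power: (f + ε)^{-1/2} ≤ f^{-1/2} where f > 0, and where f = 0 the
      -- gradient factor is zero.
      rcases (h0 v).eq_or_lt with hv | hv
      · simp [pd_eq_zero_of_eq_zero hf2 h0 hv.symm]
      · rw [abs_mul, abs_mul, abs_of_nonneg (nF _ ε hε v), abs_of_nonneg (Real.rpow_nonneg (h0 v) _)]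
        gcongr ?_ * _
        exact Real.rpow_le_rpow_of_nonpos hv (by linarith) (by norm_num)
    · intro v
      have e : 16 / 9 * (φ v * ∑ i, ∑ j, matA f v i j *
          (pd i (fun w => f w ^ (3 / 4 : ℝ)) v * pd j (fun w => f w ^ (3 / 4 : ℝ)) v))
        = φ v * (f v ^ (-(1 / 2) : ℝ) * ∑ i, ∑ j, matA f v i j * (pd i f v * pd j f v)) := by
        rw [hS v]; ring
      rw [e]
      refine Tendsto.const_mul _ ?_
      rcases (h0 v).eq_or_lt with hv | hv
      · simp [pd_eq_zero_of_eq_zero hf2 h0 hv.symm]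
      · refine Tendsto.mul_const _ ?_
        have h : ContinuousAt (fun ε : ℝ => (f v + ε) ^ (-(1 / 2) : ℝ)) 0 :=
          ContinuousAt.rpow_const (by fun_prop) (Or.inl (by simpa using hv.ne'))
        have := h.tendsto
        rw [add_zero] at this
        exact this.mono_left nhdsWithin_le_nhds
  have l2 : Tendsto (fun ε => ∫ v, ∑ i, ∑ j, (f v + ε) ^ (1 / 2 : ℝ) *
        (matA f v i j * (pd j f v * pd i φ v)))
      (𝓝[>] 0) (𝓝 (∫ v, 4 / 3 * ∑ i, ∑ j, matA f v i j *
          (f v ^ (3 / 4 : ℝ) * pd j (fun w => f w ^ (3 / 4 : ℝ)) v * pd i φ v))) := by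
    refine tendsto_integral_of_zero_outside hK
      (B := fun v => ∑ i, ∑ j, (f v + 1) ^ (1 / 2 : ℝ) * |matA f v i j * (pd j f v * pd i φ v)|)
      ?_ ?_ ?_ ?_ ?_
    · have := cF1 (1 / 2); fun_prop
    · intro ε hε; have := cFp (1 / 2) ε hε; fun_prop
    · intro ε _ v hv; simp [z1 _ v hv]
    · intro ε hε hε1 v
      refine (Finset.abs_sum_le_sum_abs _ _).trans (Finset.sum_le_sum fun i _ => ?_)
      refine (Finset.abs_sum_le_sum_abs _ _).trans (Finset.sum_le_sum fun j _ => ?_)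
      rw [abs_mul, abs_of_nonneg (nF _ ε hε v)]
      gcongr ?_ * _
      exact bF _ (by norm_num) ε hε hε1 v
    · intro v
      have e : 4 / 3 * ∑ i, ∑ j, matA f v i j *
          (f v ^ (3 / 4 : ℝ) * pd j (fun w => f w ^ (3 / 4 : ℝ)) v * pd i φ v)
        = ∑ i, ∑ j, f v ^ (1 / 2 : ℝ) * (matA f v i j * (pd j f v * pd i φ v)) := by
        simp only [Finset.mul_sum, rpow_mul_pd_rpow hf2 h0]
        refine Finset.sum_congr rfl fun i _ => Finset.sum_congr rfl fun j _ => ?_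
        ring
      rw [e]
      exact tendsto_finsetSum _ fun i _ => tendsto_finsetSum _ fun j _ =>
        (tendsto_add_rpow (f v) (by norm_num)).mul_const _
  have l3 : Tendsto (fun ε => ∫ v, f v * (φ v *
          (1 / 2 * (f v + ε) ^ (3 / 2 : ℝ) - 3 / 2 * ε * (f v + ε) ^ (1 / 2 : ℝ))))
      (𝓝[>] 0) (𝓝 (∫ v, 1 / 2 * (φ v * f v ^ (5 / 2 : ℝ)))) := by
    refine tendsto_integral_of_zero_outside hK
      (B := fun v => f v * (|φ v| * (1 / 2 * (f v + 1) ^ (3 / 2 : ℝ) +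
        3 / 2 * 1 * (f v + 1) ^ (1 / 2 : ℝ)))) ?_ ?_ ?_ ?_ ?_
    · have := cF1 (1 / 2); have := cF1 (3 / 2); fun_prop
    · intro ε hε; have := cFp (1 / 2) ε hε; have := cFp (3 / 2) ε hε; fun_prop
    · intro ε _ v hv; rw [z0 v hv]; ring
    · intro ε hε hε1 v
      have n1 := nF (1 / 2) ε hε v
      have n3 := nF (3 / 2) ε hε v
      rw [abs_mul, abs_mul, abs_of_nonneg (h0 v)]
      refine mul_le_mul_of_nonneg_left (mul_le_mul_of_nonneg_left ?_ (abs_nonneg _)) (h0 v)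
      refine (abs_sub _ _).trans ?_
      rw [abs_of_nonneg (mul_nonneg (by norm_num) n3),
        abs_of_nonneg (mul_nonneg (by positivity) n1)]
      have b1 := bF (1 / 2) (by norm_num) ε hε hε1 v
      have b3 := bF (3 / 2) (by norm_num) ε hε hε1 v
      gcongr
    · intro v
      have e : 1 / 2 * (φ v * f v ^ (5 / 2 : ℝ))
          = f v * (φ v * (1 / 2 * f v ^ (3 / 2 : ℝ) - 3 / 2 * 0 * f v ^ (1 / 2 : ℝ))) := by
        rw [show (5 / 2 : ℝ) = 1 + 3 / 2 by norm_num, Real.rpow_one_add' (h0 v) (by norm_num)]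
        ring
      rw [e]
      refine Tendsto.const_mul _ (Tendsto.const_mul _ (Tendsto.sub ?_ ?_))
      · exact (tendsto_add_rpow (f v) (by norm_num)).const_mul _
      · exact (tendsto_const_nhds.mul (tendsto_id.mono_left nhdsWithin_le_nhds)).mul
          (tendsto_add_rpow (f v) (by norm_num))
  have l4 : Tendsto (fun ε => ∫ v, ∑ i, ∑ j, (f v + ε) ^ (3 / 2 : ℝ) *
        (matA f v i j * pd j (pd i φ) v))
      (𝓝[>] 0) (𝓝 (∫ v, ∑ i, ∑ j, f v ^ (3 / 2 : ℝ) * (matA f v i j * pd j (pd i φ) v))) := by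
    refine tendsto_integral_of_zero_outside hK
      (B := fun v => ∑ i, ∑ j, (f v + 1) ^ (3 / 2 : ℝ) * |matA f v i j * pd j (pd i φ) v|)
      ?_ ?_ ?_ ?_ ?_
    · have := cF1 (3 / 2); fun_prop
    · intro ε hε; have := cFp (3 / 2) ε hε; fun_prop
    · intro ε _ v hv; simp [z2 _ _ v hv]
    · intro ε hε hε1 v
      refine (Finset.abs_sum_le_sum_abs _ _).trans (Finset.sum_le_sum fun i _ => ?_)
      refine (Finset.abs_sum_le_sum_abs _ _).trans (Finset.sum_le_sum fun j _ => ?_)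
      rw [abs_mul, abs_of_nonneg (nF _ ε hε v)]
      gcongr ?_ * _
      exact bF _ (by norm_num) ε hε hε1 v
    · intro v
      exact tendsto_finsetSum _ fun i _ => tendsto_finsetSum _ fun j _ =>
        (tendsto_add_rpow (f v) (by norm_num)).mul_const _
  have lim := (((l1.const_mul (-(3 / 4))).sub (l2.const_mul 3)).add
    (l3.const_mul (newtonConst / (4 * Real.pi)))).sub l4
  have h := tendsto_nhds_unique_of_eventuallyEq l0 lim (by
    filter_upwards [self_mem_nhdsWithin] with ε hε using energy_identity_reg hf2 h0 hf hφ hc hε)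
  rw [h, integral_const_mul, integral_const_mul, integral_const_mul]
  have e : newtonConst / (8 * Real.pi) = newtonConst / (4 * Real.pi) * (1 / 2) := by ring
  rw [e]
  ring

end Energy

/-! ### Quadratic form bounds for A[f] -/

/-- The quadratic form of a `3 × 3` matrix, polarised. -/
noncomputable def bil (A : Matrix (Fin 3) (Fin 3) ℝ) (x y : Fin 3 → ℝ) : ℝ :=
  ∑ i, ∑ j, A i j * (x i * y j)

lemma bil_smul_add {A : Matrix (Fin 3) (Fin 3) ℝ} (hA : ∀ i j, A i j = A j i) (x y : Fin 3 → ℝ)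
    (s t : ℝ) : bil A (fun i => s * x i + t * y i) (fun i => s * x i + t * y i)
      = s ^ 2 * bil A x x + 2 * s * t * bil A x y + t ^ 2 * bil A y y := by
  simp only [bil, Fin.sum_univ_three]
  rw [hA 1 0, hA 2 0, hA 2 1]; ring

lemma bil_sq_le {A : Matrix (Fin 3) (Fin 3) ℝ} (hA : ∀ i j, A i j = A j i)
    (hp : ∀ x, 0 ≤ bil A x x) (x y : Fin 3 → ℝ) : bil A x y ^ 2 ≤ bil A x x * bil A y y := by
  have h : ∀ t : ℝ, 0 ≤ bil A x x * (t * t) + 2 * bil A x y * t + bil A y y := by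
    intro t
    have := hp (fun i => t * x i + 1 * y i)
    rw [bil_smul_add hA] at this
    linarith
  have := discrim_le_zero h
  rw [discrim] at this
  nlinarith

/-- Weighted Young inequality. The hypothesis c² ≤ 4αβ avoids dividing by a weight, so α may be a
cutoff that vanishes. -/
lemma mul_abs_bil_le {A : Matrix (Fin 3) (Fin 3) ℝ} (hA : ∀ i j, A i j = A j i)
    (hp : ∀ x, 0 ≤ bil A x x) {c α β : ℝ} (hα : 0 ≤ α) (hβ : 0 ≤ β)
    (h : c ^ 2 ≤ 4 * α * β) (x y : Fin 3 → ℝ) :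
    c * |bil A x y| ≤ α * bil A x x + β * bil A y y := by
  have h1 := bil_sq_le hA hp x y
  have hx := hp x
  have hy := hp y
  refine abs_le_of_sq_le_sq' ?_ (by positivity) |>.2
  rw [mul_pow, sq_abs]
  calc c ^ 2 * bil A x y ^ 2 ≤ (4 * α * β) * (bil A x x * bil A y y) := by gcongr
    _ ≤ (α * bil A x x + β * bil A y y) ^ 2 := by
      nlinarith [sq_nonneg (α * bil A x x - β * bil A y y)]

/-- In this form the value on a unit vector x is |u|⁻³ times the squared distance from u to the line
ℝx, which is what the lower bound of A[f] exploits. -/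
lemma norm_mul_bil_ker (u : V) (x : Fin 3 → ℝ) (hu : u ≠ 0) :
    bil (Matrix.of fun i j => ker i j u) x x
      = ‖u‖⁻¹ ^ 3 * (‖u‖ ^ 2 * (∑ i, x i ^ 2) - (∑ i, u i * x i) ^ 2) := by
  have hn : ‖u‖ ≠ 0 := norm_ne_zero_iff.2 hu
  simp only [bil, ker, proj, Matrix.of_apply, Fin.sum_univ_three]
  simp
  field_simp
  ring

lemma sq_sum_mul_le (u : V) (x : Fin 3 → ℝ) :
    (∑ i, u i * x i) ^ 2 ≤ ‖u‖ ^ 2 * ∑ i, x i ^ 2 := by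
  rw [norm_sq_eq_sum]
  exact Finset.sum_mul_sq_le_sq_mul_sq _ _ _

lemma bil_ker_nonneg (u : V) (x : Fin 3 → ℝ) : 0 ≤ bil (Matrix.of fun i j => ker i j u) x x := by
  by_cases hu : u = 0
  · simp [hu, ker, bil]
  rw [norm_mul_bil_ker u x hu]
  have := sq_sum_mul_le u x
  exact mul_nonneg (by positivity) (by linarith)

lemma bil_ker_le (u : V) (x : Fin 3 → ℝ) :
    bil (Matrix.of fun i j => ker i j u) x x ≤ ‖u‖⁻¹ * ∑ i, x i ^ 2 := by
  by_cases hu : u = 0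
  · simp [hu, ker, bil]
  rw [norm_mul_bil_ker u x hu]
  have hn : ‖u‖ ≠ 0 := norm_ne_zero_iff.2 hu
  have e : ‖u‖⁻¹ * ∑ i, x i ^ 2 = ‖u‖⁻¹ ^ 3 * (‖u‖ ^ 2 * ∑ i, x i ^ 2) := by field_simp
  rw [e]
  gcongr
  linarith [sq_nonneg (∑ i, u i * x i)]

lemma abs_ker_le (i j : Fin 3) (u : V) : |ker i j u| ≤ 2 * ‖u‖⁻¹ := by
  by_cases hu : u = 0
  · simp [hu, ker]
  refine le_of_tendsto (tendsto_regKer hu i j).abs ?_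
  filter_upwards [self_mem_nhdsWithin] with ε hε using abs_regKer_le hε hu i j

section Form

variable {f : V → ℝ} (hc : Continuous f) (hf : Integrable f)
include hc hf

lemma bil_matA_eq (v : V) (x y : Fin 3 → ℝ) : bil (matA f v) x y
    = 1 / (8 * Real.pi) * ∫ z, bil (Matrix.of fun i j => ker i j (v - z)) x y * f z := by
  simp only [bil, matA_eq, Matrix.of_apply]
  have hi : ∀ i j, Integrable fun z => ker i j (v - z) * (x i * y j) * f z := fun i j => by
    refine ((integrable_kernel_mul (isHomKernel_ker i j) hc hf v).mul_const (x i * y j)).congr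
      (Eventually.of_forall fun z => ?_)
    simp only; ring
  have : ∀ z, (∑ i, ∑ j, ker i j (v - z) * (x i * y j)) * f z
      = ∑ i, ∑ j, ker i j (v - z) * (x i * y j) * f z := fun z => by
    simp only [Finset.sum_mul]
  simp only [this]
  rw [integral_finsetSum _ fun i _ => integrable_finsetSum _ fun j _ => hi i j, Finset.mul_sum]
  refine Finset.sum_congr rfl fun i _ => ?_
  rw [integral_finsetSum _ fun j _ => hi i j, Finset.mul_sum]
  refine Finset.sum_congr rfl fun j _ => ?_
  rw [mul_assoc, ← integral_mul_const]
  congr 2 with z; ring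

lemma integrable_bil_ker (v : V) (x y : Fin 3 → ℝ) :
    Integrable fun z => bil (Matrix.of fun i j => ker i j (v - z)) x y * f z := by
  simp only [bil, Matrix.of_apply, Finset.sum_mul]
  refine integrable_finsetSum _ fun i _ => integrable_finsetSum _ fun j _ => ?_
  refine ((integrable_kernel_mul (isHomKernel_ker i j) hc hf v).mul_const (x i * y j)).congr
    (Eventually.of_forall fun z => ?_)
  simp only; ring

variable (h0 : ∀ v, 0 ≤ f v)
include h0

lemma scalA_nonneg (v : V) : 0 ≤ scalA f v := by
  rw [scalA_eq hc hf]
  refine mul_nonneg (by positivity) (integral_nonneg fun z => ?_)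
  have := h0 z; positivity

lemma bil_matA_nonneg (v : V) (x : Fin 3 → ℝ) : 0 ≤ bil (matA f v) x x := by
  rw [bil_matA_eq hc hf]
  exact mul_nonneg (by positivity) (integral_nonneg fun z => mul_nonneg (bil_ker_nonneg _ _) (h0 z))

lemma bil_matA_le (v : V) (x : Fin 3 → ℝ) : bil (matA f v) x x ≤ scalA f v * ∑ i, x i ^ 2 := by
  rw [bil_matA_eq hc hf, scalA_eq hc hf]
  have h1 : ∫ z, bil (Matrix.of fun i j => ker i j (v - z)) x x * f z
      ≤ (∫ z, ‖v - z‖⁻¹ * f z) * ∑ i, x i ^ 2 := by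
    rw [← integral_mul_const]
    refine integral_mono (integrable_bil_ker hc hf v x x)
      ((integrable_newton_mul hc hf v).mul_const _) fun z => ?_
    have := mul_le_mul_of_nonneg_right (bil_ker_le (v - z) x) (h0 z)
    simp only; linarith
  have h2 : 0 ≤ (∫ z, ‖v - z‖⁻¹ * f z) * ∑ i, x i ^ 2 :=
    mul_nonneg (integral_nonneg fun z => by have := h0 z; positivity)
      (Finset.sum_nonneg fun i _ => sq_nonneg _)
  rw [mul_assoc]
  refine mul_le_mul ?_ h1 (integral_nonneg fun z => mul_nonneg (bil_ker_nonneg _ _) (h0 z))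
    (by positivity)
  gcongr; norm_num

lemma abs_matA_le (v : V) (i j : Fin 3) : |matA f v i j| ≤ scalA f v := by
  rw [matA_eq, scalA_eq hc hf, abs_mul, abs_of_pos (by positivity)]
  have h1 : |∫ z, ker i j (v - z) * f z| ≤ 2 * ∫ z, ‖v - z‖⁻¹ * f z := by
    rw [← Real.norm_eq_abs, ← integral_const_mul]
    refine norm_integral_le_of_norm_le ((integrable_newton_mul hc hf v).const_mul 2)
      (Eventually.of_forall fun z => ?_)
    rw [norm_mul, Real.norm_of_nonneg (h0 z), ← mul_assoc]
    exact mul_le_mul_of_nonneg_right (abs_ker_le _ _ _) (h0 z)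
  calc _ ≤ 1 / (8 * Real.pi) * (2 * ∫ z, ‖v - z‖⁻¹ * f z) := by gcongr
    _ = _ := by ring

end Form

/-! ### Rate of change of a slowly varying average -/

section MassWeak

variable {f : V → ℝ} (hf2 : ContDiff ℝ 2 f) (h0 : ∀ v, 0 ≤ f v) (hf : Integrable f)
include hf2 h0 hf

/-- The weak form of the equation against a slowly varying test function. -/
lemma abs_integral_mul_divergence_flux_le {φ : V → ℝ} (hφ : ContDiff ℝ 2 φ)
    (hc : HasCompactSupport φ) {L : ℝ} (hL : ∀ i v z, |pd i φ v - pd i φ z| ≤ L * ‖v - z‖)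
    (hQ : Integrable (fun p : V × V => ‖p.1 - p.2‖⁻¹ * f p.2 * f p.1) (volume.prod volume)) :
    |∫ v, φ v * divergence (flux f) v| ≤
      9 * L * ∫ p : V × V, ‖p.1 - p.2‖⁻¹ * f p.2 * f p.1 ∂(volume.prod volume) := by
  have W3 := abs_integral_grad_scalA_le hf2 h0 hf hφ hc hL hQ
  set Q := ∫ p : V × V, ‖p.1 - p.2‖⁻¹ * f p.2 * f p.1 ∂(volume.prod volume) with hQdef
  have hL0 : 0 ≤ L := by
    have := (abs_nonneg _).trans (hL 0 (EuclideanSpace.single 0 1) 0)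
    simpa using this
  have hQ0 : 0 ≤ Q := integral_nonneg fun p => by
    have := h0 p.1; have := h0 p.2; positivity
  have hp : ∀ i, ContDiff ℝ 1 (pd i φ) := fun i => contDiff_pd hφ (by norm_num) i
  have hpc : ∀ i, HasCompactSupport (pd i φ) := fun i => HasCompactSupport.pd hc i
  set X : Fin 3 → V → ℝ := fun i v => f v * pd i φ v with hX
  have hX1 : ∀ i, ContDiff ℝ 1 (X i) := fun i => (hf2.of_le (by norm_num)).mul (hp i)
  have hXc : ∀ i, HasCompactSupport (X i) := fun i => (hpc i).mul_left
  have W2 := integral_grad_scalA_mul hf2 h0 hf hX1 hXc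
  have cA : ∀ i j, Continuous fun v => matA f v i j := fun i j => (contDiff_matA hf2 hf i j).continuous
  have cf := hf2.continuous
  have cφ := hφ.continuous
  have cpf : ∀ i, Continuous (pd i f) := fun i => continuous_pd (hf2.of_le (by norm_num)) i
  have cpφ : ∀ i, Continuous (pd i φ) := fun i => continuous_pd (hφ.of_le (by norm_num)) i
  have cppφ : ∀ i j, Continuous (pd i (pd j φ)) := fun i j => continuous_pd (hp j) i
  have cpa : ∀ i, Continuous (pd i (scalA f)) := fun i =>
    continuous_pd ((contDiff_scalA hf2 hf).of_le (by norm_num)) i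
  have z1 : ∀ i v, v ∉ tsupport φ → pd i φ v = 0 := fun i v hv => pd_eq_zero_of_notMem hv i
  have z2 : ∀ i j v, v ∉ tsupport φ → pd i (pd j φ) v = 0 := fun i j v hv =>
    pd_pd_eq_zero_of_notMem hv i j
  have int : ∀ h : V → ℝ, Continuous h → (∀ v, v ∉ tsupport φ → h v = 0) → Integrable h :=
    fun h hh hz => integrable_of_zero_outside hc hh hz
  have pX : ∀ i j v, pd j (X i) v = pd j f v * pd i φ v + f v * pd j (pd i φ) v := by
    intro i j v
    change pd j (fun v => f v * pd i φ v) v = _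
    rw [pd_mul (hf2.differentiable (by simp) v) ((hp i).differentiable (by simp) v)]
  have iI : ∀ i j, Integrable fun v => matA f v i j * (pd j f v * pd i φ v) := fun i j =>
    int _ (by fun_prop) fun v hv => by simp [z1 _ v hv]
  have iJ : ∀ i j, Integrable fun v => matA f v i j * (f v * pd j (pd i φ) v) := fun i j =>
    int _ (by fun_prop) fun v hv => by simp [z2 _ _ v hv]
  have iX : ∀ i, Integrable fun v => pd i (scalA f) v * X i v := fun i =>
    int _ (by fun_prop) fun v hv => by simp [hX, z1 _ v hv]
  have lhs : ∫ v, φ v * divergence (flux f) v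
      = - ∑ i, ∑ j, (∫ v, matA f v i j * (pd j f v * pd i φ v))
        + ∑ i, ∫ v, pd i (scalA f) v * X i v := by
    have cfl : ∀ i, ContDiff ℝ 1 fun v => flux f v i := fun i => contDiff_flux hf2 hf i
    have ib : ∀ i, Integrable fun v => pd i (fun w => flux f w i) v * φ v := fun i =>
      int _ ((continuous_pd (cfl i) i).mul cφ) fun v hv => by
        simp [image_eq_zero_of_notMem_tsupport hv]
    have e1 : ∀ v, φ v * divergence (flux f) v = ∑ i, pd i (fun w => flux f w i) v * φ v := by
      intro v; rw [divergence_eq, Finset.mul_sum]; exact Finset.sum_congr rfl fun i _ => mul_comm _ _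
    simp only [e1]
    rw [integral_finsetSum _ fun i _ => ib i, ← Finset.sum_neg_distrib, ← Finset.sum_add_distrib]
    refine Finset.sum_congr rfl fun i _ => ?_
    have := integral_mul_pd (cfl i) (hφ.of_le (by norm_num)) hc i
    rw [eq_neg_iff_add_eq_zero, add_comm, ← eq_neg_iff_add_eq_zero] at this
    rw [this]
    have e2 : ∀ v, flux f v i * pd i φ v = ∑ j, matA f v i j * (pd j f v * pd i φ v)
        - pd i (scalA f) v * X i v := by
      intro v
      rw [flux_apply, sub_mul, Finset.sum_mul]
      congr 1
      · exact Finset.sum_congr rfl fun j _ => by ring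
      · simp only [hX]; ring
    simp only [e2]
    rw [integral_sub (integrable_finsetSum _ fun j _ => iI i j) (iX i),
      integral_finsetSum _ fun j _ => iI i j]
    ring
  have e3 : ∑ i, ∑ j, ∫ v, matA f v i j * pd j (X i) v
      = ∑ i, ∑ j, (∫ v, matA f v i j * (pd j f v * pd i φ v))
        + ∑ i, ∑ j, ∫ v, matA f v i j * (f v * pd j (pd i φ) v) := by
    simp only [pX, mul_add, integral_add (iI _ _) (iJ _ _), Finset.sum_add_distrib]
  -- Second derivatives are bounded by the Lipschitz constant of the first ones.
  have hD : ∀ i j v, |pd j (pd i φ) v| ≤ L := by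
    intro i j v
    have hlip : LipschitzWith (Real.toNNReal L) (pd i φ) := by
      refine LipschitzWith.of_dist_le_mul fun x y => ?_
      rw [Real.dist_eq, dist_eq_norm, Real.coe_toNNReal _ hL0]
      exact hL i x y
    have := norm_fderiv_le_of_lipschitz ℝ hlip (x₀ := v)
    rw [Real.coe_toNNReal _ hL0] at this
    rw [pd, ← Real.norm_eq_abs]
    refine (ContinuousLinearMap.le_opNorm _ _).trans ?_
    simpa using this
  have hsc : Integrable fun v => scalA f v * f v := by
    have := hQ.integral_prod_left
    refine (this.const_mul (1 / (4 * Real.pi))).congr (Eventually.of_forall fun v => ?_)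
    simp only
    rw [scalA_eq cf hf, integral_mul_const, mul_assoc]
  have hscQ : ∫ v, scalA f v * f v ≤ (1 / 3) * Q := by
    have e : ∫ v, scalA f v * f v = 1 / (4 * Real.pi) * Q := by
      rw [hQdef, integral_prod _ hQ, ← integral_const_mul]
      congr 1 with v
      simp only
      rw [scalA_eq cf hf, integral_mul_const, mul_assoc]
    rw [e]
    gcongr
    linarith [Real.pi_gt_three]
  have bJ : ∀ i j, |∫ v, matA f v i j * (f v * pd j (pd i φ) v)| ≤ L * ((1 / 3) * Q) := by
    intro i j
    calc _ ≤ ∫ v, L * (scalA f v * f v) := by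
          rw [← Real.norm_eq_abs]
          refine norm_integral_le_of_norm_le (hsc.const_mul L) (Eventually.of_forall fun v => ?_)
          rw [norm_mul, norm_mul, Real.norm_eq_abs, Real.norm_eq_abs, Real.norm_eq_abs,
            abs_of_nonneg (h0 v)]
          have h1 := abs_matA_le cf hf h0 v i j
          have h2 := hD i j v
          have h3 := h0 v
          have h4 := scalA_nonneg cf hf h0 v
          calc |matA f v i j| * (f v * |pd j (pd i φ) v|) ≤ scalA f v * (f v * L) := by gcongr
            _ = _ := by ring
      _ ≤ _ := by rw [integral_const_mul]; gcongr
  -- The weak identity ∇·A = ∇a trades the term with ∇f for a second copy of the drift and a Hessian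
  -- term, so no derivative of f is left. The drift contributes 2·3LQ and the nine Hessian entries
  -- LQ/3 each, in all 9LQ.
  have fin : ∫ v, φ v * divergence (flux f) v
      = 2 * (∑ i, ∫ v, pd i (scalA f) v * X i v)
        + ∑ i, ∑ j, ∫ v, matA f v i j * (f v * pd j (pd i φ) v) := by
    rw [lhs]; linarith [W2, e3]
  have bJs : |∑ i, ∑ j, ∫ v, matA f v i j * (f v * pd j (pd i φ) v)| ≤ 9 * (L * ((1 / 3) * Q)) := by
    refine (Finset.abs_sum_le_sum_abs _ _).trans ?_
    calc _ ≤ ∑ i : Fin 3, ∑ j : Fin 3, L * ((1 / 3) * Q) := Finset.sum_le_sum fun i _ =>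
          (Finset.abs_sum_le_sum_abs _ _).trans (Finset.sum_le_sum fun j _ => bJ i j)
      _ = _ := by simp; ring
  change |∑ i, ∫ v, pd i (scalA f) v * X i v| ≤ 3 * L * Q at W3
  rw [fin]
  refine (abs_add_le _ _).trans ?_
  rw [abs_mul, abs_two]
  linarith

end MassWeak

/-! ### Truncated polynomial weights -/

lemma hasDerivAt_max_zero_pow (n : ℕ) (x : ℝ) :
    HasDerivAt (fun x : ℝ => max x 0 ^ (n + 2)) ((n + 2) * max x 0 ^ (n + 1)) x := by
  rcases lt_trichotomy x 0 with hx | hx | hx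
  · have h : (fun x : ℝ => max x 0 ^ (n + 2)) =ᶠ[𝓝 x] fun _ => 0 := by
      filter_upwards [Iio_mem_nhds hx] with y hy
      rw [max_eq_right (le_of_lt hy)]; simp
    rw [max_eq_right hx.le]
    simpa using (hasDerivAt_const x (0 : ℝ)).congr_of_eventuallyEq h
  · subst hx
    have : HasDerivAt (fun x : ℝ => max x 0 ^ (n + 2)) 0 0 := by
      rw [hasDerivAt_iff_isLittleO]
      simp only [max_self, ne_eq, Nat.add_eq_zero_iff, OfNat.ofNat_ne_zero, and_false,
        not_false_eq_true, zero_pow, sub_zero, smul_zero]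
      have h1 : (fun x : ℝ => max x 0 ^ (n + 2)) =O[𝓝 0] fun x : ℝ => x ^ (n + 2) := by
        refine Asymptotics.IsBigO.of_bound 1 (Eventually.of_forall fun x => ?_)
        rw [norm_pow, norm_pow, one_mul]
        gcongr
        rw [Real.norm_eq_abs, Real.norm_eq_abs, abs_of_nonneg (le_max_right _ _)]
        exact max_le (le_abs_self _) (abs_nonneg _)
      refine h1.trans_isLittleO ?_
      have := Asymptotics.isLittleO_pow_pow (𝕜 := ℝ) (show 1 < n + 2 by omega)
      simpa using this
    simpa using this
  · have h : (fun x : ℝ => max x 0 ^ (n + 2)) =ᶠ[𝓝 x] fun x => x ^ (n + 2) := by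
      filter_upwards [Ioi_mem_nhds hx] with y hy
      rw [max_eq_left (le_of_lt hy)]
    rw [max_eq_left hx.le]
    have := (hasDerivAt_pow (n + 2) x).congr_of_eventuallyEq h
    simpa using this

/-- Each further power of the positive part gains one derivative. The exponent 4 in `cutoff` gives
C³, while its square root, with exponent 2, is still C¹ as needed for Sobolev. -/
lemma contDiff_max_zero_pow (n : ℕ) : ContDiff ℝ n fun x : ℝ => max x 0 ^ (n + 1) := by
  induction n with
  | zero =>
    simp only [zero_add, pow_one]
    exact contDiff_zero.2 (continuous_id.max continuous_const)
  | succ n ih =>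
    rw [Nat.cast_succ, contDiff_succ_iff_deriv]
    refine ⟨fun x => (hasDerivAt_max_zero_pow n x).differentiableAt, by simp, ?_⟩
    have : deriv (fun x : ℝ => max x 0 ^ (n + 2)) =
        fun x : ℝ => ((n : ℝ) + 2) * max x 0 ^ (n + 1) :=
      funext fun x => (hasDerivAt_max_zero_pow n x).deriv
    rw [this]
    exact contDiff_const.mul ih

/-- The truncation `(1 - |v|²/R²)₊`. -/
noncomputable def trunc (R : ℝ) (v : V) : ℝ := max (1 - ‖v‖ ^ 2 / R ^ 2) 0

/-- The weight `(1 + |v|²)^p` cut off at radius `R`. -/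
noncomputable def cutoff (p R : ℝ) (v : V) : ℝ := (1 + ‖v‖ ^ 2) ^ p * trunc R v ^ 4

/-- The radial derivative coefficient of `cutoff`. -/
noncomputable def cutoffD (p R : ℝ) (v : V) : ℝ :=
  p * (1 + ‖v‖ ^ 2) ^ (p - 1) * trunc R v ^ 4 - 4 / R ^ 2 * (1 + ‖v‖ ^ 2) ^ p * trunc R v ^ 3

/-- The second radial derivative coefficient of `cutoff`. -/
noncomputable def cutoffD2 (p R : ℝ) (v : V) : ℝ :=
  p * (p - 1) * (1 + ‖v‖ ^ 2) ^ (p - 2) * trunc R v ^ 4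
    - 8 * p / R ^ 2 * (1 + ‖v‖ ^ 2) ^ (p - 1) * trunc R v ^ 3
    + 12 / R ^ 4 * (1 + ‖v‖ ^ 2) ^ p * trunc R v ^ 2

section Cutoff

variable (p R : ℝ)

lemma trunc_nonneg (v : V) : 0 ≤ trunc R v := le_max_right _ _

lemma trunc_le_one (v : V) : trunc R v ≤ 1 := max_le (by
  have : 0 ≤ ‖v‖ ^ 2 / R ^ 2 := by positivity
  linarith) zero_le_one

lemma continuous_trunc : Continuous (trunc R) := by
  unfold trunc
  exact (continuous_const.sub ((continuous_norm.pow 2).div_const _)).max continuous_const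

lemma contDiff_trunc_pow (n : ℕ) : ContDiff ℝ n fun v => trunc R v ^ (n + 1) :=
  (contDiff_max_zero_pow n).comp (contDiff_const.sub (contDiff_normSq.div_const _))

lemma differentiable_trunc_pow (n : ℕ) : Differentiable ℝ fun v => trunc R v ^ (n + 2) :=
  (contDiff_trunc_pow R (n + 1)).differentiable (by simp)

lemma pd_trunc_pow (n : ℕ) (i : Fin 3) (v : V) : pd i (fun v => trunc R v ^ (n + 2)) v
    = (n + 2) * trunc R v ^ (n + 1) * (-(2 / R ^ 2) * v i) := by
  have hd : DifferentiableAt ℝ (fun w : V => ‖w‖ ^ 2) v :=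
    (contDiff_normSq (n := 1)).differentiable (by simp) v
  have e : (fun w : V => 1 - ‖w‖ ^ 2 / R ^ 2) = fun w : V => 1 - (R ^ 2)⁻¹ * ‖w‖ ^ 2 := by
    funext w; rw [div_eq_inv_mul]
  have h := pd_comp (f := fun w : V => 1 - ‖w‖ ^ 2 / R ^ 2)
    (hasDerivAt_max_zero_pow n (1 - ‖v‖ ^ 2 / R ^ 2)) (v := v)
    (by rw [e]; exact (hd.const_mul _).const_sub _) i
  have h2 : pd i (fun w : V => 1 - ‖w‖ ^ 2 / R ^ 2) v = -(2 / R ^ 2) * v i := by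
    rw [e, pd_sub (by fun_prop) (hd.const_mul _), pd_const, pd_const_mul hd, pd_normSq]
    ring
  rw [h2] at h
  exact h

lemma contDiff_one_add_normSq_rpow {n : WithTop ℕ∞} : ContDiff ℝ n fun v : V => (1 + ‖v‖ ^ 2) ^ p :=
  (contDiff_const.add contDiff_normSq).rpow_const_of_ne fun v => by positivity

lemma pd_one_add_normSq_rpow (i : Fin 3) (v : V) : pd i (fun v : V => (1 + ‖v‖ ^ 2) ^ p) v
    = p * (1 + ‖v‖ ^ 2) ^ (p - 1) * (2 * v i) := by
  have hd : DifferentiableAt ℝ (fun w : V => ‖w‖ ^ 2) v :=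
    (contDiff_normSq (n := 1)).differentiable (by simp) v
  rw [pd_comp (f := fun v : V => 1 + ‖v‖ ^ 2)
    (Real.hasDerivAt_rpow_const (Or.inl (show 1 + ‖v‖ ^ 2 ≠ 0 by positivity))) (hd.const_add _),
    pd_add (by fun_prop) hd, pd_const, pd_normSq, zero_add]

lemma differentiable_one_add_normSq_rpow : Differentiable ℝ fun v : V => (1 + ‖v‖ ^ 2) ^ p :=
  (contDiff_one_add_normSq_rpow p (n := 1)).differentiable (by simp)

lemma contDiff_cutoff : ContDiff ℝ 3 (cutoff p R) :=
  (contDiff_one_add_normSq_rpow p).mul (contDiff_trunc_pow R 3)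

lemma cutoff_nonneg (v : V) : 0 ≤ cutoff p R v := by
  unfold cutoff; have := trunc_nonneg R v; positivity

lemma pd_cutoff (i : Fin 3) (v : V) : pd i (cutoff p R) v = 2 * v i * cutoffD p R v := by
  unfold cutoff cutoffD
  rw [pd_mul (differentiable_one_add_normSq_rpow p v) (differentiable_trunc_pow R 2 v),
    pd_one_add_normSq_rpow, pd_trunc_pow]
  push_cast; ring

lemma differentiable_cutoffD : Differentiable ℝ (cutoffD p R) := by
  unfold cutoffD
  exact (((differentiable_one_add_normSq_rpow _).const_mul p).mul (differentiable_trunc_pow R 2)).sub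
    (((differentiable_one_add_normSq_rpow _).const_mul _).mul (differentiable_trunc_pow R 1))

lemma pd_cutoffD (i : Fin 3) (v : V) : pd i (cutoffD p R) v = 2 * v i * cutoffD2 p R v := by
  unfold cutoffD cutoffD2
  have d1 := differentiable_one_add_normSq_rpow (p - 1) v
  have d2 := differentiable_one_add_normSq_rpow p v
  have t1 := differentiable_trunc_pow R 2 v
  have t2 := differentiable_trunc_pow R 1 v
  simp only [Nat.reduceAdd] at t1 t2
  have e1 := pd_trunc_pow R 2 i v
  have e2 := pd_trunc_pow R 1 i v
  simp only [Nat.reduceAdd] at e1 e2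
  rw [pd_sub ((d1.const_mul _).fun_mul t1) ((d2.const_mul _).fun_mul t2),
    pd_mul (d1.const_mul _) t1, pd_mul (d2.const_mul _) t2, pd_const_mul d1, pd_const_mul d2,
    pd_one_add_normSq_rpow, pd_one_add_normSq_rpow, e1, e2, sub_sub]
  norm_num
  ring

lemma pd_pd_cutoff (i j : Fin 3) (v : V) : pd j (pd i (cutoff p R)) v
    = (if j = i then 2 else 0) * cutoffD p R v + 4 * v i * v j * cutoffD2 p R v := by
  have : pd i (cutoff p R) = fun v => 2 * (v i * cutoffD p R v) :=
    funext fun v => by rw [pd_cutoff]; ring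
  have hi : DifferentiableAt ℝ (fun w : V => w i) v :=
    (contDiff_coord (n := 1) i).differentiable (by simp) v
  have hD := differentiable_cutoffD p R v
  rw [this, pd_const_mul (hi.fun_mul hD), pd_mul hi hD, pd_coord, pd_cutoffD]
  split_ifs <;> ring

variable {p R}

lemma trunc_eq_zero (hR : 0 < R) {v : V} (hv : R ≤ ‖v‖) : trunc R v = 0 := by
  unfold trunc
  refine max_eq_right ?_
  rw [sub_nonpos, one_le_div (by positivity)]
  gcongr

lemma cutoff_eq_zero (hR : 0 < R) {v : V} (hv : R ≤ ‖v‖) : cutoff p R v = 0 := by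
  rw [cutoff, trunc_eq_zero hR hv]; simp

lemma hasCompactSupport_cutoff (hR : 0 < R) : HasCompactSupport (cutoff p R) := by
  refine HasCompactSupport.intro (isCompact_closedBall (0 : V) R) fun v hv => cutoff_eq_zero hR ?_
  simp at hv; exact hv.le

lemma cutoff_le (v : V) : cutoff p R v ≤ (1 + ‖v‖ ^ 2) ^ p := by
  unfold cutoff
  exact mul_le_of_le_one_right (by positivity) (pow_le_one₀ (trunc_nonneg R v) (trunc_le_one R v))

lemma tendsto_cutoff (v : V) : Tendsto (fun n : ℕ => cutoff p (n + 1) v) atTop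
    (𝓝 ((1 + ‖v‖ ^ 2) ^ p)) := by
  have h1 : Tendsto (fun n : ℕ => trunc (n + 1) v) atTop (𝓝 (max (1 - 0) 0)) := by
    refine Tendsto.max (tendsto_const_nhds.sub ?_) tendsto_const_nhds
    have : Tendsto (fun n : ℕ => ((n : ℝ) + 1) ^ 2) atTop atTop :=
      (tendsto_pow_atTop two_ne_zero).comp
        (tendsto_atTop_add_const_right _ _ tendsto_natCast_atTop_atTop)
    exact tendsto_const_nhds.div_atTop this
  have h2 := (h1.pow 4).const_mul ((1 + ‖v‖ ^ 2) ^ p)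
  simpa [cutoff] using h2

/-- On the support 1 + |v|² ≤ 2R², so each factor R⁻² produced by differentiating the truncation is
as good as ⟨v⟩⁻². The derivative bounds below are therefore uniform in R. -/
lemma one_add_normSq_mul_trunc_le (hR : 1 ≤ R) (v : V) :
    (1 + ‖v‖ ^ 2) / R ^ 2 * trunc R v ≤ 2 * trunc R v := by
  by_cases h : R ≤ ‖v‖
  · rw [trunc_eq_zero (by linarith) h]; simp
  · have h := not_le.1 h
    refine mul_le_mul_of_nonneg_right ?_ (trunc_nonneg R v)
    rw [div_le_iff₀ (by positivity)]
    nlinarith [norm_nonneg v]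

/-- One power of the truncation is lost, and that suffices: the square is of order χ⁶ = χ⁴ · χ², so
it is controlled by the cutoff times a power that remains. -/
lemma abs_cutoffD_le (hp : 0 ≤ p) (hR : 1 ≤ R) (v : V) :
    |cutoffD p R v| ≤ (p + 8) * ((1 + ‖v‖ ^ 2) ^ (p - 1) * trunc R v ^ 3) := by
  have hT : 0 < 1 + ‖v‖ ^ 2 := by positivity
  set χ := trunc R v
  have hχ0 : 0 ≤ χ := trunc_nonneg R v
  have hχ1 : χ ≤ 1 := trunc_le_one R v
  have ht := one_add_normSq_mul_trunc_le hR v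
  have e : cutoffD p R v = (1 + ‖v‖ ^ 2) ^ (p - 1) * χ ^ 2 *
      (p * χ ^ 2 - 4 * ((1 + ‖v‖ ^ 2) / R ^ 2 * χ)) := by
    have : (1 + ‖v‖ ^ 2) ^ p = (1 + ‖v‖ ^ 2) ^ (p - 1) * (1 + ‖v‖ ^ 2) := by
      rw [← Real.rpow_add_one hT.ne']; ring_nf
    rw [cutoffD, this]; ring
  have h0 : 0 ≤ (1 + ‖v‖ ^ 2) / R ^ 2 * χ := by positivity
  rw [e, abs_mul, abs_of_nonneg (show 0 ≤ (1 + ‖v‖ ^ 2) ^ (p - 1) * χ ^ 2 by positivity)]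
  calc _ ≤ (1 + ‖v‖ ^ 2) ^ (p - 1) * χ ^ 2 * ((p + 8) * χ) := by
        gcongr
        rw [abs_le]
        have : p * χ ^ 2 ≤ p * χ := by
          gcongr; nlinarith
        have : 0 ≤ p * χ := by positivity
        have : 0 ≤ p * χ ^ 2 := by positivity
        constructor <;> linarith
    _ = _ := by ring

lemma abs_cutoffD2_le (hp : 0 ≤ p) (hR : 1 ≤ R) (v : V) :
    |cutoffD2 p R v| * (1 + ‖v‖ ^ 2) ≤
      (p * (p + 1) + 16 * p + 48) * ((1 + ‖v‖ ^ 2) ^ (p - 1) * trunc R v ^ 2) := by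
  have hT : 0 < 1 + ‖v‖ ^ 2 := by positivity
  have ht := one_add_normSq_mul_trunc_le hR v
  set χ := trunc R v with hχ
  have hχ0 : 0 ≤ χ := trunc_nonneg R v
  have hχ1 : χ ≤ 1 := trunc_le_one R v
  set t := (1 + ‖v‖ ^ 2) / R ^ 2 with htd
  have ht0 : 0 ≤ t := by positivity
  have e : cutoffD2 p R v * (1 + ‖v‖ ^ 2) = (1 + ‖v‖ ^ 2) ^ (p - 1) *
      (p * (p - 1) * χ ^ 4 - 8 * p * χ ^ 2 * (t * χ) + 12 * (t * χ) ^ 2) := by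
    have h1 : (1 + ‖v‖ ^ 2) ^ p = (1 + ‖v‖ ^ 2) ^ (p - 1) * (1 + ‖v‖ ^ 2) := by
      rw [← Real.rpow_add_one hT.ne']; ring_nf
    have h2 : (1 + ‖v‖ ^ 2) ^ (p - 1) = (1 + ‖v‖ ^ 2) ^ (p - 2) * (1 + ‖v‖ ^ 2) := by
      rw [← Real.rpow_add_one hT.ne']; ring_nf
    rw [cutoffD2, ← hχ, h1, h2, htd]
    field_simp
  rw [← abs_of_pos hT, ← abs_mul, abs_of_pos hT, e, abs_mul,
    abs_of_nonneg (show 0 ≤ (1 + ‖v‖ ^ 2) ^ (p - 1) by positivity)]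
  have hk : |p * (p - 1) * χ ^ 4 - 8 * p * χ ^ 2 * (t * χ) + 12 * (t * χ) ^ 2|
      ≤ (p * (p + 1) + 16 * p + 48) * χ ^ 2 := by
    have h4 : χ ^ 4 ≤ χ ^ 2 := pow_le_pow_of_le_one hχ0 hχ1 (by norm_num)
    have h3 : χ ^ 2 * (t * χ) ≤ 2 * χ ^ 2 := by
      have : t * χ ≤ 2 := ht.trans (by linarith)
      nlinarith [sq_nonneg χ]
    have h5 : (t * χ) ^ 2 ≤ 4 * χ ^ 2 := by
      calc (t * χ) ^ 2 ≤ (2 * χ) ^ 2 := by gcongr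
        _ = _ := by ring
    have n1 : 0 ≤ χ ^ 4 := by positivity
    have n2 : 0 ≤ p * (χ ^ 2 * (t * χ)) := by positivity
    have n3 : 0 ≤ (t * χ) ^ 2 := by positivity
    have m1 : p * p * χ ^ 4 ≤ p * p * χ ^ 2 := by gcongr
    have m2 : p * χ ^ 4 ≤ p * χ ^ 2 := by gcongr
    have m3 : p * (χ ^ 2 * (t * χ)) ≤ p * (2 * χ ^ 2) := by gcongr
    have m4 : 0 ≤ p * p * χ ^ 4 := by positivity
    have m5 : 0 ≤ p * χ ^ 4 := by positivity
    rw [abs_le]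
    constructor <;> nlinarith
  calc _ ≤ (1 + ‖v‖ ^ 2) ^ (p - 1) * ((p * (p + 1) + 16 * p + 48) * χ ^ 2) := by gcongr
    _ = _ := by ring

/-- The gradient of the unweighted cutoff is Lipschitz with constant `O(R⁻²)`. -/
lemma abs_pd_cutoff_zero_sub_le (hR : 1 ≤ R) (i : Fin 3) (v z : V) :
    |pd i (cutoff 0 R) v - pd i (cutoff 0 R) z| ≤ 672 / R ^ 2 * ‖v - z‖ := by
  have hR0 : 0 < R := by linarith
  -- The two terms of the Hessian contribute 8 and 48; 224 is a generous bound, and 672 = 3 · 224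
  -- dominates √3 · 224 for the norm of the gradient.
  have hpd : ∀ j w, |pd j (pd i (cutoff 0 R)) w| ≤ 224 / R ^ 2 := by
    intro j w
    have hχ0 : 0 ≤ trunc R w := trunc_nonneg R w
    have hχ1 : trunc R w ≤ 1 := trunc_le_one R w
    by_cases h : R ≤ ‖w‖
    · have h0 := trunc_eq_zero hR0 h
      rw [pd_pd_cutoff, cutoffD, cutoffD2, h0]
      simp; positivity
    have h := (not_le.1 h).le
    have e1 : cutoffD 0 R w = -(4 / R ^ 2 * trunc R w ^ 3) := by simp [cutoffD]
    have e2 : cutoffD2 0 R w = 12 / R ^ 4 * trunc R w ^ 2 := by simp [cutoffD2]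
    have c3 : trunc R w ^ 3 ≤ 1 := pow_le_one₀ hχ0 hχ1
    have c2 : trunc R w ^ 2 ≤ 1 := pow_le_one₀ hχ0 hχ1
    rw [pd_pd_cutoff, e1, e2]
    refine (abs_add_le _ _).trans ?_
    have a1 : |(if j = i then (2 : ℝ) else 0) * -(4 / R ^ 2 * trunc R w ^ 3)| ≤ 8 / R ^ 2 := by
      rw [abs_mul, abs_neg, abs_of_nonneg (show 0 ≤ 4 / R ^ 2 * trunc R w ^ 3 by positivity)]
      calc _ ≤ 2 * (4 / R ^ 2 * 1) := by
            gcongr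
            split_ifs <;> norm_num
        _ = _ := by ring
    have a2 : |4 * w i * w j * (12 / R ^ 4 * trunc R w ^ 2)| ≤ 48 / R ^ 2 := by
      rw [abs_mul, abs_mul, abs_mul, abs_of_nonneg (show 0 ≤ 12 / R ^ 4 * trunc R w ^ 2 by positivity)]
      have b1 := (abs_coord_le w i).trans h
      have b2 := (abs_coord_le w j).trans h
      calc _ ≤ |(4 : ℝ)| * R * R * (12 / R ^ 4 * 1) := by gcongr
        _ = _ := by rw [abs_of_pos (by norm_num)]; field_simp; norm_num
    calc _ ≤ 8 / R ^ 2 + 48 / R ^ 2 := add_le_add a1 a2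
      _ ≤ _ := by rw [← add_div]; gcongr; norm_num
  have hd : ∀ w, ‖fderiv ℝ (pd i (cutoff 0 R)) w‖ ≤ 672 / R ^ 2 := by
    intro w
    have h1 := norm_fderiv_sq (pd i (cutoff 0 R)) w
    have h2 : ∑ j, pd j (pd i (cutoff 0 R)) w ^ 2 ≤ ∑ _j : Fin 3, (224 / R ^ 2) ^ 2 := by
      refine Finset.sum_le_sum fun j _ => ?_
      rw [← sq_abs]
      have := hpd j w
      gcongr
    refine abs_le_of_sq_le_sq' ?_ (by positivity) |>.2
    rw [h1]
    refine h2.trans ?_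
    simp only [Finset.sum_const, Finset.card_univ, Fintype.card_fin, nsmul_eq_mul]
    have : (672 / R ^ 2) ^ 2 = 9 * (224 / R ^ 2) ^ 2 := by ring
    rw [this]
    push_cast
    nlinarith [sq_nonneg (224 / R ^ 2)]
  have hdiff : Differentiable ℝ (pd i (cutoff 0 R)) :=
    (contDiff_pd (m := 1) (contDiff_cutoff 0 R) (by norm_num) i).differentiable (by simp)
  have := Convex.norm_image_sub_le_of_norm_fderiv_le (𝕜 := ℝ) (f := pd i (cutoff 0 R))
    (s := Set.univ) (x := z) (y := v) (fun x _ => hdiff x) (fun x _ => hd x) convex_univ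
    (Set.mem_univ _) (Set.mem_univ _)
  simpa using this

end Cutoff

/-! ### The localised energy inequality -/

/-- The constant in the localisation errors of the energy inequality. -/
noncomputable def locConst (p : ℝ) : ℝ :=
  48 * (p + 8) ^ 2 + 2 * (p + 8) + 4 * (p * (p + 1) + 16 * p + 48)

lemma locConst_pos {p : ℝ} (hp : 0 ≤ p) : 0 < locConst p := by unfold locConst; positivity

section

variable {p R : ℝ} (hp : 0 ≤ p) (hR : 1 ≤ R)
include hp hR

/-- Weighted Young, spending 1/3 of the available 4/3 of the dissipation. The constant 48 solves 8²
= 4 · (1/3) · 48, and A ≤ a·I bounds the form on the vector v produced by ∇φ. -/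
lemma drift_error_le {A : Matrix (Fin 3) (Fin 3) ℝ} (hA : ∀ i j, A i j = A j i)
    (hpos : ∀ x, 0 ≤ bil A x x) {a : ℝ} (ha : ∀ x, bil A x x ≤ a * ∑ i, x i ^ 2) (ha0 : 0 ≤ a)
    {g : ℝ} (hg : 0 ≤ g) (x : Fin 3 → ℝ) (v : V) :
    |4 * ∑ i, ∑ j, A i j * (g * x j * pd i (cutoff p R) v)| ≤
      1 / 3 * (cutoff p R v * bil A x x)
        + 48 * (p + 8) ^ 2 * ((1 + ‖v‖ ^ 2) ^ p * trunc R v ^ 2 * g ^ 2 * a) := by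
  have hT : 0 < 1 + ‖v‖ ^ 2 := by positivity
  have hχ0 := trunc_nonneg R v
  have hD := abs_cutoffD_le hp hR v
  set D := cutoffD p R v
  have e : 4 * ∑ i, ∑ j, A i j * (g * x j * pd i (cutoff p R) v)
      = 8 * g * D * bil A x (fun i => v i) := by
    simp only [pd_cutoff, bil, Finset.mul_sum]
    rw [Finset.sum_comm]
    refine Finset.sum_congr rfl fun i _ => Finset.sum_congr rfl fun j _ => ?_
    rw [hA i j]; ring
  have h1 : (1 + ‖v‖ ^ 2) ^ p = (1 + ‖v‖ ^ 2) ^ (p - 1) * (1 + ‖v‖ ^ 2) := by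
    rw [← Real.rpow_add_one hT.ne']; ring_nf
  have h2 : (1 + ‖v‖ ^ 2) ^ (p - 1) = (1 + ‖v‖ ^ 2) ^ (p - 2) * (1 + ‖v‖ ^ 2) := by
    rw [← Real.rpow_add_one hT.ne']; ring_nf
  set S := (1 + ‖v‖ ^ 2) ^ (p - 2) with hS
  have hS0 : 0 ≤ S := by positivity
  have key := mul_abs_bil_le hA hpos (c := 8 * g * |D|) (α := 1 / 3 * cutoff p R v)
    (β := 48 * (p + 8) ^ 2 * (S * trunc R v ^ 2 * g ^ 2))
    (by have := cutoff_nonneg p R v; positivity) (by positivity) (by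
      calc (8 * g * |D|) ^ 2 ≤ (8 * g * ((p + 8) * ((1 + ‖v‖ ^ 2) ^ (p - 1) * trunc R v ^ 3))) ^ 2 := by
            gcongr
        _ = _ := by rw [cutoff, h1, h2]; ring) x (fun i => v i)
  rw [e, abs_mul, abs_mul, abs_mul, abs_of_nonneg hg, abs_of_pos (show (0 : ℝ) < 8 by norm_num)]
  refine key.trans ?_
  rw [mul_assoc (1 / 3)]
  refine add_le_add_right ?_ _
  rw [mul_assoc (48 * (p + 8) ^ 2)]
  refine mul_le_mul_of_nonneg_left ?_ (by positivity)
  have h3 := ha (fun i => v i)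
  rw [← norm_sq_eq_sum] at h3
  have h4 : ‖v‖ ^ 2 ≤ (1 + ‖v‖ ^ 2) * (1 + ‖v‖ ^ 2) := by nlinarith [sq_nonneg ‖v‖]
  calc S * trunc R v ^ 2 * g ^ 2 * bil A (fun i => v i) (fun i => v i)
      ≤ S * trunc R v ^ 2 * g ^ 2 * (a * ((1 + ‖v‖ ^ 2) * (1 + ‖v‖ ^ 2))) := by
        gcongr; exact h3.trans (by gcongr)
    _ = _ := by rw [h1, h2]; ring

/-- For a radial weight D²φ is a multiple of I plus a multiple of v ⊗ v, so A:D²φ involves only the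
trace a and the form A v·v ≤ a|v|². -/
lemma hessian_error_le {A : Matrix (Fin 3) (Fin 3) ℝ}
    (hpos : ∀ x, 0 ≤ bil A x x) {a : ℝ} (ha : ∀ x, bil A x x ≤ a * ∑ i, x i ^ 2) (ha0 : 0 ≤ a)
    (htr : a = ∑ i, A i i) {q : ℝ} (hq : 0 ≤ q) (v : V) :
    |∑ i, ∑ j, q * (A i j * pd j (pd i (cutoff p R)) v)| ≤
      (2 * (p + 8) + 4 * (p * (p + 1) + 16 * p + 48)) *
        ((1 + ‖v‖ ^ 2) ^ p * trunc R v ^ 2 * q * a) := by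
  have hT1 : 1 ≤ 1 + ‖v‖ ^ 2 := by nlinarith [sq_nonneg ‖v‖]
  have hT : 0 < 1 + ‖v‖ ^ 2 := by positivity
  have hχ0 := trunc_nonneg R v
  have hχ1 := trunc_le_one R v
  have hD := abs_cutoffD_le hp hR v
  have hD2 := abs_cutoffD2_le hp hR v
  have e : ∑ i, ∑ j, q * (A i j * pd j (pd i (cutoff p R)) v)
      = q * (2 * a * cutoffD p R v
        + 4 * cutoffD2 p R v * bil A (fun i => v i) (fun i => v i)) := by
    simp only [pd_pd_cutoff, bil, Fin.sum_univ_three, htr]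
    simp
    ring
  have h1 : (1 + ‖v‖ ^ 2) ^ (p - 1) ≤ (1 + ‖v‖ ^ 2) ^ p :=
    Real.rpow_le_rpow_of_exponent_le hT1 (by linarith)
  have h3 := ha (fun i => v i)
  rw [← norm_sq_eq_sum] at h3
  have h4 : bil A (fun i => v i) (fun i => v i) ≤ a * (1 + ‖v‖ ^ 2) :=
    h3.trans (by gcongr; linarith)
  set W := (1 + ‖v‖ ^ 2) ^ p
  set W1 := (1 + ‖v‖ ^ 2) ^ (p - 1)
  have hW1 : 0 ≤ W1 := by positivity
  have b1 : |2 * a * cutoffD p R v| ≤ 2 * (p + 8) * (W * trunc R v ^ 2 * a) := by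
    rw [abs_mul, abs_of_nonneg (by positivity : 0 ≤ 2 * a)]
    calc _ ≤ 2 * a * ((p + 8) * (W1 * trunc R v ^ 3)) := by gcongr
      _ ≤ 2 * a * ((p + 8) * (W * trunc R v ^ 2)) := by
          gcongr 2 * a * ((p + 8) * (?_ * ?_))
          exact pow_le_pow_of_le_one hχ0 hχ1 (by norm_num)
      _ = _ := by ring
  have b2 : |4 * cutoffD2 p R v * bil A (fun i => v i) (fun i => v i)|
      ≤ 4 * (p * (p + 1) + 16 * p + 48) * (W * trunc R v ^ 2 * a) := by
    rw [abs_mul, abs_mul, abs_of_nonneg (hpos _), abs_of_pos (show (0 : ℝ) < 4 by norm_num)]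
    calc _ ≤ 4 * |cutoffD2 p R v| * (a * (1 + ‖v‖ ^ 2)) := by gcongr
      _ = 4 * a * (|cutoffD2 p R v| * (1 + ‖v‖ ^ 2)) := by ring
      _ ≤ 4 * a * ((p * (p + 1) + 16 * p + 48) * (W1 * trunc R v ^ 2)) := by gcongr
      _ ≤ 4 * a * ((p * (p + 1) + 16 * p + 48) * (W * trunc R v ^ 2)) := by gcongr
      _ = _ := by ring
  rw [e, abs_mul, abs_of_nonneg hq]
  calc _ ≤ q * (2 * (p + 8) * (W * trunc R v ^ 2 * a)
        + 4 * (p * (p + 1) + 16 * p + 48) * (W * trunc R v ^ 2 * a)) := by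
        gcongr
        exact (abs_add_le _ _).trans (add_le_add b1 b2)
    _ = _ := by ring

variable {f : V → ℝ} (hf2 : ContDiff ℝ 2 f) (h0 : ∀ v, 0 ≤ f v) (hf : Integrable f)
include hf2 h0 hf

/-- The energy inequality with localisation errors in terms of `a[f]` only. -/
lemma energy_inequality :
    ∫ v, cutoff p R v * (3 / 2 * f v ^ (1 / 2 : ℝ)) * divergence (flux f) v ≤
      - (∫ v, cutoff p R v * bil (matA f v) (fun i => pd i (fun w => f w ^ (3 / 4 : ℝ)) v)
          (fun i => pd i (fun w => f w ^ (3 / 4 : ℝ)) v))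
      + locConst p * (∫ v, (1 + ‖v‖ ^ 2) ^ p * trunc R v ^ 2 * f v ^ (3 / 2 : ℝ) * scalA f v)
      + newtonConst / (8 * Real.pi) * (∫ v, cutoff p R v * f v ^ (5 / 2 : ℝ)) := by
  have hR0 : 0 < R := by linarith
  have hφ : ContDiff ℝ 2 (cutoff p R) := (contDiff_cutoff p R).of_le (by norm_num)
  have hc : HasCompactSupport (cutoff p R) := hasCompactSupport_cutoff hR0
  have id := energy_identity hf2 h0 hf hφ hc
  have cA : ∀ i j, Continuous fun v => matA f v i j := fun i j => (contDiff_matA hf2 hf i j).continuous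
  have ca : Continuous (scalA f) := (contDiff_scalA hf2 hf).continuous
  have cf := hf2.continuous
  have cφ := hφ.continuous
  have cpφ : ∀ i, Continuous (pd i (cutoff p R)) := fun i => continuous_pd (hφ.of_le (by norm_num)) i
  have cppφ : ∀ i j, Continuous (pd i (pd j (cutoff p R))) := fun i j =>
    continuous_pd (contDiff_pd hφ (by norm_num) j) i
  have cg := contDiff_rpow_three_quarters hf2 h0
  have cg0 := cg.continuous
  have cpg : ∀ i, Continuous (pd i fun w => f w ^ (3 / 4 : ℝ)) := fun i => continuous_pd cg i
  have c32 : Continuous fun v => f v ^ (3 / 2 : ℝ) := cf.rpow_const fun _ => Or.inr (by norm_num)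
  have cT : Continuous fun v : V => (1 + ‖v‖ ^ 2) ^ p := (contDiff_one_add_normSq_rpow p (n := 0)).continuous
  have cχ := continuous_trunc R
  have z0 : ∀ v, v ∉ Metric.closedBall (0 : V) R → cutoff p R v = 0 := fun v hv =>
    cutoff_eq_zero hR0 (by simp at hv; exact hv.le)
  have zt : ∀ v, v ∉ Metric.closedBall (0 : V) R → trunc R v = 0 := fun v hv =>
    trunc_eq_zero hR0 (by simp at hv; exact hv.le)
  have z1 : ∀ i v, v ∉ tsupport (cutoff p R) → pd i (cutoff p R) v = 0 := fun i v hv =>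
    pd_eq_zero_of_notMem hv i
  have z2 : ∀ i j v, v ∉ tsupport (cutoff p R) → pd i (pd j (cutoff p R)) v = 0 := fun i j v hv =>
    pd_pd_eq_zero_of_notMem hv i j
  have hK := isCompact_closedBall (0 : V) R
  set G : V → Fin 3 → ℝ := fun v i => pd i (fun w => f w ^ (3 / 4 : ℝ)) v with hG
  set I1 : V → ℝ := fun v => cutoff p R v * bil (matA f v) (G v) (G v) with hI1
  set I2 : V → ℝ := fun v => (1 + ‖v‖ ^ 2) ^ p * trunc R v ^ 2 * f v ^ (3 / 2 : ℝ) * scalA f v with hI2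
  set E1 : V → ℝ := fun v => ∑ i, ∑ j, matA f v i j *
    (f v ^ (3 / 4 : ℝ) * pd j (fun w => f w ^ (3 / 4 : ℝ)) v * pd i (cutoff p R) v) with hE1
  set E2 : V → ℝ := fun v => ∑ i, ∑ j, f v ^ (3 / 2 : ℝ) * (matA f v i j * pd j (pd i (cutoff p R)) v)
    with hE2
  have i1 : Integrable I1 := by
    refine integrable_of_zero_outside hK ?_ fun v hv => by simp [hI1, z0 v hv]
    simp only [hI1, bil, hG]; fun_prop
  have i2 : Integrable I2 := by
    refine integrable_of_zero_outside hK (by fun_prop) fun v hv => by simp [hI2, zt v hv]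
  have iE1 : Integrable E1 := integrable_of_zero_outside hc (by fun_prop)
    fun v hv => by simp [hE1, z1 _ v hv]
  have iE2 : Integrable E2 := integrable_of_zero_outside hc (by fun_prop)
    fun v hv => by simp [hE2, z2 _ _ v hv]
  have point : ∀ v, -4 * E1 v - E2 v ≤ 1 / 3 * I1 v + locConst p * I2 v := by
    intro v
    have d1 := drift_error_le hp hR (matA_symm f v) (bil_matA_nonneg cf hf h0 v)
      (bil_matA_le cf hf h0 v) (scalA_nonneg cf hf h0 v) (Real.rpow_nonneg (h0 v) (3 / 4)) (G v) v
    have d2 := hessian_error_le hp hR (bil_matA_nonneg cf hf h0 v)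
      (bil_matA_le cf hf h0 v) (scalA_nonneg cf hf h0 v) (scalA_eq_sum f v)
      (Real.rpow_nonneg (h0 v) (3 / 2)) v
    have e : (f v ^ (3 / 4 : ℝ)) ^ 2 = f v ^ (3 / 2 : ℝ) := by
      rw [← Real.rpow_natCast, ← Real.rpow_mul (h0 v)]; norm_num
    rw [e] at d1
    have d1' := (abs_le.1 d1).1
    have d2' := (abs_le.1 d2).1
    change - _ ≤ 4 * E1 v at d1'
    change - _ ≤ E2 v at d2'
    change _ ≤ 1 / 3 * (cutoff p R v * bil (matA f v) (G v) (G v)) + locConst p *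
      ((1 + ‖v‖ ^ 2) ^ p * trunc R v ^ 2 * f v ^ (3 / 2 : ℝ) * scalA f v)
    unfold locConst
    linarith
  have hint : - 4 * (∫ v, E1 v) - ∫ v, E2 v ≤ 1 / 3 * (∫ v, I1 v) + locConst p * ∫ v, I2 v := by
    have := integral_mono ((iE1.const_mul (-4)).sub iE2) ((i1.const_mul (1 / 3)).add
      (i2.const_mul (locConst p))) point
    simp only [Pi.sub_apply, Pi.add_apply] at this
    rw [integral_sub (iE1.const_mul (-4)) iE2, integral_add (i1.const_mul (1 / 3))
      (i2.const_mul (locConst p)), integral_const_mul, integral_const_mul,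
      integral_const_mul] at this
    linarith
  have idl : ∫ v, cutoff p R v * (3 / 2 * f v ^ (1 / 2 : ℝ)) * divergence (flux f) v
      = - (4 / 3) * (∫ v, I1 v) - 4 * (∫ v, E1 v)
      + newtonConst / (8 * Real.pi) * (∫ v, cutoff p R v * f v ^ (5 / 2 : ℝ)) - ∫ v, E2 v := id
  rw [idl]
  linarith

end

/-! ### Hölder and convolution inequalities -/

lemma lintegral_mul_le_three_halves {α : Type*} [MeasurableSpace α] {μ : Measure α}
    {a b : α → ℝ≥0∞} (ha : AEMeasurable a μ) (hb : AEMeasurable b μ) :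
    ∫⁻ x, a x * b x ∂μ ≤
      (∫⁻ x, a x ^ (3 / 2 : ℝ) ∂μ) ^ (2 / 3 : ℝ) * (∫⁻ x, b x ^ (3 : ℝ) ∂μ) ^ (1 / 3 : ℝ) := by
  have h : (3 / 2 : ℝ).HolderConjugate 3 := by
    rw [Real.holderConjugate_iff]; norm_num
  have := ENNReal.lintegral_mul_le_Lp_mul_Lq μ h ha hb
  simpa [show (1 : ℝ) / (3 / 2) = 2 / 3 by norm_num] using this

lemma lintegral_sqrt_mul_sq_le {α : Type*} [MeasurableSpace α] {μ : Measure α}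
    {a b : α → ℝ≥0∞} (ha : AEMeasurable a μ) (hb : AEMeasurable b μ) :
    ∫⁻ x, a x ^ (1 / 2 : ℝ) * b x ^ (2 : ℝ) ∂μ ≤
      (∫⁻ x, a x ^ (3 / 2 : ℝ) ∂μ) ^ (1 / 3 : ℝ) * (∫⁻ x, b x ^ (3 : ℝ) ∂μ) ^ (2 / 3 : ℝ) := by
  have := lintegral_mul_le_three_halves (hb.pow_const (2 : ℝ)) (ha.pow_const (1 / 2 : ℝ))
  have e1 : ∀ x, (b x ^ (2 : ℝ)) ^ (3 / 2 : ℝ) = b x ^ (3 : ℝ) := fun x => by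
    rw [← ENNReal.rpow_mul]; norm_num
  have e2 : ∀ x, (a x ^ (1 / 2 : ℝ)) ^ (3 : ℝ) = a x ^ (3 / 2 : ℝ) := fun x => by
    rw [← ENNReal.rpow_mul, show (1 / 2 : ℝ) * 3 = 3 / 2 by norm_num]
  simp only [e1, e2] at this
  rw [mul_comm ((∫⁻ x, a x ^ (3 / 2 : ℝ) ∂μ) ^ (1 / 3 : ℝ))]
  refine le_trans (le_of_eq ?_) this
  exact lintegral_congr fun x => mul_comm _ _

/-- Pointwise half of Young's inequality. Write KF = (KF)^{1/2} (KF)^{1/2}, apply Hölder with 3/2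
and 3, then Cauchy–Schwarz to ∫ (KF)^{3/4}. The first factor on the right can afterwards be
integrated in the convolution variable by Tonelli. -/
lemma lintegral_mul_rpow_three_le {α : Type*} [MeasurableSpace α] {μ : Measure α}
    {F K : α → ℝ≥0∞} (hF : AEMeasurable F μ) (hK : AEMeasurable K μ) :
    (∫⁻ x, K x * F x ∂μ) ^ (3 : ℝ) ≤
      (∫⁻ x, K x ^ (3 / 2 : ℝ) * F x ^ (3 / 2 : ℝ) ∂μ) *
        ((∫⁻ x, K x ^ (3 / 2 : ℝ) ∂μ) * ∫⁻ x, F x ^ (3 / 2 : ℝ) ∂μ) := by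
  set P : α → ℝ≥0∞ := fun x => (K x * F x) ^ (1 / 2 : ℝ) with hP
  have hPm : AEMeasurable P μ := (hK.mul hF).pow_const _
  have h1 := lintegral_mul_le_three_halves hPm hPm
  have e1 : ∀ x, P x * P x = K x * F x := by
    intro x
    rw [hP]
    simp only
    rw [← ENNReal.rpow_add_of_nonneg _ _ (by norm_num) (by norm_num)]
    norm_num
  have e2 : ∀ x, P x ^ (3 / 2 : ℝ) = K x ^ (3 / 4 : ℝ) * F x ^ (3 / 4 : ℝ) := by
    intro x
    simp only [hP]
    rw [← ENNReal.rpow_mul, ENNReal.mul_rpow_of_nonneg _ _ (by norm_num)]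
    norm_num
  have e3 : ∀ x, P x ^ (3 : ℝ) = K x ^ (3 / 2 : ℝ) * F x ^ (3 / 2 : ℝ) := by
    intro x
    simp only [hP]
    rw [← ENNReal.rpow_mul, ENNReal.mul_rpow_of_nonneg _ _ (by norm_num)]
    norm_num
  simp only [e1, e2, e3] at h1
  have h2 : ∫⁻ x, K x ^ (3 / 4 : ℝ) * F x ^ (3 / 4 : ℝ) ∂μ ≤
      (∫⁻ x, K x ^ (3 / 2 : ℝ) ∂μ) ^ (1 / 2 : ℝ) * (∫⁻ x, F x ^ (3 / 2 : ℝ) ∂μ) ^ (1 / 2 : ℝ) := by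
    have h : (2 : ℝ).HolderConjugate 2 := by rw [Real.holderConjugate_iff]; norm_num
    have := ENNReal.lintegral_mul_le_Lp_mul_Lq μ h (hK.pow_const (3 / 4 : ℝ)) (hF.pow_const (3 / 4 : ℝ))
    have e : ∀ G : α → ℝ≥0∞, ∀ x, (G x ^ (3 / 4 : ℝ)) ^ (2 : ℝ) = G x ^ (3 / 2 : ℝ) := fun G x => by
      rw [← ENNReal.rpow_mul, show (3 / 4 : ℝ) * 2 = 3 / 2 by norm_num]
    simp only [Pi.mul_apply, e] at this
    exact this
  set A := ∫⁻ x, K x ^ (3 / 2 : ℝ) * F x ^ (3 / 2 : ℝ) ∂μ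
  set B := ∫⁻ x, K x ^ (3 / 2 : ℝ) ∂μ
  set C := ∫⁻ x, F x ^ (3 / 2 : ℝ) ∂μ
  calc (∫⁻ x, K x * F x ∂μ) ^ (3 : ℝ)
      ≤ ((B ^ (1 / 2 : ℝ) * C ^ (1 / 2 : ℝ)) ^ (2 / 3 : ℝ) * A ^ (1 / 3 : ℝ)) ^ (3 : ℝ) := by
        gcongr
        exact h1.trans (by gcongr)
    _ = _ := by
        rw [← ENNReal.mul_rpow_of_nonneg _ _ (by norm_num), ENNReal.mul_rpow_of_nonneg _ _ (by norm_num),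
          ← ENNReal.rpow_mul, ← ENNReal.rpow_mul, ← ENNReal.rpow_mul]
        norm_num
        rw [mul_comm]

/-- The case `L^{3/2} * L^{3/2} ⊆ L³` of Young's convolution inequality. -/
lemma lintegral_conv_rpow_three_le {F K : V → ℝ≥0∞} (hF : AEMeasurable F) (hK : Measurable K) :
    ∫⁻ v, (∫⁻ z, K (v - z) * F z) ^ (3 : ℝ) ≤
      (∫⁻ v, F v ^ (3 / 2 : ℝ)) ^ 2 * (∫⁻ u, K u ^ (3 / 2 : ℝ)) ^ 2 := by
  have hKm : ∀ v : V, Measurable fun z => K (v - z) := fun v => hK.comp (by fun_prop)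
  have hi : ∀ v : V, ∫⁻ z, K (v - z) ^ (3 / 2 : ℝ) = ∫⁻ u, K u ^ (3 / 2 : ℝ) := fun v =>
    lintegral_sub_left_eq_self (fun u => K u ^ (3 / 2 : ℝ)) v
  have hi' : ∀ z : V, ∫⁻ v, K (v - z) ^ (3 / 2 : ℝ) = ∫⁻ u, K u ^ (3 / 2 : ℝ) := fun z =>
    lintegral_sub_right_eq_self (fun u => K u ^ (3 / 2 : ℝ)) z
  set B := ∫⁻ u, K u ^ (3 / 2 : ℝ)
  set C := ∫⁻ v, F v ^ (3 / 2 : ℝ)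
  have hprod : AEMeasurable (Function.uncurry fun v z : V => K (v - z) ^ (3 / 2 : ℝ) * F z ^ (3 / 2 : ℝ))
      (volume.prod volume) := by
    refine AEMeasurable.mul ?_ ?_
    · exact ((hK.comp (measurable_fst.sub measurable_snd)).pow_const _).aemeasurable
    · exact (hF.comp_quasiMeasurePreserving Measure.quasiMeasurePreserving_snd).pow_const _
  calc ∫⁻ v, (∫⁻ z, K (v - z) * F z) ^ (3 : ℝ)
      ≤ ∫⁻ v, (∫⁻ z, K (v - z) ^ (3 / 2 : ℝ) * F z ^ (3 / 2 : ℝ)) * (B * C) := by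
        refine lintegral_mono fun v => ?_
        have := lintegral_mul_rpow_three_le hF (hKm v).aemeasurable
        rwa [hi v] at this
    _ = (∫⁻ v, ∫⁻ z, K (v - z) ^ (3 / 2 : ℝ) * F z ^ (3 / 2 : ℝ)) * (B * C) :=
        lintegral_mul_const'' _ hprod.lintegral_prod_right'
    _ = (∫⁻ z, ∫⁻ v, K (v - z) ^ (3 / 2 : ℝ) * F z ^ (3 / 2 : ℝ)) * (B * C) := by
        rw [lintegral_lintegral_swap hprod]
    _ = (B * C) * (B * C) := by
        congr 1
        have : ∀ z, ∫⁻ v, K (v - z) ^ (3 / 2 : ℝ) * F z ^ (3 / 2 : ℝ) = B * F z ^ (3 / 2 : ℝ) := by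
          intro z
          rw [lintegral_mul_const _ (show Measurable fun v => K (v - z) ^ (3 / 2 : ℝ) from
            (hK.comp (measurable_id.sub_const z)).pow_const _), hi']
        simp only [this]
        rw [lintegral_const_mul'' _ (hF.pow_const _)]
    _ = _ := by ring

/-! ### Consequences of the weighted L^{3/2} bound -/

/-- The Newtonian kernel restricted to the unit ball. -/
noncomputable def nearKer (u : V) : ℝ≥0∞ := (Metric.ball (0 : V) 1).indicator
  (fun u => ENNReal.ofReal ‖u‖⁻¹) u

lemma measurable_nearKer : Measurable nearKer :=
  Measurable.indicator (by fun_prop) Metric.isOpen_ball.measurableSet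

/-- |u|^{-3/2} is integrable at the origin of ℝ³ but not at infinity, which is why the potential is
split at distance one. -/
lemma lintegral_nearKer_lt_top : ∫⁻ u, nearKer u ^ (3 / 2 : ℝ) < ⊤ := by
  have h := integrableOn_norm_rpow_neg (p := 3 / 2) (by norm_num) one_pos
  have e : ∀ u, nearKer u ^ (3 / 2 : ℝ) = (Metric.ball (0 : V) 1).indicator
      (fun u => ENNReal.ofReal (‖u‖ ^ (-(3 / 2) : ℝ))) u := by
    intro u
    unfold nearKer
    by_cases hu : u ∈ Metric.ball (0 : V) 1
    · rw [Set.indicator_of_mem hu, Set.indicator_of_mem hu,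
        ENNReal.ofReal_rpow_of_nonneg (by positivity) (by norm_num), Real.inv_rpow (norm_nonneg _),
        Real.rpow_neg (norm_nonneg _)]
    · rw [Set.indicator_of_notMem hu, Set.indicator_of_notMem hu]
      simp
  simp only [e]
  rw [lintegral_indicator Metric.isOpen_ball.measurableSet]
  exact h.lintegral_lt_top

lemma rpow_lintegral_le_of_wNorm_le {k : ℝ} {f : V → ℝ} (h0 : ∀ v, 0 ≤ f v) {M : ℝ≥0∞}
    (hM : wNorm k f ≤ M) :
    ∫⁻ v, ENNReal.ofReal (bracket v ^ k * f v) ^ (3 / 2 : ℝ) ≤ M ^ (3 / 2 : ℝ) := by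
  rw [wNorm, eLpNorm_eq_lintegral_rpow_enorm_toReal (by norm_num)
    (ENNReal.div_ne_top (by norm_num) (by norm_num))] at hM
  have e : (3 / 2 : ℝ≥0∞).toReal = 3 / 2 := by simp
  rw [e] at hM
  have h : ∀ v, ‖bracket v ^ k * f v‖ₑ = ENNReal.ofReal (bracket v ^ k * f v) := fun v =>
    Real.enorm_of_nonneg (mul_nonneg (Real.rpow_nonneg (bracket_pos v).le _) (h0 v))
  simp only [h] at hM
  calc _ = ((∫⁻ v, ENNReal.ofReal (bracket v ^ k * f v) ^ (3 / 2 : ℝ)) ^ (1 / (3 / 2) : ℝ)) ^ (3 / 2 : ℝ) := by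
        rw [← ENNReal.rpow_mul]; norm_num
    _ ≤ _ := by gcongr

/-- The constant in the embedding of weighted `L^{3/2}` in `L¹` with one moment. -/
noncomputable def momentConst (k : ℝ) : ℝ≥0∞ :=
  (∫⁻ v : V, ENNReal.ofReal (bracket v ^ (1 - k)) ^ (3 : ℝ)) ^ (1 / 3 : ℝ)

/-- The dual weight ⟨v⟩^{1−k} lies in L³ as soon as 3(k − 1) exceeds the dimension. -/
lemma momentConst_lt_top {k : ℝ} (hk : 2 < k) : momentConst k < ⊤ := by
  refine ENNReal.rpow_lt_top_of_nonneg (by norm_num) (ne_of_lt ?_)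
  have h := integrable_rpow_neg_one_add_norm_sq (E := V) (μ := volume) (r := 3 * (k - 1))
    (by simp; linarith)
  refine lt_of_eq_of_lt ?_ h.lintegral_lt_top
  refine lintegral_congr fun v => ?_
  rw [ENNReal.ofReal_rpow_of_nonneg (Real.rpow_nonneg (bracket_pos v).le _) (by norm_num),
    ← Real.rpow_mul (bracket_pos v).le, bracket_rpow_eq]
  congr 2; ring

lemma lintegral_bracket_mul_le {k : ℝ} {f : V → ℝ} (hm : AEStronglyMeasurable f) (h0 : ∀ v, 0 ≤ f v)
    {M : ℝ≥0∞} (hM : wNorm k f ≤ M) :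
    ∫⁻ v, ENNReal.ofReal (bracket v * f v) ≤ M * momentConst k := by
  have hw : AEMeasurable fun v => ENNReal.ofReal (bracket v ^ k * f v) :=
    ((continuous_bracket_rpow k).aestronglyMeasurable.mul hm).aemeasurable.ennreal_ofReal
  have hb : AEMeasurable fun v : V => ENNReal.ofReal (bracket v ^ (1 - k)) :=
    (continuous_bracket_rpow _).measurable.ennreal_ofReal.aemeasurable
  have h := lintegral_mul_le_three_halves hw hb
  have h2 := rpow_lintegral_le_of_wNorm_le h0 hM
  calc ∫⁻ v, ENNReal.ofReal (bracket v * f v)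
      = ∫⁻ v, ENNReal.ofReal (bracket v ^ k * f v) * ENNReal.ofReal (bracket v ^ (1 - k)) := by
        refine lintegral_congr fun v => ?_
        rw [← ENNReal.ofReal_mul (mul_nonneg (Real.rpow_nonneg (bracket_pos v).le _) (h0 v))]
        congr 1
        have : bracket v ^ k * bracket v ^ (1 - k) = bracket v := by
          rw [← Real.rpow_add (bracket_pos v)]; simp
        linear_combination - f v * this
    _ ≤ _ := h
    _ ≤ (M ^ (3 / 2 : ℝ)) ^ (2 / 3 : ℝ) * momentConst k := by
        rw [momentConst]; gcongr
    _ = _ := by rw [← ENNReal.rpow_mul]; norm_num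

/-- Hölder against an indicator: mass cannot concentrate on sets of small volume. This is applied to
a thin tube in the proof of coercivity. -/
lemma setLIntegral_le {k : ℝ} (hk : 0 ≤ k) {f : V → ℝ} (hm : AEStronglyMeasurable f)
    (h0 : ∀ v, 0 ≤ f v) {M : ℝ≥0∞} (hM : wNorm k f ≤ M) (S : Set V) :
    ∫⁻ v in S, ENNReal.ofReal (f v) ≤ M * volume S ^ (1 / 3 : ℝ) := by
  have h2 := rpow_lintegral_le_of_wNorm_le h0 hM
  have hf : AEMeasurable (fun v => ENNReal.ofReal (f v)) (volume.restrict S) :=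
    hm.aemeasurable.ennreal_ofReal.restrict
  have h := lintegral_mul_le_three_halves hf (aemeasurable_const (b := (1 : ℝ≥0∞)))
  simp only [mul_one, ENNReal.one_rpow, lintegral_const, one_mul, Measure.restrict_apply_univ] at h
  refine h.trans ?_
  gcongr
  calc (∫⁻ v in S, ENNReal.ofReal (f v) ^ (3 / 2 : ℝ)) ^ (2 / 3 : ℝ)
      ≤ (M ^ (3 / 2 : ℝ)) ^ (2 / 3 : ℝ) := by
        gcongr
        refine (setLIntegral_le_lintegral _ _).trans (le_trans (lintegral_mono fun v => ?_) h2)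
        gcongr
        exact le_mul_of_one_le_left (h0 v) (Real.one_le_rpow (one_le_bracket v) hk)
    _ = M := by rw [← ENNReal.rpow_mul]; norm_num

section Near

variable {k : ℝ} (hk : 0 ≤ k) {f : V → ℝ} (hm : AEStronglyMeasurable f) (h0 : ∀ v, 0 ≤ f v)
  {M : ℝ≥0∞} (hM : wNorm k f ≤ M)
include hk hm h0 hM

omit hk in
lemma lintegral_near_rpow_three_le :
    ∫⁻ v, (∫⁻ z, nearKer (v - z) * ENNReal.ofReal (bracket z ^ k * f z)) ^ (3 : ℝ) ≤
      M ^ (3 : ℝ) * (∫⁻ u, nearKer u ^ (3 / 2 : ℝ)) ^ 2 := by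
  have hw : AEMeasurable fun v => ENNReal.ofReal (bracket v ^ k * f v) :=
    ((continuous_bracket_rpow k).aestronglyMeasurable.mul hm).aemeasurable.ennreal_ofReal
  refine (lintegral_conv_rpow_three_le hw measurable_nearKer).trans ?_
  gcongr
  calc _ ≤ (M ^ (3 / 2 : ℝ)) ^ 2 := by
        gcongr; exact rpow_lintegral_le_of_wNorm_le h0 hM
    _ = _ := by rw [← ENNReal.rpow_natCast, ← ENNReal.rpow_mul]; norm_num

/-- The total weight 3k/2 splits into k/2 on f^{1/2} and k on the squared potential. The kernel
lives at distance below one, so the latter weight moves onto the density at the cost of powers of 2.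
Hölder and the L³ bound on the convolution then close the estimate. -/
lemma lintegral_sqrt_mul_near_sq_le :
    ∫⁻ v, ENNReal.ofReal (bracket v ^ k * f v) ^ (1 / 2 : ℝ) *
        (ENNReal.ofReal (bracket v ^ (k / 2)) * ∫⁻ z, nearKer (v - z) * ENNReal.ofReal (f z)) ^ (2 : ℝ) ≤
      ENNReal.ofReal (2 ^ k) ^ (2 : ℝ) * (M ^ (5 / 2 : ℝ) *
        (∫⁻ u, nearKer u ^ (3 / 2 : ℝ)) ^ (4 / 3 : ℝ)) := by
  have hw : AEMeasurable fun v => ENNReal.ofReal (bracket v ^ k * f v) :=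
    ((continuous_bracket_rpow k).aestronglyMeasurable.mul hm).aemeasurable.ennreal_ofReal
  set H : V → ℝ≥0∞ := fun v => ∫⁻ z, nearKer (v - z) * ENNReal.ofReal (bracket z ^ k * f z) with hH
  have hHm : AEMeasurable H := by
    have hprod : AEMeasurable (Function.uncurry fun v z : V =>
        nearKer (v - z) * ENNReal.ofReal (bracket z ^ k * f z)) (volume.prod volume) := by
      refine AEMeasurable.mul ?_ ?_
      · exact (measurable_nearKer.comp (measurable_fst.sub measurable_snd)).aemeasurable
      · exact hw.comp_quasiMeasurePreserving Measure.quasiMeasurePreserving_snd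
    exact hprod.lintegral_prod_right'
  have hle : ∀ v, ENNReal.ofReal (bracket v ^ (k / 2)) * ∫⁻ z, nearKer (v - z) * ENNReal.ofReal (f z)
      ≤ ENNReal.ofReal (2 ^ k) * H v := by
    intro v
    rw [hH, ← lintegral_const_mul' _ _ ENNReal.ofReal_ne_top,
      ← lintegral_const_mul' _ _ ENNReal.ofReal_ne_top]
    refine lintegral_mono fun z => ?_
    by_cases hz : v - z ∈ Metric.ball (0 : V) 1
    · have hb : bracket v ^ (k / 2) ≤ 2 ^ k * bracket z ^ k := by
        have h1 : bracket v ^ (k / 2) ≤ bracket v ^ k :=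
          Real.rpow_le_rpow_of_exponent_le (one_le_bracket v) (by linarith)
        have h2 : bracket v ^ k ≤ (2 * bracket z) ^ k :=
          Real.rpow_le_rpow (bracket_pos v).le
            (bracket_le_two_mul (by simpa using (le_of_lt (by simpa using hz)))) hk
        rw [Real.mul_rpow (by norm_num) (bracket_pos z).le] at h2
        exact h1.trans h2
      have h3 : ENNReal.ofReal (bracket v ^ (k / 2)) * ENNReal.ofReal (f z)
          ≤ ENNReal.ofReal (2 ^ k) * ENNReal.ofReal (bracket z ^ k * f z) := by
        rw [← ENNReal.ofReal_mul (Real.rpow_nonneg (bracket_pos v).le _),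
          ← ENNReal.ofReal_mul (by positivity)]
        apply ENNReal.ofReal_le_ofReal
        rw [← mul_assoc]
        exact mul_le_mul_of_nonneg_right hb (h0 z)
      calc _ = nearKer (v - z) * (ENNReal.ofReal (bracket v ^ (k / 2)) * ENNReal.ofReal (f z)) := by ring
        _ ≤ nearKer (v - z) * (ENNReal.ofReal (2 ^ k) * ENNReal.ofReal (bracket z ^ k * f z)) := by gcongr
        _ = _ := by ring
    · have : nearKer (v - z) = 0 := Set.indicator_of_notMem hz _
      simp [this]
  calc _ ≤ ∫⁻ v, ENNReal.ofReal (bracket v ^ k * f v) ^ (1 / 2 : ℝ) *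
        (ENNReal.ofReal (2 ^ k) * H v) ^ (2 : ℝ) := by
        refine lintegral_mono fun v => ?_
        exact mul_le_mul' le_rfl (ENNReal.rpow_le_rpow (hle v) (by norm_num))
    _ = ENNReal.ofReal (2 ^ k) ^ (2 : ℝ) * ∫⁻ v, ENNReal.ofReal (bracket v ^ k * f v) ^ (1 / 2 : ℝ) *
        H v ^ (2 : ℝ) := by
        rw [← lintegral_const_mul' _ _ (ENNReal.rpow_ne_top_of_nonneg (by norm_num) ENNReal.ofReal_ne_top)]
        refine lintegral_congr fun v => ?_
        rw [ENNReal.mul_rpow_of_nonneg _ _ (by norm_num)]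
        ring
    _ ≤ _ := by
        gcongr
        refine (lintegral_sqrt_mul_sq_le hw hHm).trans ?_
        calc _ ≤ (M ^ (3 / 2 : ℝ)) ^ (1 / 3 : ℝ) *
            (M ^ (3 : ℝ) * (∫⁻ u, nearKer u ^ (3 / 2 : ℝ)) ^ 2) ^ (2 / 3 : ℝ) := by
              gcongr
              · exact rpow_lintegral_le_of_wNorm_le h0 hM
              · exact lintegral_near_rpow_three_le hm h0 hM
          _ = _ := by
              rw [ENNReal.mul_rpow_of_nonneg _ _ (by norm_num), ← ENNReal.rpow_natCast,
                ← ENNReal.rpow_mul, ← ENNReal.rpow_mul, ← ENNReal.rpow_mul, ← mul_assoc,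
                ← ENNReal.rpow_add_of_nonneg _ _ (by norm_num) (by norm_num)]
              norm_num

/-- Hölder pairs f in L^{3/2} with its near potential in L³; this gives the near half of the
interaction energy. -/
lemma lintegral_mul_near_le :
    ∫⁻ v, ENNReal.ofReal (f v) * ∫⁻ z, nearKer (v - z) * ENNReal.ofReal (f z) ≤
      M ^ (2 : ℝ) * (∫⁻ u, nearKer u ^ (3 / 2 : ℝ)) ^ (2 / 3 : ℝ) := by
  have hf : AEMeasurable fun v => ENNReal.ofReal (f v) := hm.aemeasurable.ennreal_ofReal
  have hprod : AEMeasurable (Function.uncurry fun v z : V =>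
      nearKer (v - z) * ENNReal.ofReal (f z)) (volume.prod volume) := by
    refine AEMeasurable.mul ?_ ?_
    · exact (measurable_nearKer.comp (measurable_fst.sub measurable_snd)).aemeasurable
    · exact hf.comp_quasiMeasurePreserving Measure.quasiMeasurePreserving_snd
  have hfw : ∀ v, ENNReal.ofReal (f v) ≤ ENNReal.ofReal (bracket v ^ k * f v) := fun v =>
    ENNReal.ofReal_le_ofReal (le_mul_of_one_le_left (h0 v) (Real.one_le_rpow (one_le_bracket v) hk))
  refine (lintegral_mul_le_three_halves hf hprod.lintegral_prod_right').trans ?_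
  calc _ ≤ (M ^ (3 / 2 : ℝ)) ^ (2 / 3 : ℝ) *
      (M ^ (3 : ℝ) * (∫⁻ u, nearKer u ^ (3 / 2 : ℝ)) ^ 2) ^ (1 / 3 : ℝ) := by
        gcongr
        · refine le_trans (lintegral_mono fun v => ?_) (rpow_lintegral_le_of_wNorm_le h0 hM)
          exact ENNReal.rpow_le_rpow (hfw v) (by norm_num)
        · refine le_trans (lintegral_mono fun v => ?_) (lintegral_near_rpow_three_le hm h0 hM)
          exact ENNReal.rpow_le_rpow (lintegral_mono fun z => mul_le_mul' le_rfl (hfw z)) (by norm_num)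
    _ = _ := by
        rw [ENNReal.mul_rpow_of_nonneg _ _ (by norm_num), ← ENNReal.rpow_natCast,
          ← ENNReal.rpow_mul, ← ENNReal.rpow_mul, ← ENNReal.rpow_mul, ← mul_assoc,
          ← ENNReal.rpow_add_of_nonneg _ _ (by norm_num) (by norm_num)]
        norm_num

end Near

lemma integrable_and_integral_le {α : Type*} [MeasurableSpace α] {μ : Measure α} {F : α → ℝ}
    (hF : AEStronglyMeasurable F μ) (h0 : 0 ≤ᵐ[μ] F) {B : ℝ} (hB : 0 ≤ B)
    (h : ∫⁻ x, ENNReal.ofReal (F x) ∂μ ≤ ENNReal.ofReal B) :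
    Integrable F μ ∧ ∫ x, F x ∂μ ≤ B := by
  refine ⟨⟨hF, ?_⟩, ?_⟩
  · rw [hasFiniteIntegral_iff_ofReal h0]
    exact h.trans_lt ENNReal.ofReal_lt_top
  · rw [integral_eq_lintegral_of_nonneg_ae h0 hF]
    exact ENNReal.toReal_le_of_le_ofReal hB h

/-- The potential of the mass within unit distance. -/
noncomputable def nearPot (f : V → ℝ) (v : V) : ℝ :=
  (∫⁻ z, nearKer (v - z) * ENNReal.ofReal (f z)).toReal

lemma nearPot_nonneg (f : V → ℝ) (v : V) : 0 ≤ nearPot f v := ENNReal.toReal_nonneg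

lemma nearKer_le (u : V) : nearKer u ≤ ENNReal.ofReal ‖u‖⁻¹ := by
  unfold nearKer
  exact Set.indicator_le_self' (fun _ _ => zero_le) u

/-- The constant in the trilinear estimate for `nearPot`. -/
noncomputable def nearConst (k : ℝ) : ℝ :=
  (2 ^ k) ^ 2 * (∫⁻ u, nearKer u ^ (3 / 2 : ℝ)).toReal ^ (4 / 3 : ℝ)

/-- The constant in the interaction energy estimate. -/
noncomputable def interactionConst (k : ℝ) : ℝ :=
  (∫⁻ u, nearKer u ^ (3 / 2 : ℝ)).toReal ^ (2 / 3 : ℝ) + (momentConst k).toReal ^ 2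

lemma nearConst_nonneg (k : ℝ) : 0 ≤ nearConst k := by unfold nearConst; positivity

lemma interactionConst_nonneg (k : ℝ) : 0 ≤ interactionConst k := by
  unfold interactionConst; positivity

section

variable {k : ℝ} (hk : 2 < k) {f : V → ℝ} (hc : Continuous f) (h0 : ∀ v, 0 ≤ f v)
  {M : ℝ} (hM0 : 0 ≤ M) (hM : wNorm k f ≤ ENNReal.ofReal M)
include hk hc h0 hM0 hM

lemma bracket_mul_bound : Integrable (fun v => bracket v * f v) ∧
    ∫ v, bracket v * f v ≤ M * (momentConst k).toReal := by
  refine integrable_and_integral_le (continuous_bracket.mul hc).aestronglyMeasurable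
    (Eventually.of_forall fun v => mul_nonneg (bracket_pos v).le (h0 v)) (by positivity) ?_
  rw [ENNReal.ofReal_mul hM0, ENNReal.ofReal_toReal (momentConst_lt_top hk).ne]
  exact lintegral_bracket_mul_le hc.aestronglyMeasurable h0 hM

lemma integrable_of_wNorm_le : Integrable f :=
  (bracket_mul_bound hk hc h0 hM0 hM).1.mono' hc.aestronglyMeasurable
    (Eventually.of_forall fun v => by
      rw [Real.norm_of_nonneg (h0 v)]; exact le_mul_of_one_le_left (h0 v) (one_le_bracket v))

lemma integral_le_of_wNorm_le : ∫ v, f v ≤ M * (momentConst k).toReal :=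
  (integral_mono (integrable_of_wNorm_le hk hc h0 hM0 hM) (bracket_mul_bound hk hc h0 hM0 hM).1
    fun v => le_mul_of_one_le_left (h0 v) (one_le_bracket v)).trans
    (bracket_mul_bound hk hc h0 hM0 hM).2

omit hk hc hM0 hM in
lemma weight_mul_rpow_eq (v : V) :
    (1 + ‖v‖ ^ 2) ^ (3 * k / 4) * f v ^ (3 / 2 : ℝ) = (bracket v ^ k * f v) ^ (3 / 2 : ℝ) := by
  rw [Real.mul_rpow (Real.rpow_nonneg (bracket_pos v).le _) (h0 v), ← Real.rpow_mul (bracket_pos v).le,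
    bracket_rpow_eq, show k * (3 / 2) / 2 = 3 * k / 4 by ring]

omit hk in
lemma weight_mul_rpow_bound : Integrable (fun v => (1 + ‖v‖ ^ 2) ^ (3 * k / 4) * f v ^ (3 / 2 : ℝ)) ∧
    ∫ v, (1 + ‖v‖ ^ 2) ^ (3 * k / 4) * f v ^ (3 / 2 : ℝ) ≤ M ^ (3 / 2 : ℝ) := by
  refine integrable_and_integral_le ?_ (Eventually.of_forall fun v => ?_) (by positivity) ?_
  · exact ((contDiff_one_add_normSq_rpow _ (n := 0)).continuous.mul
      (hc.rpow_const fun _ => Or.inr (by norm_num))).aestronglyMeasurable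
  · have := h0 v; simp only [Pi.zero_apply]; positivity
  · rw [← ENNReal.ofReal_rpow_of_nonneg hM0 (by norm_num)]
    refine le_trans (le_of_eq (lintegral_congr fun v => ?_)) (rpow_lintegral_le_of_wNorm_le h0 hM)
    rw [weight_mul_rpow_eq h0, ENNReal.ofReal_rpow_of_nonneg
      (mul_nonneg (Real.rpow_nonneg (bracket_pos v).le _) (h0 v)) (by norm_num)]

lemma near_lintegral_lt_top (v : V) : ∫⁻ z, nearKer (v - z) * ENNReal.ofReal (f z) < ⊤ := by
  refine lt_of_le_of_lt (lintegral_mono fun z => ?_)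
    (integrable_newton_mul hc (integrable_of_wNorm_le hk hc h0 hM0 hM) v).lintegral_lt_top
  rw [ENNReal.ofReal_mul (by positivity)]
  exact mul_le_mul' (nearKer_le _) le_rfl

lemma integral_newton_le (v : V) : ∫ z, ‖v - z‖⁻¹ * f z ≤ nearPot f v + ∫ z, f z := by
  have hf := integrable_of_wNorm_le hk hc h0 hM0 hM
  have hm : Measurable fun z => nearKer (v - z) * ENNReal.ofReal (f z) :=
    (measurable_nearKer.comp (by fun_prop)).mul hc.measurable.ennreal_ofReal
  have h1 : ∫⁻ z, ENNReal.ofReal (‖v - z‖⁻¹ * f z) ≤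
      (∫⁻ z, nearKer (v - z) * ENNReal.ofReal (f z)) + ∫⁻ z, ENNReal.ofReal (f z) := by
    rw [← lintegral_add_left hm]
    refine lintegral_mono fun z => ?_
    rw [ENNReal.ofReal_mul (by positivity)]
    by_cases hz : v - z ∈ Metric.ball (0 : V) 1
    · rw [nearKer, Set.indicator_of_mem hz]; exact le_self_add
    · have h2 : ‖v - z‖⁻¹ ≤ 1 := inv_le_one_of_one_le₀ (by simpa using hz)
      refine le_add_left ?_
      calc _ ≤ 1 * ENNReal.ofReal (f z) := mul_le_mul' (by simpa using h2) le_rfl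
        _ = _ := one_mul _
  have hfin := (near_lintegral_lt_top hk hc h0 hM0 hM v).ne
  have hfin2 : ∫⁻ z, ENNReal.ofReal (f z) ≠ ⊤ := hf.lintegral_lt_top.ne
  rw [integral_eq_lintegral_of_nonneg_ae (Eventually.of_forall fun z => mul_nonneg (by positivity) (h0 z))
    (integrable_newton_mul hc hf v).aestronglyMeasurable,
    integral_eq_lintegral_of_nonneg_ae (Eventually.of_forall h0) hc.aestronglyMeasurable, nearPot,
    ← ENNReal.toReal_add hfin hfin2]
  exact ENNReal.toReal_mono (by simp [hfin, hfin2]) h1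

lemma scalA_le (v : V) : scalA f v ≤ nearPot f v + ∫ z, f z := by
  have hf := integrable_of_wNorm_le hk hc h0 hM0 hM
  rw [scalA_eq hc hf]
  have h1 := integral_newton_le hk hc h0 hM0 hM v
  have h2 : 0 ≤ ∫ z, ‖v - z‖⁻¹ * f z := integral_nonneg fun z => mul_nonneg (by positivity) (h0 z)
  have h3 : 1 / (4 * Real.pi) ≤ 1 := by
    rw [div_le_one (by positivity)]; linarith [Real.pi_gt_three]
  exact (mul_le_of_le_one_left h2 h3).trans h1

omit hk h0 hM0 hM in
lemma measurable_nearPot : Measurable (nearPot f) := by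
  have : Measurable (Function.uncurry fun v z : V => nearKer (v - z) * ENNReal.ofReal (f z)) :=
    (measurable_nearKer.comp (measurable_fst.sub measurable_snd)).mul
      (hc.measurable.comp measurable_snd).ennreal_ofReal
  exact this.lintegral_prod_right'.ennreal_toReal

lemma sqrt_mul_nearPot_sq_bound :
    Integrable (fun v => (1 + ‖v‖ ^ 2) ^ (3 * k / 4) * f v ^ (1 / 2 : ℝ) * nearPot f v ^ 2) ∧
    ∫ v, (1 + ‖v‖ ^ 2) ^ (3 * k / 4) * f v ^ (1 / 2 : ℝ) * nearPot f v ^ 2 ≤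
      nearConst k * M ^ (5 / 2 : ℝ) := by
  refine integrable_and_integral_le ?_ (Eventually.of_forall fun v => ?_)
    (mul_nonneg (nearConst_nonneg k) (by positivity)) ?_
  · exact ((contDiff_one_add_normSq_rpow _ (n := 0)).continuous.mul
      (hc.rpow_const fun _ => Or.inr (by norm_num))).aestronglyMeasurable.mul
      ((measurable_nearPot hc).pow_const 2).aestronglyMeasurable
  · have := h0 v; simp only [Pi.zero_apply]; positivity
  · have h := lintegral_sqrt_mul_near_sq_le (by linarith) hc.aestronglyMeasurable h0 hM
    refine le_trans (le_of_eq (lintegral_congr fun v => ?_)) (h.trans (le_of_eq ?_))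
    · have hb := Real.rpow_nonneg (bracket_pos v).le k
      have hb2 := Real.rpow_nonneg (bracket_pos v).le (k / 2)
      have e : ∫⁻ z, nearKer (v - z) * ENNReal.ofReal (f z) = ENNReal.ofReal (nearPot f v) :=
        (ENNReal.ofReal_toReal (near_lintegral_lt_top hk hc h0 hM0 hM v).ne).symm
      rw [e, ENNReal.ofReal_rpow_of_nonneg (mul_nonneg hb (h0 v)) (by norm_num),
        ← ENNReal.ofReal_mul hb2, ENNReal.ofReal_rpow_of_nonneg
          (mul_nonneg hb2 (nearPot_nonneg f v)) (by norm_num), ← ENNReal.ofReal_mul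
          (Real.rpow_nonneg (mul_nonneg hb (h0 v)) _)]
      congr 1
      rw [Real.mul_rpow hb (h0 v), Real.mul_rpow hb2 (nearPot_nonneg f v),
        ← Real.rpow_mul (bracket_pos v).le, ← Real.rpow_mul (bracket_pos v).le, Real.rpow_two]
      have e2 : (1 + ‖v‖ ^ 2) ^ (3 * k / 4) = bracket v ^ (k * (1 / 2)) * bracket v ^ (k / 2 * 2) := by
        rw [← Real.rpow_add (bracket_pos v), bracket_rpow_eq]; congr 1; ring
      rw [e2]; ring
    · have hK := lintegral_nearKer_lt_top.ne
      rw [nearConst, ENNReal.ofReal_mul (by positivity), ENNReal.ofReal_mul (by positivity),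
        ← ENNReal.ofReal_rpow_of_nonneg hM0 (by norm_num),
        ← ENNReal.ofReal_rpow_of_nonneg ENNReal.toReal_nonneg (by norm_num), ENNReal.ofReal_toReal hK,
        ENNReal.ofReal_pow (by positivity), ENNReal.rpow_two]
      ring

/-- The part at distance below one is controlled by the convolution inequality, the rest by the
square of the mass. Finiteness of this energy is what drives mass conservation. -/
lemma interaction_bound :
    Integrable (fun p : V × V => ‖p.1 - p.2‖⁻¹ * f p.2 * f p.1) (volume.prod volume) ∧
    ∫ p : V × V, ‖p.1 - p.2‖⁻¹ * f p.2 * f p.1 ∂(volume.prod volume) ≤ interactionConst k * M ^ 2 := by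
  have hf := integrable_of_wNorm_le hk hc h0 hM0 hM
  have hme : Measurable fun p : V × V => ‖p.1 - p.2‖⁻¹ * f p.2 * f p.1 := by
    have := hc.measurable; fun_prop
  refine integrable_and_integral_le hme.aestronglyMeasurable (Eventually.of_forall fun p => ?_)
    (mul_nonneg (interactionConst_nonneg k) (by positivity)) ?_
  · have := h0 p.1; have := h0 p.2; simp only [Pi.zero_apply]; positivity
  · rw [lintegral_prod _ hme.ennreal_ofReal.aemeasurable]
    have hm := integral_le_of_wNorm_le hk hc h0 hM0 hM
    have hle : ∀ v, ∫⁻ z, ENNReal.ofReal (‖v - z‖⁻¹ * f z * f v) ≤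
        ENNReal.ofReal (f v) * (∫⁻ z, nearKer (v - z) * ENNReal.ofReal (f z)) +
          ENNReal.ofReal (f v) * ENNReal.ofReal (M * (momentConst k).toReal) := by
      intro v
      rw [← mul_add]
      calc _ = ENNReal.ofReal (∫ z, ‖v - z‖⁻¹ * f z * f v) :=
            (ofReal_integral_eq_lintegral_ofReal ((integrable_newton_mul hc hf v).mul_const _)
              (Eventually.of_forall fun z => mul_nonneg (mul_nonneg (by positivity) (h0 z)) (h0 v))).symm
        _ = ENNReal.ofReal (f v) * ENNReal.ofReal (∫ z, ‖v - z‖⁻¹ * f z) := by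
            rw [integral_mul_const, mul_comm, ENNReal.ofReal_mul (h0 v)]
        _ ≤ _ := by
            refine mul_le_mul' le_rfl ?_
            rw [← ENNReal.ofReal_toReal (near_lintegral_lt_top hk hc h0 hM0 hM v).ne,
              ← ENNReal.ofReal_add ENNReal.toReal_nonneg (by positivity)]
            refine ENNReal.ofReal_le_ofReal ((integral_newton_le hk hc h0 hM0 hM v).trans ?_)
            exact add_le_add le_rfl hm
    refine (lintegral_mono hle).trans ?_
    rw [lintegral_add_right _ (by have := hc.measurable; fun_prop), lintegral_mul_const _ hc.measurable.ennreal_ofReal,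
      interactionConst, add_mul, ENNReal.ofReal_add (by positivity) (by positivity)]
    refine add_le_add ((lintegral_mul_near_le (by linarith) hc.aestronglyMeasurable h0 hM).trans
      (le_of_eq ?_)) ?_
    · have hK := lintegral_nearKer_lt_top.ne
      rw [ENNReal.ofReal_mul (by positivity),
        ← ENNReal.ofReal_rpow_of_nonneg ENNReal.toReal_nonneg (by norm_num), ENNReal.ofReal_toReal hK,
        ENNReal.ofReal_pow hM0, ENNReal.rpow_two]
      ring
    · rw [← ofReal_integral_eq_lintegral_ofReal hf (Eventually.of_forall h0),
        ← ENNReal.ofReal_mul (integral_nonneg h0)]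
      refine ENNReal.ofReal_le_ofReal ?_
      calc _ ≤ (M * (momentConst k).toReal) * (M * (momentConst k).toReal) := by gcongr
        _ = _ := by ring

end

/-! ### Coercivity of the diffusion matrix -/

lemma volume_tube_le {e : V} (he : ‖e‖ = 1) (v : V) {R ρ : ℝ} (hR : 0 ≤ R) (hρ : 0 ≤ ρ) :
    volume {z : V | ‖z‖ ≤ R ∧ ‖v - z‖ ^ 2 - inner ℝ e (v - z) ^ 2 ≤ ρ ^ 2} ≤
      ENNReal.ofReal (8 * R * ρ ^ 2) := by
  have horth : Orthonormal ℝ (({0} : Set (Fin 3)).domRestrict fun _ => e) := by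
    refine ⟨fun i => he, fun i j hij => absurd (Subsingleton.elim i j) hij⟩
  obtain ⟨b, hb⟩ := Orthonormal.exists_orthonormalBasis_extension_of_card_eq (𝕜 := ℝ) (E := V)
    (by simp) horth
  have hb0 : b 0 = e := hb 0 rfl
  -- In an orthonormal basis starting with e, the tube inside the ball lies in a box with sides 2R,
  -- 2ρ, 2ρ.
  set c : Fin 3 → ℝ := fun i => if i = 0 then -R else b.repr v i - ρ
  set d : Fin 3 → ℝ := fun i => if i = 0 then R else b.repr v i + ρ
  have hsub : {z : V | ‖z‖ ≤ R ∧ ‖v - z‖ ^ 2 - inner ℝ e (v - z) ^ 2 ≤ ρ ^ 2} ⊆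
      b.repr ⁻¹' ((@WithLp.ofLp 2 (Fin 3 → ℝ)) ⁻¹' Set.Icc c d) := by
    rintro z ⟨hz, hp⟩
    have hcoord : ∀ (u : V) i, |b.repr u i| ≤ ‖u‖ := fun u i => by
      rw [← b.repr.norm_map u]; exact abs_coord_le _ _
    have hn : ‖v - z‖ ^ 2 = b.repr (v - z) 0 ^ 2 + b.repr (v - z) 1 ^ 2 + b.repr (v - z) 2 ^ 2 := by
      rw [← b.repr.norm_map, norm_sq_eq_sum, Fin.sum_univ_three]
    have h0 : inner ℝ e (v - z) = b.repr (v - z) 0 := by rw [b.repr_apply_apply, hb0]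
    rw [h0, hn] at hp
    have h1 : |b.repr (v - z) 1| ≤ ρ := abs_le_of_sq_le_sq (by nlinarith [sq_nonneg (b.repr (v - z) 2)]) hρ
    have h2 : |b.repr (v - z) 2| ≤ ρ := abs_le_of_sq_le_sq (by nlinarith [sq_nonneg (b.repr (v - z) 1)]) hρ
    have h3 := (hcoord z 0).trans hz
    rw [map_sub] at h1 h2
    simp only [PiLp.sub_apply] at h1 h2
    rw [abs_le] at h1 h2 h3
    simp only [Set.mem_preimage, Set.mem_Icc, Pi.le_def, Fin.forall_fin_succ, c, d]
    simp
    refine ⟨⟨h3.1, ?_, ?_⟩, h3.2, ?_, ?_⟩ <;> linarith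
  refine (measure_mono hsub).trans ?_
  rw [b.measurePreserving_repr.measure_preimage
      ((PiLp.volume_preserving_ofLp (Fin 3)).measurable measurableSet_Icc).nullMeasurableSet,
    (PiLp.volume_preserving_ofLp (Fin 3)).measure_preimage measurableSet_Icc.nullMeasurableSet,
    Real.volume_Icc_pi, Fin.prod_univ_three, ← ENNReal.ofReal_mul (by simp [c, d]; linarith),
    ← ENNReal.ofReal_mul (mul_nonneg (by simp [c, d]; linarith) (by simp [c, d]; linarith))]
  refine ENNReal.ofReal_le_ofReal (le_of_eq ?_)
  simp [c, d]; ring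

/-- The constant in the lower bound of the diffusion matrix. -/
noncomputable def coerConst (k : ℝ) : ℝ :=
  1 / (65536 * Real.pi * (4 * ((momentConst k).toReal + 1)) ^ 4)

lemma coerConst_pos (k : ℝ) : 0 < coerConst k := by
  unfold coerConst
  have : 0 ≤ (momentConst k).toReal := ENNReal.toReal_nonneg
  positivity

section

variable {k : ℝ} (hk : 2 < k) {f : V → ℝ} (hc : Continuous f) (h0 : ∀ v, 0 ≤ f v)
  {M : ℝ} (hM0 : 0 ≤ M) (hM : wNorm k f ≤ ENNReal.ofReal M)
  {X : ℝ} (hX : 0 < X) (hX2 : M ≤ X * ∫ v, f v)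
include hk hc h0 hM0 hM hX hX2

/-- At most a quarter of the mass lies outside the ball of radius R, by Chebyshev with the first
moment. At most a quarter lies in the tube about the line v + ℝe, by non-concentration. The
hypothesis M ≤ X m turns both bounds into fractions of the mass. -/
lemma half_mass_le_setIntegral {e : V} (he : ‖e‖ = 1) (v : V) :
    (∫ z, f z) / 2 ≤ ∫ z in {z : V | ‖z‖ ≤ 4 * ((momentConst k).toReal + 1) * X ∧
      1 / (512 * (4 * ((momentConst k).toReal + 1) * X) * X ^ 3) <
        ‖v - z‖ ^ 2 - inner ℝ e (v - z) ^ 2}, f z := by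
  set c := (momentConst k).toReal
  have hc0 : 0 ≤ c := ENNReal.toReal_nonneg
  set R := 4 * (c + 1) * X with hR
  have hR0 : 0 < R := by positivity
  have hf := integrable_of_wNorm_le hk hc h0 hM0 hM
  set m := ∫ z, f z with hm
  set ρ := Real.sqrt (1 / (512 * R * X ^ 3)) with hρ
  have hρ2 : ρ ^ 2 = 1 / (512 * R * X ^ 3) := Real.sq_sqrt (by positivity)
  rw [← hρ2]
  set G := {z : V | ‖z‖ ≤ R ∧ ρ ^ 2 < ‖v - z‖ ^ 2 - inner ℝ e (v - z) ^ 2}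
  set S := {z : V | ‖z‖ ≤ R ∧ ‖v - z‖ ^ 2 - inner ℝ e (v - z) ^ 2 ≤ ρ ^ 2}
  set F := {z : V | R < ‖z‖}
  have mF : MeasurableSet F := measurableSet_lt measurable_const measurable_norm
  have mq : Measurable fun z : V => ‖v - z‖ ^ 2 - inner ℝ e (v - z) ^ 2 :=
    Continuous.measurable (by fun_prop)
  have mG : MeasurableSet G := (measurableSet_le measurable_norm measurable_const).inter
    (measurableSet_lt measurable_const mq)
  have mS : MeasurableSet S := (measurableSet_le measurable_norm measurable_const).inter
    (measurableSet_le mq measurable_const)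
  have hF : ∫ z in F, f z ≤ m / 4 := by
    have h1 : R * ∫ z in F, f z ≤ ∫ z, bracket z * f z := by
      rw [← integral_const_mul]
      refine le_trans (setIntegral_mono_on (hf.const_mul R).integrableOn
        (bracket_mul_bound hk hc h0 hM0 hM).1.integrableOn mF fun z hz => ?_)
        (setIntegral_le_integral (bracket_mul_bound hk hc h0 hM0 hM).1
          (Eventually.of_forall fun z => mul_nonneg (bracket_pos z).le (h0 z)))
      exact mul_le_mul_of_nonneg_right ((le_of_lt hz).trans (norm_le_bracket z)) (h0 z)
    have h2 := (bracket_mul_bound hk hc h0 hM0 hM).2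
    have h3 : M * c ≤ R * (m / 4) := by
      have h4 : M * c ≤ X * m * c := mul_le_mul_of_nonneg_right hX2 hc0
      have h5 : 0 ≤ m := integral_nonneg h0
      have h6 : 0 ≤ X * m := by positivity
      rw [hR]; nlinarith
    exact le_of_mul_le_mul_left (h1.trans (h2.trans h3)) hR0
  have hS : ∫ z in S, f z ≤ m / 4 := by
    have hm0 : 0 ≤ m := integral_nonneg h0
    rw [integral_eq_lintegral_of_nonneg_ae (Eventually.of_forall h0) hc.aestronglyMeasurable]
    refine ENNReal.toReal_le_of_le_ofReal (by positivity) ?_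
    refine (setLIntegral_le (by linarith) hc.aestronglyMeasurable h0 hM S).trans ?_
    have hv := volume_tube_le he v hR0.le (Real.sqrt_nonneg (1 / (512 * R * X ^ 3)))
    -- The 512 = 8 · 4³ in ρ is chosen so that the cube root of the tube volume is at most 1/(4X),
    -- and M/(4X) ≤ m/4.
    have h8 : 8 * R * ρ ^ 2 = (1 / (4 * X)) ^ 3 := by
      rw [hρ2]; field_simp; norm_num
    calc _ ≤ ENNReal.ofReal M * (ENNReal.ofReal (8 * R * ρ ^ 2)) ^ (1 / 3 : ℝ) :=
          mul_le_mul' le_rfl (ENNReal.rpow_le_rpow hv (by norm_num))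
      _ = ENNReal.ofReal (M * (1 / (4 * X))) := by
          rw [h8, ENNReal.ofReal_rpow_of_nonneg (by positivity) (by norm_num),
            ← ENNReal.ofReal_mul hM0, ← Real.rpow_natCast, ← Real.rpow_mul (by positivity)]
          norm_num
      _ ≤ _ := by
          refine ENNReal.ofReal_le_ofReal ?_
          rw [mul_one_div, div_le_iff₀ (by positivity)]
          linarith
  have hGS : Disjoint G S := Set.disjoint_left.2 fun z hz hz' => absurd hz.2 (not_lt.2 hz'.2)
  have hFc : Fᶜ = G ∪ S := by
    ext z
    simp only [F, G, S, Set.mem_compl_iff, Set.mem_ofPred_eq, Set.mem_union, not_lt]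
    constructor
    · intro h; rcases lt_or_ge (ρ ^ 2) (‖v - z‖ ^ 2 - inner ℝ e (v - z) ^ 2) with h' | h'
      · exact Or.inl ⟨h, h'⟩
      · exact Or.inr ⟨h, h'⟩
    · rintro (h | h) <;> exact h.1
  have htot := integral_add_compl mF hf
  rw [hFc, setIntegral_union hGS mS hf.integrableOn hf.integrableOn] at htot
  linarith

/-- On the good half of the mass the squared distance of v − z from the direction of x exceeds ρ²,
of order X⁻⁴, and |v − z| ≤ 2R⟨v⟩ with R of order X. The kernel form is then at least of order X⁻⁷
⟨v⟩⁻³, and the mass is at least 1/X. -/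
lemma coercive (hX1 : 1 ≤ X) (hX3 : 1 ≤ X * ∫ v, f v) (v : V) (x : Fin 3 → ℝ) :
    coerConst k / X ^ 8 / bracket v ^ 3 * ∑ i, x i ^ 2 ≤ bil (matA f v) x x := by
  have hf := integrable_of_wNorm_le hk hc h0 hM0 hM
  set y : V := WithLp.toLp 2 x with hy
  have hyn : ‖y‖ ^ 2 = ∑ i, x i ^ 2 := by rw [norm_sq_eq_sum]
  rw [← hyn]
  by_cases hy0 : ‖y‖ = 0
  · rw [hy0]; simpa using bil_matA_nonneg hc hf h0 v x
  set e : V := ‖y‖⁻¹ • y with hedef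
  have he : ‖e‖ = 1 := by rw [hedef, norm_smul, norm_inv, norm_norm]; exact inv_mul_cancel₀ hy0
  have hhalf := half_mass_le_setIntegral hk hc h0 hM0 hM hX hX2 he v
  set c := (momentConst k).toReal with hcdef
  have hc0 : 0 ≤ c := ENNReal.toReal_nonneg
  set R := 4 * (c + 1) * X with hR
  have hR0 : 0 < R := by positivity
  set ρ2 := 1 / (512 * R * X ^ 3) with hρ2
  have hρ0 : 0 < ρ2 := by positivity
  set m := ∫ z, f z with hm
  set G := {z : V | ‖z‖ ≤ R ∧ ρ2 < ‖v - z‖ ^ 2 - inner ℝ e (v - z) ^ 2}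
  have mG : MeasurableSet G := (measurableSet_le measurable_norm measurable_const).inter
    (measurableSet_lt measurable_const
      (show Continuous fun z : V => ‖v - z‖ ^ 2 - inner ℝ e (v - z) ^ 2 by fun_prop).measurable)
  have hb := one_le_bracket v
  have hR1 : 1 ≤ R := by rw [hR]; nlinarith
  have hker : ∀ z ∈ G, ‖y‖ ^ 2 * (ρ2 / (2 * R * bracket v) ^ 3) * f z ≤
      bil (Matrix.of fun i j => ker i j (v - z)) x x * f z := by
    intro z hz
    refine mul_le_mul_of_nonneg_right ?_ (h0 z)
    have hu2 : ‖v - z‖ ≤ 2 * R * bracket v := by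
      have h1 := norm_sub_le v z
      have h2 := norm_le_bracket v
      have h3 := hz.1
      nlinarith
    have hun : 0 < ‖v - z‖ := by
      refine norm_pos_iff.2 fun h => ?_
      have h4 := hz.2
      rw [h] at h4
      simp at h4
      linarith
    rw [norm_mul_bil_ker _ _ (norm_pos_iff.1 hun), ← hyn]
    have hin : ∑ i, (v - z) i * x i = ‖y‖ * inner ℝ e (v - z) := by
      rw [hedef, real_inner_smul_left, ← mul_assoc, mul_inv_cancel₀ hy0, one_mul]
      simp [PiLp.inner_apply, hy]
    rw [hin]
    have h5 : ‖v - z‖ ^ 2 * ‖y‖ ^ 2 - (‖y‖ * inner ℝ e (v - z)) ^ 2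
        = ‖y‖ ^ 2 * (‖v - z‖ ^ 2 - inner ℝ e (v - z) ^ 2) := by ring
    rw [h5, div_eq_mul_inv, ← inv_pow]
    have h6 : (2 * R * bracket v)⁻¹ ^ 3 ≤ ‖v - z‖⁻¹ ^ 3 := by gcongr
    calc ‖y‖ ^ 2 * (ρ2 * (2 * R * bracket v)⁻¹ ^ 3)
        ≤ ‖y‖ ^ 2 * ((‖v - z‖ ^ 2 - inner ℝ e (v - z) ^ 2) * ‖v - z‖⁻¹ ^ 3) := by
          refine mul_le_mul_of_nonneg_left ?_ (by positivity)
          exact mul_le_mul hz.2.le h6 (by positivity) (hρ0.le.trans hz.2.le)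
      _ = _ := by ring
  have hint : ‖y‖ ^ 2 * (ρ2 / (2 * R * bracket v) ^ 3) * (m / 2) ≤
      ∫ z, bil (Matrix.of fun i j => ker i j (v - z)) x x * f z := by
    have hi := integrable_bil_ker hc hf v x x
    calc _ ≤ ‖y‖ ^ 2 * (ρ2 / (2 * R * bracket v) ^ 3) * ∫ z in G, f z :=
          mul_le_mul_of_nonneg_left hhalf (by positivity)
      _ = ∫ z in G, ‖y‖ ^ 2 * (ρ2 / (2 * R * bracket v) ^ 3) * f z := (integral_const_mul _ _).symm
      _ ≤ ∫ z in G, bil (Matrix.of fun i j => ker i j (v - z)) x x * f z :=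
          setIntegral_mono_on (hf.const_mul _).integrableOn hi.integrableOn mG hker
      _ ≤ _ := setIntegral_le_integral hi
          (Eventually.of_forall fun z => mul_nonneg (bil_ker_nonneg _ _) (h0 z))
  rw [bil_matA_eq hc hf]
  refine le_trans ?_ (mul_le_mul_of_nonneg_left hint (by positivity))
  -- 65536 = 8 · 512 · 2³ · 2: the prefactor 1/(8π), the tube, the cube of 2R⟨v⟩ and the half mass.
  have hconst : coerConst k / X ^ 8 / bracket v ^ 3 * ‖y‖ ^ 2 = (1 / X) * (1 / (8 * Real.pi) *
      (‖y‖ ^ 2 * (ρ2 / (2 * R * bracket v) ^ 3) * (1 / 2))) := by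
    rw [coerConst, hρ2, hR, ← hcdef]
    have := bracket_pos v
    field_simp
    norm_num
  rw [hconst]
  have h7 : 1 / X ≤ m := by rw [div_le_iff₀ hX]; linarith
  calc _ ≤ m * (1 / (8 * Real.pi) * (‖y‖ ^ 2 * (ρ2 / (2 * R * bracket v) ^ 3) * (1 / 2))) :=
        mul_le_mul_of_nonneg_right h7 (by have := bracket_pos v; positivity)
    _ = _ := by ring

end

/-! ### Sobolev inequality with the weight φ/⟨v⟩³ -/

/-- The Sobolev constant for `‖u‖_{L⁶} ≤ C ‖∇u‖_{L²}` in dimension three. -/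
noncomputable def sobolevConst : ℝ := eLpNormLESNormFDerivOfEqInnerConst (volume : Measure V) 2

lemma sobolevConst_nonneg : 0 ≤ sobolevConst := NNReal.coe_nonneg _

/-- The squared L⁶ norm is written as the L³ norm of u², the form in which Hölder pairs it with an
L^{3/2} factor. -/
lemma lintegral_rpow_six_le {u : V → ℝ} (hu : ContDiff ℝ 1 u) (hc : HasCompactSupport u) :
    (∫⁻ v, ENNReal.ofReal (u v ^ 2) ^ (3 : ℝ)) ^ (1 / 3 : ℝ) ≤
      ENNReal.ofReal (sobolevConst ^ 2 * ∫ v, ‖fderiv ℝ u v‖ ^ 2) := by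
  have h := eLpNorm_le_eLpNorm_fderiv_of_eq_inner (μ := (volume : Measure V)) hu hc (p := 2) (p' := 6)
    (by norm_num) (by simp) (by simp; norm_num)
  have e6 : eLpNorm u (6 : NNReal) volume = (∫⁻ v, ENNReal.ofReal (u v ^ 2) ^ (3 : ℝ)) ^ (1 / 6 : ℝ) := by
    rw [eLpNorm_eq_lintegral_rpow_enorm_toReal (by norm_num) (by norm_num)]
    have e : ((6 : NNReal) : ℝ≥0∞).toReal = 6 := by simp
    rw [e]
    congr 1
    refine lintegral_congr fun v => ?_
    rw [← sq_abs, ENNReal.ofReal_pow (abs_nonneg _), ← Real.enorm_eq_ofReal_abs, ← ENNReal.rpow_natCast,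
      ← ENNReal.rpow_mul]
    norm_num
  have hcont : Continuous (fderiv ℝ u) := hu.continuous_fderiv (by simp)
  have hi : Integrable fun v => ‖fderiv ℝ u v‖ ^ 2 := by
    refine Continuous.integrable_of_hasCompactSupport (by fun_prop) ?_
    exact (hc.fderiv (𝕜 := ℝ)).comp_left (g := fun x => ‖x‖ ^ 2) (by simp)
  have e2 : eLpNorm (fderiv ℝ u) (2 : NNReal) volume =
      (ENNReal.ofReal (∫ v, ‖fderiv ℝ u v‖ ^ 2)) ^ (1 / 2 : ℝ) := by
    rw [eLpNorm_eq_lintegral_rpow_enorm_toReal (by norm_num) (by norm_num)]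
    have e : ((2 : NNReal) : ℝ≥0∞).toReal = 2 := by simp
    rw [e, ofReal_integral_eq_lintegral_ofReal hi (Eventually.of_forall fun v => by positivity)]
    congr 1
    refine lintegral_congr fun v => ?_
    rw [ENNReal.ofReal_pow (norm_nonneg _), ofReal_norm, ENNReal.rpow_two]
  rw [e6, e2] at h
  have h2 := ENNReal.rpow_le_rpow h (show (0 : ℝ) ≤ 2 by norm_num)
  rw [← ENNReal.rpow_mul, ENNReal.mul_rpow_of_nonneg _ _ (by norm_num), ← ENNReal.rpow_mul,
    show (1 / 6 : ℝ) * 2 = 1 / 3 by norm_num, show (1 / 2 : ℝ) * 2 = 1 by norm_num, ENNReal.rpow_one,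
    ENNReal.rpow_two] at h2
  rw [ENNReal.ofReal_mul (by positivity), ENNReal.ofReal_pow sobolevConst_nonneg]
  convert h2 using 3
  simp [sobolevConst]

/-- The square root of `cutoff p R / ⟨v⟩³`. -/
noncomputable def rootCutoff (p R : ℝ) (v : V) : ℝ := (1 + ‖v‖ ^ 2) ^ (p / 2 - 3 / 4) * trunc R v ^ 2

section

variable {p R : ℝ}

lemma contDiff_rootCutoff : ContDiff ℝ 1 (rootCutoff p R) :=
  (contDiff_one_add_normSq_rpow _).mul (contDiff_trunc_pow R 1)

lemma rootCutoff_sq (v : V) : rootCutoff p R v ^ 2 = cutoff p R v / bracket v ^ 3 := by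
  have hS : 0 < 1 + ‖v‖ ^ 2 := by positivity
  have e : bracket v ^ 3 = (1 + ‖v‖ ^ 2) ^ (3 / 2 : ℝ) := by
    rw [← Real.rpow_natCast, bracket_rpow_eq]; norm_num
  have e2 : (1 + ‖v‖ ^ 2) ^ p = ((1 + ‖v‖ ^ 2) ^ (p / 2 - 3 / 4)) ^ 2 * (1 + ‖v‖ ^ 2) ^ (3 / 2 : ℝ) := by
    generalize 1 + ‖v‖ ^ 2 = S at hS
    rw [← Real.rpow_natCast, ← Real.rpow_mul hS.le, ← Real.rpow_add hS]; congr 1; push_cast; ring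
  rw [e, rootCutoff, cutoff, e2]
  field_simp

lemma hasCompactSupport_rootCutoff (hR : 0 < R) : HasCompactSupport (rootCutoff p R) := by
  refine HasCompactSupport.intro (isCompact_closedBall (0 : V) R) fun v hv => ?_
  simp at hv; rw [rootCutoff, trunc_eq_zero hR hv.le]; simp

/-- A crude bound by the full weight is enough, since this quantity multiplies f^{3/2} and ∫
⟨v⟩^{2p} f^{3/2} is bounded for p = 3k/4. The condition 3/2 ≤ p makes the exponent in `rootCutoff`
nonnegative. -/
lemma sum_pd_rootCutoff_sq_le (hp : 3 / 2 ≤ p) (hR : 1 ≤ R) (v : V) :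
    ∑ i, pd i (rootCutoff p R) v ^ 2 ≤ 4 * (p + 8) ^ 2 * (1 + ‖v‖ ^ 2) ^ p := by
  have hS : 1 ≤ 1 + ‖v‖ ^ 2 := by linarith [sq_nonneg ‖v‖]
  have hS0 : 0 < 1 + ‖v‖ ^ 2 := by linarith
  set q := p / 2 - 3 / 4 with hq
  have hq0 : 0 ≤ q := by linarith
  set χ := trunc R v with hχ
  have hχ0 : 0 ≤ χ := trunc_nonneg R v
  have hχ1 : χ ≤ 1 := trunc_le_one R v
  have ht := one_add_normSq_mul_trunc_le hR v
  rw [← hχ] at ht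
  have hSq : (1 + ‖v‖ ^ 2) ^ q = (1 + ‖v‖ ^ 2) ^ (q - 1) * (1 + ‖v‖ ^ 2) := by
    rw [← Real.rpow_add_one hS0.ne']; ring_nf
  set Z := (1 + ‖v‖ ^ 2) ^ (q - 1) with hZ
  have hZ0 : 0 < Z := by positivity
  have e : ∀ i, pd i (rootCutoff p R) v = 2 * v i * (Z * (q * χ ^ 2 - 2 * ((1 + ‖v‖ ^ 2) / R ^ 2 * χ))) := by
    intro i
    unfold rootCutoff
    rw [pd_mul (differentiable_one_add_normSq_rpow _ v) (differentiable_trunc_pow R 0 v),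
      pd_one_add_normSq_rpow, pd_trunc_pow, ← hq, hSq]
    push_cast
    rw [← hχ, ← hZ]
    ring
  have hb : |q * χ ^ 2 - 2 * ((1 + ‖v‖ ^ 2) / R ^ 2 * χ)| ≤ p + 8 := by
    have h1 : 0 ≤ (1 + ‖v‖ ^ 2) / R ^ 2 * χ := by positivity
    have h2 : 0 ≤ q * χ ^ 2 := by positivity
    have h3 : q * χ ^ 2 ≤ q := mul_le_of_le_one_right hq0 (pow_le_one₀ hχ0 hχ1)
    rw [abs_le]; constructor <;> linarith
  set Y := q * χ ^ 2 - 2 * ((1 + ‖v‖ ^ 2) / R ^ 2 * χ)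
  have hY : Y ^ 2 ≤ (p + 8) ^ 2 := by rw [← sq_abs]; gcongr
  have hsum : ∑ i, pd i (rootCutoff p R) v ^ 2 = 4 * ‖v‖ ^ 2 * (Z * Y) ^ 2 := by
    simp only [e, norm_sq_eq_sum v, Fin.sum_univ_three]; ring
  have hZp : (1 + ‖v‖ ^ 2) * Z ^ 2 ≤ (1 + ‖v‖ ^ 2) ^ p := by
    rw [hZ]
    generalize 1 + ‖v‖ ^ 2 = S at hS hS0
    rw [← Real.rpow_natCast, ← Real.rpow_mul hS0.le, mul_comm, ← Real.rpow_add_one hS0.ne']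
    exact Real.rpow_le_rpow_of_exponent_le hS (by push_cast; linarith)
  rw [hsum]
  calc 4 * ‖v‖ ^ 2 * (Z * Y) ^ 2 = 4 * (‖v‖ ^ 2 * Z ^ 2) * Y ^ 2 := by ring
    _ ≤ 4 * ((1 + ‖v‖ ^ 2) * Z ^ 2) * (p + 8) ^ 2 := by gcongr; linarith
    _ ≤ 4 * (1 + ‖v‖ ^ 2) ^ p * (p + 8) ^ 2 := by gcongr
    _ = _ := by ring

end

section

variable {p R : ℝ} (hp : 3 / 2 ≤ p) (hR : 1 ≤ R) {f : V → ℝ} (hf2 : ContDiff ℝ 2 f) (h0 : ∀ v, 0 ≤ f v)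
  (hi : Integrable fun v => (1 + ‖v‖ ^ 2) ^ p * f v ^ (3 / 2 : ℝ))
include hp hR hf2 h0 hi

lemma integral_fderiv_rootCutoff_mul_le :
    ∫ v, ‖fderiv ℝ (fun w => rootCutoff p R w * f w ^ (3 / 4 : ℝ)) v‖ ^ 2 ≤
      2 * (∫ v, cutoff p R v / bracket v ^ 3 * ∑ i, pd i (fun w => f w ^ (3 / 4 : ℝ)) v ^ 2)
        + 8 * (p + 8) ^ 2 * (∫ v, (1 + ‖v‖ ^ 2) ^ p * f v ^ (3 / 2 : ℝ)) := by
  have hR0 : 0 < R := by linarith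
  have hg : ContDiff ℝ 1 fun w => f w ^ (3 / 4 : ℝ) := contDiff_rpow_three_quarters hf2 h0
  have hr : ContDiff ℝ 1 (rootCutoff p R) := contDiff_rootCutoff
  have hgd := hg.differentiable (by simp)
  have hrd := hr.differentiable (by simp)
  have hi1 : Integrable fun v => cutoff p R v / bracket v ^ 3 *
      ∑ i, pd i (fun w => f w ^ (3 / 4 : ℝ)) v ^ 2 := by
    refine Continuous.integrable_of_hasCompactSupport ?_ ?_
    · have h1 := (contDiff_cutoff p R).continuous
      have h2 := continuous_bracket
      have h3 : ∀ i, Continuous (pd i fun w => f w ^ (3 / 4 : ℝ)) := fun i => continuous_pd hg i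
      refine (h1.div (h2.pow 3) fun v => (pow_pos (bracket_pos v) 3).ne').mul ?_
      fun_prop
    · refine HasCompactSupport.mul_right ?_
      simp only [div_eq_mul_inv]
      exact (hasCompactSupport_cutoff hR0).mul_right
  rw [← integral_const_mul, ← integral_const_mul, ← integral_add (hi1.const_mul 2) (hi.const_mul _)]
  refine integral_mono_of_nonneg (Eventually.of_forall fun v => by positivity)
    ((hi1.const_mul 2).add (hi.const_mul _)) (Eventually.of_forall fun v => ?_)
  have hgv : (f v ^ (3 / 4 : ℝ)) ^ 2 = f v ^ (3 / 2 : ℝ) := by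
    rw [← Real.rpow_natCast, ← Real.rpow_mul (h0 v)]; norm_num
  have hb := sum_pd_rootCutoff_sq_le hp hR v
  have hq := rootCutoff_sq (p := p) (R := R) v
  simp only [norm_fderiv_sq]
  simp only [pd_mul (hrd v) (hgd v)]
  rw [← hq]
  have h2 : (∑ i, pd i (rootCutoff p R) v ^ 2) * (f v ^ (3 / 4 : ℝ)) ^ 2 ≤
      4 * (p + 8) ^ 2 * (1 + ‖v‖ ^ 2) ^ p * f v ^ (3 / 2 : ℝ) := by
    rw [hgv]; exact mul_le_mul_of_nonneg_right hb (Real.rpow_nonneg (h0 v) _)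
  calc _ ≤ ∑ i, (2 * (rootCutoff p R v ^ 2 * pd i (fun w => f w ^ (3 / 4 : ℝ)) v ^ 2)
        + 2 * (pd i (rootCutoff p R) v ^ 2 * (f v ^ (3 / 4 : ℝ)) ^ 2)) := by
        refine Finset.sum_le_sum fun i _ => ?_
        nlinarith [sq_nonneg (rootCutoff p R v * pd i (fun w => f w ^ (3 / 4 : ℝ)) v
          - pd i (rootCutoff p R) v * f v ^ (3 / 4 : ℝ))]
    _ ≤ _ := by
        rw [Finset.sum_add_distrib, ← Finset.mul_sum, ← Finset.mul_sum, ← Finset.mul_sum,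
          ← Finset.sum_mul]
        linarith

end

/-! ### The critical term and the localisation term -/

lemma integrable_mollify_kernel {η : V → ℝ} (hη : IsMollifier η) {δ : ℝ} {f : V → ℝ} (hf : Integrable f)
    (v : V) : Integrable fun z => (δ ^ 3)⁻¹ * η (δ⁻¹ • (v - z)) * f z := by
  have hc : Continuous η := hη.smooth.continuous
  refine (hf.const_mul |(δ ^ 3)⁻¹|).mono ((Continuous.aestronglyMeasurable (by fun_prop)).mul hf.1)
    (Eventually.of_forall fun z => ?_)
  rw [norm_mul, norm_mul, norm_mul]
  simp only [Real.norm_eq_abs, abs_abs]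
  refine mul_le_mul_of_nonneg_right ?_ (abs_nonneg _)
  refine mul_le_of_le_one_right (abs_nonneg _) ?_
  rw [abs_of_nonneg (hη.nonneg _)]; exact hη.le_one _

/-- Since η ≤ 1, the mollified part is bounded, at the price of δ⁻³. -/
lemma abs_mollify_le {η : V → ℝ} (hη : IsMollifier η) {δ : ℝ} (hδ : 0 < δ) {f : V → ℝ}
    (hf : Integrable f) (h0 : ∀ v, 0 ≤ f v) (v : V) :
    |mollify η δ f v| ≤ (δ ^ 3)⁻¹ * ∫ z, f z := by
  unfold mollify
  rw [← integral_const_mul, ← Real.norm_eq_abs]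
  refine norm_integral_le_of_norm_le (hf.const_mul _) (Eventually.of_forall fun z => ?_)
  rw [Real.norm_of_nonneg (mul_nonneg (mul_nonneg (by positivity) (hη.nonneg _)) (h0 z))]
  refine mul_le_mul_of_nonneg_right ?_ (h0 z)
  exact mul_le_of_le_one_right (by positivity) (hη.le_one _)

lemma aestronglyMeasurable_mollify {η : V → ℝ} (hη : IsMollifier η) (δ : ℝ) {f : V → ℝ}
    (hf : AEStronglyMeasurable f) : AEStronglyMeasurable (mollify η δ f) := by
  have hc : Continuous η := hη.smooth.continuous
  have : AEStronglyMeasurable (Function.uncurry fun v z : V => (δ ^ 3)⁻¹ * η (δ⁻¹ • (v - z)) * f z)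
      (volume.prod volume) := by
    refine AEStronglyMeasurable.mul (Continuous.aestronglyMeasurable (by fun_prop)) ?_
    exact hf.comp_quasiMeasurePreserving Measure.quasiMeasurePreserving_snd
  exact this.integral_prod_right'

lemma wNorm_abs (k : ℝ) (u : V → ℝ) : wNorm k (fun v => |u v|) = wNorm k u := by
  unfold wNorm
  refine eLpNorm_congr_norm_ae (Eventually.of_forall fun v => ?_)
  simp

/-- The dissipation with weight `cutoff p R / ⟨v⟩³`. -/
noncomputable def dissip (p R : ℝ) (f : V → ℝ) : ℝ :=
  ∫ v, cutoff p R v / bracket v ^ 3 * ∑ i, pd i (fun w => f w ^ (3 / 4 : ℝ)) v ^ 2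

/-- The time derivative of `∫ cutoff p R * f^{3/2}` along the flow. -/
noncomputable def energyRate (p R : ℝ) (f : V → ℝ) : ℝ :=
  ∫ v, cutoff p R v * (3 / 2 * f v ^ (1 / 2 : ℝ)) * divergence (flux f) v

section

variable {k R : ℝ} (hk : 3 ≤ k) (hR : 1 ≤ R) {f : V → ℝ} (hf2 : ContDiff ℝ 2 f) (h0 : ∀ v, 0 ≤ f v)

lemma continuous_cutoff_mul_rpow (hf : Continuous f) (p R : ℝ) {r : ℝ} (hr : 0 ≤ r) :
    Continuous fun v => cutoff p R v * f v ^ r :=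
  (contDiff_cutoff p R).continuous.mul (hf.rpow_const fun _ => Or.inr hr)

include hk hR hf2 h0

/-- With H the product of `rootCutoff` and f^{3/4}, φ f^{5/2} = ⟨v⟩³ f H². Bound f by |f − f*η_δ|
plus a constant. The first part is estimated by Hölder with 3/2 and 3, with ⟨v⟩³ ≤ ⟨v⟩^k putting the
weight on the small factor and Sobolev turning H² into dissipation. -/
lemma integral_cutoff_mul_rpow_le {M : ℝ} (hM0 : 0 ≤ M) (hM : wNorm k f ≤ ENNReal.ofReal M)
    {η : V → ℝ} (hη : IsMollifier η) {δ : ℝ} (hδ : 0 < δ) {ε : ℝ} (hε : 0 ≤ ε)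
    (hu : wNorm k (fun v => f v - mollify η δ f v) ≤ ENNReal.ofReal ε) :
    ∫ v, cutoff (3 * k / 4) R v * f v ^ (5 / 2 : ℝ) ≤
      ε * (sobolevConst ^ 2 * (2 * dissip (3 * k / 4) R f
        + 8 * (3 * k / 4 + 8) ^ 2 * (∫ v, (1 + ‖v‖ ^ 2) ^ (3 * k / 4) * f v ^ (3 / 2 : ℝ))))
      + (δ ^ 3)⁻¹ * (∫ v, f v) * (∫ v, (1 + ‖v‖ ^ 2) ^ (3 * k / 4) * f v ^ (3 / 2 : ℝ)) := by
  have hR0 : 0 < R := by linarith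
  have hcf := hf2.continuous
  have hf := integrable_of_wNorm_le (by linarith) hcf h0 hM0 hM
  set p := 3 * k / 4 with hp
  have hW := (weight_mul_rpow_bound hcf h0 hM0 hM).1
  rw [← hp] at hW
  set B := ∫ v, (1 + ‖v‖ ^ 2) ^ p * f v ^ (3 / 2 : ℝ) with hB
  have hB0 : 0 ≤ B := integral_nonneg fun v => by have := h0 v; positivity
  have hD0 : 0 ≤ dissip p R f := integral_nonneg fun v => by
    have := cutoff_nonneg p R v; have := bracket_pos v; positivity
  have hm0 : 0 ≤ ∫ v, f v := integral_nonneg h0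
  set H : V → ℝ := fun w => rootCutoff p R w * f w ^ (3 / 4 : ℝ) with hH
  have hHs : ContDiff ℝ 1 H := contDiff_rootCutoff.mul (contDiff_rpow_three_quarters hf2 h0)
  have hHc : HasCompactSupport H := (hasCompactSupport_rootCutoff hR0).mul_right
  have hgrad := integral_fderiv_rootCutoff_mul_le (p := p) (by linarith) hR hf2 h0 hW
  rw [← hB] at hgrad
  change _ ≤ 2 * dissip p R f + _ at hgrad
  have hsob := lintegral_rpow_six_le hHs hHc
  set u : V → ℝ := fun v => f v - mollify η δ f v with hudef
  have hum : AEStronglyMeasurable u := hcf.aestronglyMeasurable.sub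
    (aestronglyMeasurable_mollify hη δ hcf.aestronglyMeasurable)
  have hHsq : ∀ v, H v ^ 2 * bracket v ^ 3 = cutoff p R v * f v ^ (3 / 2 : ℝ) := by
    intro v
    have hgv : (f v ^ (3 / 4 : ℝ)) ^ 2 = f v ^ (3 / 2 : ℝ) := by
      rw [← Real.rpow_natCast, ← Real.rpow_mul (h0 v)]; norm_num
    rw [hH]
    simp only [mul_pow, rootCutoff_sq, hgv]
    have := bracket_pos v
    field_simp
  have hpt : ∀ v, cutoff p R v * f v ^ (5 / 2 : ℝ) ≤ (bracket v ^ k * |u v|) * H v ^ 2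
      + (δ ^ 3)⁻¹ * (∫ v, f v) * ((1 + ‖v‖ ^ 2) ^ p * f v ^ (3 / 2 : ℝ)) := by
    intro v
    have h1 := abs_mollify_le hη hδ hf h0 v
    have h2 : f v ≤ |u v| + (δ ^ 3)⁻¹ * ∫ v, f v := by
      have e1 := le_abs_self (u v)
      have e2 := le_abs_self (mollify η δ f v)
      simp only [hudef] at e1 ⊢
      linarith
    have h3 : f v ^ (5 / 2 : ℝ) = f v ^ (3 / 2 : ℝ) * f v := by
      rw [← Real.rpow_add_one' (h0 v) (by norm_num)]; norm_num
    have hχ := cutoff_nonneg p R v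
    have hχ2 : cutoff p R v ≤ (1 + ‖v‖ ^ 2) ^ p := cutoff_le ..
    have hr : 0 ≤ f v ^ (3 / 2 : ℝ) := Real.rpow_nonneg (h0 v) _
    have hbk : bracket v ^ 3 ≤ bracket v ^ k := by
      rw [← Real.rpow_natCast]
      exact Real.rpow_le_rpow_of_exponent_le (one_le_bracket v) (by push_cast; exact hk)
    calc cutoff p R v * f v ^ (5 / 2 : ℝ) = cutoff p R v * f v ^ (3 / 2 : ℝ) * f v := by rw [h3]; ring
      _ ≤ cutoff p R v * f v ^ (3 / 2 : ℝ) * (|u v| + (δ ^ 3)⁻¹ * ∫ v, f v) :=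
          mul_le_mul_of_nonneg_left h2 (by positivity)
      _ = bracket v ^ 3 * (|u v| * H v ^ 2) + (δ ^ 3)⁻¹ * (∫ v, f v) * (cutoff p R v * f v ^ (3 / 2 : ℝ)) := by
          rw [mul_add, ← hHsq]; ring
      _ ≤ bracket v ^ k * (|u v| * H v ^ 2) +
          (δ ^ 3)⁻¹ * (∫ v, f v) * ((1 + ‖v‖ ^ 2) ^ p * f v ^ (3 / 2 : ℝ)) := by
          refine add_le_add (mul_le_mul_of_nonneg_right hbk (by positivity)) ?_
          exact mul_le_mul_of_nonneg_left (mul_le_mul_of_nonneg_right hχ2 hr) (by positivity)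
      _ = _ := by ring
  refine (integrable_and_integral_le
    (continuous_cutoff_mul_rpow hcf p R (by norm_num)).aestronglyMeasurable
    (Eventually.of_forall fun v => mul_nonneg (cutoff_nonneg p R v) (Real.rpow_nonneg (h0 v) _))
    (by positivity) ?_).2
  have hwm : AEMeasurable fun v => ENNReal.ofReal (bracket v ^ k * |u v|) :=
    ((continuous_bracket_rpow k).aestronglyMeasurable.mul hum.norm).aemeasurable.ennreal_ofReal
  have hHm : AEMeasurable fun v => ENNReal.ofReal (H v ^ 2) :=
    (hHs.continuous.pow 2).measurable.ennreal_ofReal.aemeasurable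
  have hu' : ∫⁻ v, ENNReal.ofReal (bracket v ^ k * |u v|) ^ (3 / 2 : ℝ) ≤ ENNReal.ofReal ε ^ (3 / 2 : ℝ) :=
    rpow_lintegral_le_of_wNorm_le (fun v => abs_nonneg _) ((wNorm_abs k u).le.trans hu)
  calc ∫⁻ v, ENNReal.ofReal (cutoff p R v * f v ^ (5 / 2 : ℝ))
      ≤ ∫⁻ v, (ENNReal.ofReal (bracket v ^ k * |u v|) * ENNReal.ofReal (H v ^ 2)
        + ENNReal.ofReal ((δ ^ 3)⁻¹ * (∫ v, f v) * ((1 + ‖v‖ ^ 2) ^ p * f v ^ (3 / 2 : ℝ)))) := by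
        refine lintegral_mono fun v => ?_
        refine (ENNReal.ofReal_le_ofReal (hpt v)).trans ?_
        rw [← ENNReal.ofReal_mul (mul_nonneg (Real.rpow_nonneg (bracket_pos v).le _) (abs_nonneg _))]
        exact ENNReal.ofReal_add_le
    _ = (∫⁻ v, ENNReal.ofReal (bracket v ^ k * |u v|) * ENNReal.ofReal (H v ^ 2)) +
        ENNReal.ofReal ((δ ^ 3)⁻¹ * (∫ v, f v) * B) := by
        rw [lintegral_add_left' (show AEMeasurable (fun v => ENNReal.ofReal (bracket v ^ k * |u v|) *
          ENNReal.ofReal (H v ^ 2)) volume from hwm.mul hHm), hB, ← integral_const_mul ((δ ^ 3)⁻¹ * ∫ v, f v),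
          ofReal_integral_eq_lintegral_ofReal (hW.const_mul _)]
        exact Eventually.of_forall fun v => by have := h0 v; simp only [Pi.zero_apply]; positivity
    _ ≤ ENNReal.ofReal (ε * (sobolevConst ^ 2 * (2 * dissip p R f + 8 * (p + 8) ^ 2 * B))) +
        ENNReal.ofReal ((δ ^ 3)⁻¹ * (∫ v, f v) * B) := by
        refine add_le_add ?_ le_rfl
        refine (lintegral_mul_le_three_halves hwm hHm).trans ?_
        rw [ENNReal.ofReal_mul hε]
        refine mul_le_mul' ?_ (hsob.trans (ENNReal.ofReal_le_ofReal
          (mul_le_mul_of_nonneg_left hgrad (by positivity))))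
        calc _ ≤ (ENNReal.ofReal ε ^ (3 / 2 : ℝ)) ^ (2 / 3 : ℝ) := ENNReal.rpow_le_rpow hu' (by norm_num)
          _ = _ := by rw [← ENNReal.rpow_mul]; norm_num
    _ = _ := (ENNReal.ofReal_add (by positivity) (by positivity)).symm

omit hk in
-- Splits a[f] into its near potential h and a remainder at most the mass, then uses f^{3/2} h =
-- f^{5/4} · f^{1/4} h. The power χ² of the truncation goes entirely with f^{5/4}, so its square
-- restores the full χ⁴ of the cutoff.
lemma integral_loc_le (hk : 2 < k) {M : ℝ} (hM0 : 0 ≤ M) (hM : wNorm k f ≤ ENNReal.ofReal M) :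
    ∫ v, (1 + ‖v‖ ^ 2) ^ (3 * k / 4) * trunc R v ^ 2 * f v ^ (3 / 2 : ℝ) * scalA f v ≤
      (∫ v, cutoff (3 * k / 4) R v * f v ^ (5 / 2 : ℝ)) + nearConst k * M ^ (5 / 2 : ℝ)
        + (∫ v, f v) * (∫ v, (1 + ‖v‖ ^ 2) ^ (3 * k / 4) * f v ^ (3 / 2 : ℝ)) := by
  have hR0 : 0 < R := by linarith
  have hcf := hf2.continuous
  have hf := integrable_of_wNorm_le hk hcf h0 hM0 hM
  obtain ⟨hN, hN'⟩ := sqrt_mul_nearPot_sq_bound hk hcf h0 hM0 hM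
  have hW := (weight_mul_rpow_bound hcf h0 hM0 hM).1
  set p := 3 * k / 4
  have hφ : Integrable fun v => cutoff p R v * f v ^ (5 / 2 : ℝ) :=
    (continuous_cutoff_mul_rpow hcf p R (by norm_num)).integrable_of_hasCompactSupport
      (hasCompactSupport_cutoff hR0).mul_right
  have hφN : Integrable fun v => cutoff p R v * f v ^ (5 / 2 : ℝ) +
      (1 + ‖v‖ ^ 2) ^ p * f v ^ (1 / 2 : ℝ) * nearPot f v ^ 2 := hφ.add hN
  refine le_trans ?_ (add_le_add_left (add_le_add_right hN' _) _)
  rw [← integral_const_mul, ← integral_add hφ hN, ← integral_add hφN (hW.const_mul _)]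
  refine integral_mono_of_nonneg (Eventually.of_forall fun v => ?_) (hφN.add (hW.const_mul _))
    (Eventually.of_forall fun v => ?_)
  · have := h0 v; have := scalA_nonneg hcf hf h0 v; simp only [Pi.zero_apply]; positivity
  have ha := scalA_le hk hcf h0 hM0 hM v
  have hh := nearPot_nonneg f v
  set h := nearPot f v
  set χ := trunc R v with hχ
  have hχ0 : 0 ≤ χ := trunc_nonneg R v
  have hχ1 : χ ^ 2 ≤ 1 := pow_le_one₀ hχ0 (trunc_le_one R v)
  have hW0 : 0 ≤ (1 + ‖v‖ ^ 2) ^ p := by positivity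
  have hm0 : 0 ≤ ∫ v, f v := integral_nonneg h0
  set m := ∫ v, f v
  -- With s = f^{1/4} all the exponents become integers.
  obtain ⟨s, hs0, hs⟩ : ∃ s : ℝ, 0 ≤ s ∧ f v = s ^ 4 :=
    ⟨f v ^ (1 / 4 : ℝ), Real.rpow_nonneg (h0 v) _, by
      rw [← Real.rpow_natCast, ← Real.rpow_mul (h0 v)]; norm_num⟩
  have e : ∀ (r : ℝ) (n : ℕ), 4 * r = n → f v ^ r = s ^ n := by
    intro r n hn
    rw [hs, ← Real.rpow_natCast, ← Real.rpow_mul hs0, ← Real.rpow_natCast]; congr 1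
  simp only [cutoff, e (3 / 2) 6 (by norm_num), e (5 / 2) 10 (by norm_num), e (1 / 2) 2 (by norm_num), ← hχ]
  set W := (1 + ‖v‖ ^ 2) ^ p
  calc W * χ ^ 2 * s ^ 6 * scalA f v ≤ W * χ ^ 2 * s ^ 6 * (h + m) :=
        mul_le_mul_of_nonneg_left ha (by positivity)
    _ = W * ((χ ^ 2 * s ^ 5) * (s * h)) + χ ^ 2 * (m * (W * s ^ 6)) := by ring
    _ ≤ W * ((χ ^ 2 * s ^ 5) ^ 2 + (s * h) ^ 2) + 1 * (m * (W * s ^ 6)) := by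
        refine add_le_add (mul_le_mul_of_nonneg_left ?_ hW0)
          (mul_le_mul_of_nonneg_right hχ1 (by positivity))
        nlinarith [sq_nonneg (χ ^ 2 * s ^ 5 - s * h), sq_nonneg (χ ^ 2 * s ^ 5), sq_nonneg (s * h)]
    _ = _ := by ring

end

/-! ### Closing the estimate at a fixed time -/

/-- The constant in front of `∫ cutoff * f^{5/2}` in the localised energy inequality. -/
noncomputable def rateConst (k : ℝ) : ℝ := locConst (3 * k / 4) + newtonConst / (8 * Real.pi)

/-- The smallness threshold for the mollification error. -/
noncomputable def smallConst (k : ℝ) : ℝ :=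
  coerConst k / (4 * rateConst k * (sobolevConst ^ 2 + 1))

/-- The constant in the lower order terms of the localised energy inequality. -/
noncomputable def lowerConst (k : ℝ) : ℝ :=
  rateConst k * (smallConst k * (sobolevConst ^ 2 * (8 * (3 * k / 4 + 8) ^ 2)))
    + rateConst k * (momentConst k).toReal
    + locConst (3 * k / 4) * (nearConst k + (momentConst k).toReal)

lemma rateConst_pos {k : ℝ} (hk : 0 ≤ k) : 0 < rateConst k :=
  add_pos_of_pos_of_nonneg (locConst_pos (by positivity)) (div_nonneg newtonConst_nonneg (by positivity))

lemma smallConst_pos {k : ℝ} (hk : 0 ≤ k) : 0 < smallConst k :=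
  div_pos (coerConst_pos k) (by have := rateConst_pos hk; positivity)

lemma lowerConst_nonneg {k : ℝ} (hk : 0 ≤ k) : 0 ≤ lowerConst k := by
  have h1 := rateConst_pos hk
  have h2 := smallConst_pos hk
  have h3 := locConst_pos (p := 3 * k / 4) (by positivity)
  have h4 := nearConst_nonneg k
  have h5 : 0 ≤ (momentConst k).toReal := ENNReal.toReal_nonneg
  unfold lowerConst; positivity

/-- Coercivity bounds the dissipative term below by coerConst/X⁸ times D. The critical term costs at
most half of this by the smallness hypothesis, and every other term is of order at most X³ δ⁻³. -/
lemma energyRate_le {k R : ℝ} (hk : 3 ≤ k) (hR : 1 ≤ R) {f : V → ℝ} (hf2 : ContDiff ℝ 2 f)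
    (h0 : ∀ v, 0 ≤ f v) {M : ℝ} (hM0 : 0 ≤ M) (hM : wNorm k f ≤ ENNReal.ofReal M)
    {X : ℝ} (hX1 : 1 ≤ X) (hMX : M ≤ X) (hX2 : M ≤ X * ∫ v, f v) (hX3 : 1 ≤ X * ∫ v, f v)
    {η : V → ℝ} (hη : IsMollifier η) {δ : ℝ} (hδ : δ ∈ Set.Ioc (0 : ℝ) 1)
    (hu : wNorm k (fun v => f v - mollify η δ f v) ≤ ENNReal.ofReal (smallConst k / X ^ 12)) :
    energyRate (3 * k / 4) R f ≤ - (coerConst k / (2 * X ^ 8) * dissip (3 * k / 4) R f)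
      + lowerConst k * (X / δ) ^ 3 := by
  have hk0 : 0 ≤ k := by linarith
  have hk2 : 2 < k := by linarith
  have hX : 0 < X := by linarith
  have hR0 : 0 < R := by linarith
  have hδ0 := hδ.1
  have hcf := hf2.continuous
  have hf := integrable_of_wNorm_le hk2 hcf h0 hM0 hM
  have hE := energy_inequality (p := 3 * k / 4) (by positivity) hR hf2 h0 hf
  have hloc := integral_loc_le hR hf2 h0 hk2 hM0 hM
  have hκ := smallConst_pos hk0
  have hP := integral_cutoff_mul_rpow_le hk hR hf2 h0 hM0 hM hη hδ0 (ε := smallConst k / X ^ 12)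
    (by positivity) hu
  have hWb := (weight_mul_rpow_bound hcf h0 hM0 hM).2
  have hmb := integral_le_of_wNorm_le hk2 hcf h0 hM0 hM
  have hcoer := coercive hk2 hcf h0 hM0 hM hX hX2 hX1 hX3
  have hL := locConst_pos (p := 3 * k / 4) (by positivity)
  have hK := rateConst_pos hk0
  have hKdef : rateConst k = locConst (3 * k / 4) + newtonConst / (8 * Real.pi) := rfl
  have hc1 : 0 ≤ (momentConst k).toReal := ENNReal.toReal_nonneg
  have hn := nearConst_nonneg k
  have hcc := coerConst_pos k
  have hB0 : 0 ≤ ∫ v, (1 + ‖v‖ ^ 2) ^ (3 * k / 4) * f v ^ (3 / 2 : ℝ) :=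
    integral_nonneg fun v => by have := h0 v; positivity
  have hm0 : 0 ≤ ∫ v, f v := integral_nonneg h0
  have hD0 : 0 ≤ dissip (3 * k / 4) R f := integral_nonneg fun v => by
    have := cutoff_nonneg (3 * k / 4) R v; have := bracket_pos v; positivity
  have hlow : coerConst k / X ^ 8 * dissip (3 * k / 4) R f ≤
      ∫ v, cutoff (3 * k / 4) R v * bil (matA f v) (fun i => pd i (fun w => f w ^ (3 / 4 : ℝ)) v)
          (fun i => pd i (fun w => f w ^ (3 / 4 : ℝ)) v) := by
    have hg : ContDiff ℝ 1 fun w => f w ^ (3 / 4 : ℝ) := contDiff_rpow_three_quarters hf2 h0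
    rw [dissip, ← integral_const_mul]
    refine integral_mono_of_nonneg (Eventually.of_forall fun v => ?_) ?_
      (Eventually.of_forall fun v => ?_)
    · have := cutoff_nonneg (3 * k / 4) R v; have := bracket_pos v
      simp only [Pi.zero_apply]; positivity
    · refine Continuous.integrable_of_hasCompactSupport ?_ (hasCompactSupport_cutoff hR0).mul_right
      have h1 : ∀ i, Continuous (pd i fun w => f w ^ (3 / 4 : ℝ)) := fun i => continuous_pd hg i
      have h2 : ∀ i j, Continuous fun v => matA f v i j :=
        fun i j => (contDiff_matA hf2 hf i j).continuous
      have h3 := (contDiff_cutoff (3 * k / 4) R).continuous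
      unfold bil
      fun_prop
    · have := mul_le_mul_of_nonneg_left (hcoer v fun i => pd i (fun w => f w ^ (3 / 4 : ℝ)) v)
        (cutoff_nonneg (3 * k / 4) R v)
      refine le_trans (le_of_eq ?_) this
      ring
  unfold energyRate
  set D := dissip (3 * k / 4) R f
  set B := ∫ v, (1 + ‖v‖ ^ 2) ^ (3 * k / 4) * f v ^ (3 / 2 : ℝ)
  set m := ∫ v, f v
  set P := ∫ v, cutoff (3 * k / 4) R v * f v ^ (5 / 2 : ℝ)
  set L := locConst (3 * k / 4)
  set K := rateConst k
  set κ := smallConst k with hκdef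
  set c1 := (momentConst k).toReal
  set S2 := sobolevConst ^ 2 with hS2
  have hS0 : 0 ≤ S2 := sq_nonneg _
  set E := 8 * (3 * k / 4 + 8) ^ 2 with hEdef
  have hE0 : 0 ≤ E := by positivity
  set Z := (X / δ) ^ 3 with hZ
  have hδ3 : 1 ≤ (δ ^ 3)⁻¹ := (one_le_inv₀ (by positivity)).2 (pow_le_one₀ hδ0.le hδ.2)
  have hZe : Z = X ^ 3 * (δ ^ 3)⁻¹ := by rw [hZ, div_pow, div_eq_mul_inv]
  have hX3Z : X ^ 3 ≤ Z := by rw [hZe]; exact le_mul_of_one_le_right (by positivity) hδ3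
  have hM52 : M ^ (5 / 2 : ℝ) ≤ X ^ 3 := by
    calc M ^ (5 / 2 : ℝ) ≤ X ^ (5 / 2 : ℝ) := Real.rpow_le_rpow hM0 hMX (by norm_num)
      _ ≤ X ^ (3 : ℝ) := Real.rpow_le_rpow_of_exponent_le hX1 (by norm_num)
      _ = X ^ 3 := by rw [← Real.rpow_natCast]; norm_num
  have hBX : B ≤ X ^ 3 := by
    refine hWb.trans ?_
    calc M ^ (3 / 2 : ℝ) ≤ X ^ (3 / 2 : ℝ) := Real.rpow_le_rpow hM0 hMX (by norm_num)
      _ ≤ X ^ (3 : ℝ) := Real.rpow_le_rpow_of_exponent_le hX1 (by norm_num)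
      _ = X ^ 3 := by rw [← Real.rpow_natCast]; norm_num
  have hmB : m * B ≤ c1 * X ^ 3 := by
    calc m * B ≤ (M * c1) * M ^ (3 / 2 : ℝ) := mul_le_mul hmb hWb hB0 (by positivity)
      _ = c1 * M ^ (5 / 2 : ℝ) := by
          have : M ^ (5 / 2 : ℝ) = M ^ (3 / 2 : ℝ) * M := by
            rw [← Real.rpow_add_one' hM0 (by norm_num)]; norm_num
          rw [this]; ring
      _ ≤ _ := mul_le_mul_of_nonneg_left hM52 hc1
  have hε : κ / X ^ 12 ≤ κ := div_le_self hκ.le (one_le_pow₀ hX1)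
  -- The absorption needs only κ/X⁸. The stronger threshold lets one exponent serve for the
  -- smallness condition and for the final bound.
  have hε8 : κ / X ^ 12 ≤ κ / X ^ 8 :=
    div_le_div_of_nonneg_left hκ.le (by positivity) (pow_le_pow_right₀ hX1 (by norm_num))
  -- The factor 4 in `smallConst` leaves half of the coercivity; S2 + 1 in place of S2 keeps the
  -- denominator positive.
  have habs : K * (κ * (S2 * 2)) ≤ coerConst k / 2 := by
    have : κ = coerConst k / (4 * K * (S2 + 1)) := rfl
    rw [this]
    have h1 : K * (coerConst k / (4 * K * (S2 + 1)) * (S2 * 2)) = coerConst k / 2 * (S2 / (S2 + 1)) := by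
      field_simp; ring
    rw [h1]
    exact mul_le_of_le_one_right (by positivity) ((div_le_one (by positivity)).2 (by linarith))
  have hDabs : K * (κ / X ^ 12 * (S2 * (2 * D))) ≤ coerConst k / (2 * X ^ 8) * D := by
    calc K * (κ / X ^ 12 * (S2 * (2 * D))) ≤ K * (κ / X ^ 8 * (S2 * (2 * D))) := by gcongr
      _ = K * (κ * (S2 * 2)) * (D / X ^ 8) := by ring
      _ ≤ coerConst k / 2 * (D / X ^ 8) := mul_le_mul_of_nonneg_right habs (by positivity)
      _ = _ := by field_simp
  have hB1 : K * (κ / X ^ 12 * (S2 * (E * B))) ≤ K * (κ * (S2 * E)) * Z := by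
    calc _ ≤ K * (κ * (S2 * (E * X ^ 3))) := by gcongr
      _ ≤ K * (κ * (S2 * (E * Z))) := by gcongr
      _ = _ := by ring
  have hB2 : K * ((δ ^ 3)⁻¹ * m * B) ≤ K * c1 * Z := by
    calc K * ((δ ^ 3)⁻¹ * m * B) = K * (δ ^ 3)⁻¹ * (m * B) := by ring
      _ ≤ K * (δ ^ 3)⁻¹ * (c1 * X ^ 3) := by gcongr
      _ = _ := by rw [hZe]; ring
  have hB3 : L * (nearConst k * M ^ (5 / 2 : ℝ) + m * B) ≤ L * (nearConst k + c1) * Z := by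
    calc _ ≤ L * (nearConst k * X ^ 3 + c1 * X ^ 3) := by gcongr
      _ = L * (nearConst k + c1) * X ^ 3 := by ring
      _ ≤ _ := by gcongr
  have hKP : K * P ≤ K * (κ / X ^ 12 * (S2 * (2 * D + E * B)) + (δ ^ 3)⁻¹ * m * B) :=
    mul_le_mul_of_nonneg_left hP hK.le
  have hLl := mul_le_mul_of_nonneg_left hloc hL.le
  have hlc : lowerConst k = K * (κ * (S2 * E)) + K * c1 + L * (nearConst k + c1) := rfl
  have hcD : coerConst k / X ^ 8 * D = coerConst k / (2 * X ^ 8) * D + coerConst k / (2 * X ^ 8) * D := by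
    field_simp; norm_num
  rw [hlc]
  rw [hKdef] at hKP
  have e1 : (L + newtonConst / (8 * Real.pi)) * (κ / X ^ 12 * (S2 * (2 * D + E * B)) + (δ ^ 3)⁻¹ * m * B)
      = K * (κ / X ^ 12 * (S2 * (2 * D))) + K * (κ / X ^ 12 * (S2 * (E * B))) + K * ((δ ^ 3)⁻¹ * m * B) := by
    rw [← hKdef]; ring
  rw [e1] at hKP
  linarith

/-! ### Time derivatives of localised integrals -/

section

variable {T : ℝ} {f : ℝ → V → ℝ} (hs : IsClassicalSolution T f)
include hs

lemma contDiffAt_uncurry {t : ℝ} (ht : t ∈ Set.Ioo 0 T) (v : V) :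
    ContDiffAt ℝ 2 (fun p : ℝ × V => f p.1 p.2) (t, v) :=
  hs.smooth.contDiffAt ((isOpen_Ioo.prod isOpen_univ).mem_nhds ⟨ht, trivial⟩)

lemma contDiff_slice {t : ℝ} (ht : t ∈ Set.Ioo 0 T) : ContDiff ℝ 2 (f t) := by
  rw [contDiff_iff_contDiffAt]
  intro v
  exact (contDiffAt_uncurry hs ht v).comp v (contDiffAt_const.prodMk contDiffAt_id)

lemma continuousOn_uncurry : ContinuousOn (fun p : ℝ × V => f p.1 p.2) (Set.Ioo 0 T ×ˢ Set.univ) :=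
  hs.smooth.continuousOn

lemma continuousOn_fderiv_uncurry :
    ContinuousOn (fderiv ℝ fun p : ℝ × V => f p.1 p.2) (Set.Ioo 0 T ×ˢ Set.univ) :=
  hs.smooth.continuousOn_fderiv_of_isOpen (isOpen_Ioo.prod isOpen_univ) (by norm_num)

lemma hasFDerivAt_uncurry {t : ℝ} (ht : t ∈ Set.Ioo 0 T) (v : V) :
    HasFDerivAt (fun p : ℝ × V => f p.1 p.2) (fderiv ℝ (fun p : ℝ × V => f p.1 p.2) (t, v)) (t, v) :=
  ((contDiffAt_uncurry hs ht v).differentiableAt (by norm_num)).hasFDerivAt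

lemma hasDerivAt_time {t : ℝ} (ht : t ∈ Set.Ioo 0 T) (v : V) :
    HasDerivAt (fun s => f s v) (divergence (flux (f t)) v) t := by
  rw [← hs.equation t ht v]
  exact ((hasFDerivAt_uncurry hs ht v).comp_hasDerivAt t
    ((hasDerivAt_id t).prodMk (hasDerivAt_const t v))).differentiableAt.hasDerivAt

/-- Joint continuity of the right-hand side in (t,v) is read off from ∂ₜf through this identity, so
nothing has to be known about how A[f(t)] depends on t. -/
lemma divergence_flux_eq {t : ℝ} (ht : t ∈ Set.Ioo 0 T) (v : V) :
    divergence (flux (f t)) v = fderiv ℝ (fun p : ℝ × V => f p.1 p.2) (t, v) (1, 0) :=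
  (hasDerivAt_time hs ht v).unique (HasFDerivAt.comp_hasDerivAt (f := fun s : ℝ => (s, v)) t
    (hasFDerivAt_uncurry hs ht v) ((hasDerivAt_id t).prodMk (hasDerivAt_const t v)))

lemma continuousOn_divergence_flux :
    ContinuousOn (fun p : ℝ × V => divergence (flux (f p.1)) p.2) (Set.Ioo 0 T ×ˢ Set.univ) :=
  ((continuousOn_fderiv_uncurry hs).clm_apply continuousOn_const).congr
    fun p hp => divergence_flux_eq hs hp.1 p.2

variable {φ : V → ℝ} (hφ : Continuous φ) (hφc : HasCompactSupport φ) {G G' : ℝ → ℝ}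
  (hG : ∀ x, HasDerivAt G (G' x) x) (hG' : Continuous G')
include hφ hφc hG'

omit hφc in
lemma continuousOn_rate_integrand : ContinuousOn
    (fun p : ℝ × V => φ p.2 * G' (f p.1 p.2) * divergence (flux (f p.1)) p.2)
    (Set.Ioo 0 T ×ˢ Set.univ) :=
  ((hφ.comp continuous_snd).continuousOn.mul (hG'.comp_continuousOn (continuousOn_uncurry hs))).mul
    (continuousOn_divergence_flux hs)

lemma continuousOn_rate : ContinuousOn
    (fun t => ∫ v, φ v * G' (f t v) * divergence (flux (f t)) v) (Set.Ioo 0 T) :=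
  continuousOn_integral_of_compact_support hφc.isCompact (continuousOn_rate_integrand hs hφ hG')
    fun t v _ hv => by rw [image_eq_zero_of_notMem_tsupport hv]; simp

include hG

/-- The support of φ times a small closed time interval is compact, so the integrand's time
derivative is bounded there. The case G(x) = x serves mass conservation, and G(x) = x^{3/2} the
energy. -/
lemma hasDerivAt_integral_comp {t : ℝ} (ht : t ∈ Set.Ioo 0 T) :
    HasDerivAt (fun t => ∫ v, φ v * G (f t v))
      (∫ v, φ v * G' (f t v) * divergence (flux (f t)) v) t := by
  obtain ⟨r, hr, hball⟩ := Metric.nhds_basis_closedBall.mem_iff.1 (isOpen_Ioo.mem_nhds ht)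
  have hGc : Continuous G := continuous_iff_continuousAt.2 fun x => (hG x).continuousAt
  have hc : ∀ s ∈ Set.Ioo 0 T, Continuous fun v => φ v * G (f s v) := fun s hs' =>
    hφ.mul (hGc.comp (contDiff_slice hs hs').continuous)
  have hK : IsCompact (Metric.closedBall t r ×ˢ tsupport φ) :=
    (isCompact_closedBall t r).prod hφc.isCompact
  obtain ⟨B, hB⟩ := hK.exists_bound_of_continuousOn ((continuousOn_rate_integrand hs hφ hG').mono
    (Set.prod_mono hball (Set.subset_univ _)))
  refine (hasDerivAt_integral_of_dominated_loc_of_deriv_le (F := fun t v => φ v * G (f t v))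
    (F' := fun t v => φ v * G' (f t v) * divergence (flux (f t)) v)
    (bound := (tsupport φ).indicator fun _ => B) (Metric.ball_mem_nhds t hr) ?_ ?_ ?_ ?_ ?_ ?_).2
  · filter_upwards [isOpen_Ioo.mem_nhds ht] with s hs'
    exact (hc s hs').aestronglyMeasurable
  · exact (hc t ht).integrable_of_hasCompactSupport hφc.mul_right
  · exact (ContinuousOn.comp_continuous (continuousOn_rate_integrand hs hφ hG')
      (Continuous.prodMk_right t) fun v => ⟨ht, trivial⟩).aestronglyMeasurable
  · refine Eventually.of_forall fun v s hs' => ?_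
    by_cases hv : v ∈ tsupport φ
    · rw [Set.indicator_of_mem hv]
      exact hB (s, v) ⟨Metric.ball_subset_closedBall hs', hv⟩
    · rw [Set.indicator_of_notMem hv, image_eq_zero_of_notMem_tsupport hv]; simp
  · rw [integrable_indicator_iff hφc.isCompact.measurableSet]
    exact integrableOn_const hφc.isCompact.measure_lt_top.ne
  · refine Eventually.of_forall fun v s hs' => ?_
    have h1 := hasDerivAt_time hs (hball (Metric.ball_subset_closedBall hs')) v
    have := ((hG (f s v)).comp s h1).const_mul (φ v)
    simpa [mul_assoc] using this

lemma integral_rate_eq {a b : ℝ} (ha : 0 < a) (hab : a ≤ b) (hb : b < T) :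
    ∫ t in a..b, (∫ v, φ v * G' (f t v) * divergence (flux (f t)) v) =
      (∫ v, φ v * G (f b v)) - ∫ v, φ v * G (f a v) := by
  have hsub : Set.uIcc a b ⊆ Set.Ioo 0 T := by
    rw [Set.uIcc_of_le hab]; exact fun t ht => ⟨ha.trans_le ht.1, ht.2.trans_lt hb⟩
  exact intervalIntegral.integral_eq_sub_of_hasDerivAt
    (fun t ht => hasDerivAt_integral_comp hs hφ hφc hG hG' (hsub ht))
    ((continuousOn_rate hs hφ hφc hG').mono hsub).intervalIntegrable

end

/-! ### Weighted continuity in time and conservation of mass -/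

lemma aestronglyMeasurable_of_weight {k : ℝ} {g : V → ℝ}
    (hg : AEStronglyMeasurable fun v => bracket v ^ k * g v) : AEStronglyMeasurable g := by
  refine ((continuous_bracket_rpow (-k)).aestronglyMeasurable.mul hg).congr
    (Eventually.of_forall fun v => ?_)
  simp only [Pi.mul_apply]
  rw [← mul_assoc, ← Real.rpow_add (bracket_pos v)]; simp

lemma aestronglyMeasurable_weight_mul (k : ℝ) {g : V → ℝ} (hg : AEStronglyMeasurable g) :
    AEStronglyMeasurable fun v => bracket v ^ k * g v :=
  (continuous_bracket_rpow k).aestronglyMeasurable.mul hg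

lemma wNorm_add_le (k : ℝ) {g h : V → ℝ} (hg : AEStronglyMeasurable g) (hh : AEStronglyMeasurable h) :
    wNorm k (fun v => g v + h v) ≤ wNorm k g + wNorm k h := by
  unfold wNorm
  simp only [mul_add]
  exact eLpNorm_add_le (aestronglyMeasurable_weight_mul k hg) (aestronglyMeasurable_weight_mul k hh)
    (by rw [ENNReal.le_div_iff_mul_le (by simp) (by simp)]; norm_num)

lemma lintegral_enorm_le {k : ℝ} {g : V → ℝ} (hg : AEStronglyMeasurable g) :
    ∫⁻ v, ‖g v‖ₑ ≤ wNorm k g * momentConst k := by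
  refine le_trans (lintegral_mono fun v => ?_) (lintegral_bracket_mul_le (M := wNorm k g)
    hg.norm (fun v => norm_nonneg (g v)) (wNorm_abs k g).le)
  rw [← ofReal_norm]
  exact ENNReal.ofReal_le_ofReal (le_mul_of_one_le_left (norm_nonneg _) (one_le_bracket v))

lemma integrable_of_wNorm_lt_top {k : ℝ} (hk : 2 < k) {g : V → ℝ} (hg : AEStronglyMeasurable g)
    (h : wNorm k g < ⊤) : Integrable g :=
  ⟨hg, (lintegral_enorm_le hg).trans_lt (ENNReal.mul_lt_top h (momentConst_lt_top hk))⟩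

section

variable {k T : ℝ} {f : ℝ → V → ℝ} (hw : WeightedContinuous k T f)
include hw

lemma aestronglyMeasurable_slice {t : ℝ} (ht : t ∈ Set.Icc 0 T) : AEStronglyMeasurable (f t) :=
  aestronglyMeasurable_of_weight (hw.memLp t ht).1

lemma wNorm_slice_lt_top {t : ℝ} (ht : t ∈ Set.Icc 0 T) : wNorm k (f t) < ⊤ := (hw.memLp t ht).2

lemma wNorm_slice_le {t s : ℝ} (ht : t ∈ Set.Icc 0 T) (hs : s ∈ Set.Icc 0 T) :
    wNorm k (f t) ≤ wNorm k (fun v => f t v - f s v) + wNorm k (f s) := by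
  have := wNorm_add_le k (g := fun v => f t v - f s v)
    ((aestronglyMeasurable_slice hw ht).sub (aestronglyMeasurable_slice hw hs))
    (aestronglyMeasurable_slice hw hs)
  simpa only [sub_add_cancel] using this

/-- Continuity bounds the norm near each time by its value there plus one, and [0,T] is compact. -/
lemma wSup_lt_top : wSup k T f < ⊤ := by
  have : ∃ B : ℝ≥0∞, B < ⊤ ∧ ∀ t ∈ Set.Icc 0 T, wNorm k (f t) ≤ B := by
    refine (isCompact_Icc (a := (0 : ℝ)) (b := T)).induction_on
      (p := fun s => ∃ B : ℝ≥0∞, B < ⊤ ∧ ∀ t ∈ s, wNorm k (f t) ≤ B)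
      ⟨0, by simp, by simp⟩ ?_ ?_ ?_
    · rintro s s' hss ⟨B, hB, h⟩; exact ⟨B, hB, fun t ht => h t (hss ht)⟩
    · rintro s s' ⟨B, hB, h⟩ ⟨B', hB', h'⟩
      refine ⟨max B B', max_lt hB hB', ?_⟩
      rintro t (ht | ht)
      · exact (h t ht).trans (le_max_left _ _)
      · exact (h' t ht).trans (le_max_right _ _)
    · intro t ht
      refine ⟨_, inter_mem self_mem_nhdsWithin ((hw.tendsto t ht).eventually_lt_const zero_lt_one),
        1 + wNorm k (f t), by simp [wNorm_slice_lt_top hw ht], ?_⟩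
      rintro s ⟨hs, hs'⟩
      exact (wNorm_slice_le hw hs ht).trans (add_le_add_left (le_of_lt hs') _)
  obtain ⟨B, hB, h⟩ := this
  exact (iSup₂_le h).trans_lt hB

lemma wNorm_le_wSup {t : ℝ} (ht : t ∈ Set.Icc 0 T) :
    wNorm k (f t) ≤ ENNReal.ofReal (wSup k T f).toReal := by
  rw [ENNReal.ofReal_toReal (wSup_lt_top hw).ne]
  exact le_iSup₂ (f := fun t (_ : t ∈ Set.Icc 0 T) => wNorm k (f t)) t ht

variable (hk : 2 < k)
include hk

lemma integrable_slice {t : ℝ} (ht : t ∈ Set.Icc 0 T) : Integrable (f t) :=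
  integrable_of_wNorm_lt_top hk (aestronglyMeasurable_slice hw ht) (wNorm_slice_lt_top hw ht)

lemma continuousOn_integral_slice : ContinuousOn (fun t => ∫ v, f t v) (Set.Icc 0 T) := by
  intro t ht
  refine tendsto_integral_of_L1 _ (integrable_slice hw hk ht).1 ?_ ?_
  · filter_upwards [self_mem_nhdsWithin] with s hs using integrable_slice hw hk hs
  · have h := ENNReal.Tendsto.mul_const (hw.tendsto t ht) (Or.inr (momentConst_lt_top hk).ne)
    rw [zero_mul] at h
    refine tendsto_of_tendsto_of_tendsto_of_le_of_le' tendsto_const_nhds h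
      (Eventually.of_forall fun _ => zero_le) ?_
    filter_upwards [self_mem_nhdsWithin] with s hs
    exact lintegral_enorm_le ((aestronglyMeasurable_slice hw hs).sub (aestronglyMeasurable_slice hw ht))

variable (hs : IsClassicalSolution T f)
include hs

/-- Against the cutoff at radius n + 1 the integral changes by O(n⁻²), because the cutoff's gradient
has Lipschitz constant of that order and the interaction energy is bounded uniformly in time.
Dominated convergence recovers the full mass. -/
lemma integral_slice_eq_of_mem_Ioo {a b : ℝ} (ha : 0 < a) (hab : a ≤ b) (hb : b < T) :
    ∫ v, f a v = ∫ v, f b v := by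
  set M := (wSup k T f).toReal
  have hM0 : 0 ≤ M := ENNReal.toReal_nonneg
  have mem : ∀ t ∈ Set.Icc a b, t ∈ Set.Ioo 0 T := fun t ht => ⟨ha.trans_le ht.1, ht.2.trans_lt hb⟩
  have hI : ∀ t ∈ Set.Icc a b, Integrable (f t) := fun t ht =>
    integrable_slice hw hk (Set.Ioo_subset_Icc_self (mem t ht))
  have key : ∀ n : ℕ, |(∫ v, cutoff 0 (n + 1) v * f b v) - ∫ v, cutoff 0 (n + 1) v * f a v| ≤
      9 * (672 / ((n : ℝ) + 1) ^ 2) * (interactionConst k * M ^ 2) * |b - a| := by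
    intro n
    have hR : (1 : ℝ) ≤ n + 1 := by linarith [(Nat.cast_nonneg n : (0 : ℝ) ≤ n)]
    have hφ := contDiff_cutoff 0 ((n : ℝ) + 1)
    have hφc := hasCompactSupport_cutoff (p := 0) (R := (n : ℝ) + 1) (by linarith)
    have h := integral_rate_eq hs hφ.continuous hφc (G := fun x => x) (G' := fun _ => 1)
      (fun x => hasDerivAt_id x) continuous_const ha hab hb
    rw [← h, ← Real.norm_eq_abs]
    refine intervalIntegral.norm_integral_le_of_norm_le_const fun t ht => ?_
    rw [Set.uIoc_of_le hab] at ht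
    have htm := mem t ⟨ht.1.le, ht.2⟩
    have ht2 := contDiff_slice hs htm
    have hn := hs.nonneg t htm
    have hMt := wNorm_le_wSup hw (Set.Ioo_subset_Icc_self htm)
    obtain ⟨hQ, hQ'⟩ := interaction_bound hk ht2.continuous hn hM0 hMt
    have := abs_integral_mul_divergence_flux_le ht2 hn (hI t ⟨ht.1.le, ht.2⟩) (hφ.of_le (by norm_num)) hφc
      (fun i v z => abs_pd_cutoff_zero_sub_le hR i v z) hQ
    simp only [mul_one]
    rw [Real.norm_eq_abs]
    exact this.trans (mul_le_mul_of_nonneg_left hQ' (by positivity))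
  have lim : ∀ t ∈ Set.Icc a b, Tendsto (fun n : ℕ => ∫ v, cutoff 0 (n + 1) v * f t v) atTop
      (𝓝 (∫ v, f t v)) := by
    intro t ht
    refine tendsto_integral_of_dominated_convergence (fun v => ‖f t v‖)
      (fun n => ((contDiff_cutoff 0 _).continuous.aestronglyMeasurable.mul (hI t ht).1)) (hI t ht).norm
      (fun n => Eventually.of_forall fun v => ?_) (Eventually.of_forall fun v => ?_)
    · rw [norm_mul]
      refine mul_le_of_le_one_left (norm_nonneg _) ?_
      rw [Real.norm_of_nonneg (cutoff_nonneg _ _ v)]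
      simpa using cutoff_le (p := 0) (R := n + 1) v
    · simpa using (tendsto_cutoff (p := 0) v).mul_const (f t v)
  have h1 := ((lim b ⟨hab, le_rfl⟩).sub (lim a ⟨le_rfl, hab⟩)).abs
  have h2 : Tendsto (fun n : ℕ => 9 * (672 / ((n : ℝ) + 1) ^ 2) * (interactionConst k * M ^ 2) * |b - a|)
      atTop (𝓝 (9 * 0 * (interactionConst k * M ^ 2) * |b - a|)) := by
    refine ((Tendsto.const_mul 9 ?_).mul_const _).mul_const _
    refine tendsto_const_nhds.div_atTop ?_
    exact (tendsto_pow_atTop (by norm_num)).comp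
      (tendsto_atTop_add_const_right _ _ tendsto_natCast_atTop_atTop)
  have h3 := le_of_tendsto_of_tendsto' h1 h2 key
  simp only [mul_zero, zero_mul] at h3
  exact (sub_eq_zero.1 (abs_nonpos_iff.1 h3)).symm

/-- The equation says nothing at t = 0; the initial mass is reached through continuity in L¹, which
the weighted norm controls. -/
lemma integral_slice_eq_mass {t : ℝ} (ht : t ∈ Set.Ioo 0 T) : ∫ v, f t v = mass f := by
  have hT : 0 < T := ht.1.trans ht.2
  have hc := continuousOn_integral_slice hw hk 0 ⟨le_rfl, hT.le⟩
  have h1 : Tendsto (fun s => ∫ v, f s v) (𝓝[Set.Ioo 0 t] 0) (𝓝 (mass f)) :=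
    hc.mono_left (nhdsWithin_mono _ fun s hs => ⟨hs.1.le, (hs.2.trans ht.2).le⟩)
  have h2 : Tendsto (fun s => ∫ v, f s v) (𝓝[Set.Ioo 0 t] 0) (𝓝 (∫ v, f t v)) := by
    refine tendsto_const_nhds.congr' ?_
    filter_upwards [self_mem_nhdsWithin] with s hs'
    exact (integral_slice_eq_of_mem_Ioo hw hk hs hs'.1 hs'.2.le ht.2).symm
  have : (𝓝[Set.Ioo 0 t] (0 : ℝ)).NeBot := by
    rw [nhdsWithin_Ioo_eq_nhdsGT ht.1]; infer_instance
  exact tendsto_nhds_unique h2 h1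

end

/-! ### From the rate inequality to the space-time bound -/

lemma slab_eq (T : ℝ) : slab T = (volume.restrict (Set.Ioo 0 T)).prod (volume : Measure V) := by
  rw [slab, Measure.volume_eq_prod, ← Measure.prod_restrict, Measure.restrict_univ]

section

variable {k T : ℝ} {f : ℝ → V → ℝ}

lemma norm_wGrad_sq (t : ℝ) (v : V) : ‖wGrad k f (t, v)‖ ^ 2 =
    (1 + ‖v‖ ^ 2) ^ (3 * k / 4) / bracket v ^ 3 * ∑ i, pd i (fun w => f t w ^ (3 / 4 : ℝ)) v ^ 2 := by
  have hb := bracket_pos v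
  rw [wGrad, norm_smul, mul_pow, norm_gradient_sq, Real.norm_of_nonneg (Real.rpow_nonneg hb.le _),
    ← Real.rpow_natCast, ← Real.rpow_mul hb.le, show (1 + ‖v‖ ^ 2) ^ (3 * k / 4) = bracket v ^ (3 * k / 2) by
      rw [bracket_rpow_eq]; congr 1; ring, ← Real.rpow_natCast (bracket v) 3, ← Real.rpow_sub hb]
  congr 2; push_cast; ring

lemma trunc_mul_norm_wGrad_sq (R t : ℝ) (v : V) : trunc R v ^ 4 * ‖wGrad k f (t, v)‖ ^ 2 =
    cutoff (3 * k / 4) R v / bracket v ^ 3 * ∑ i, pd i (fun w => f t w ^ (3 / 4 : ℝ)) v ^ 2 := by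
  rw [norm_wGrad_sq, cutoff]; ring

variable (hs : IsClassicalSolution T f)
include hs

/-- Expresses the gradient through the joint derivative of f, which is continuous on the slab; joint
measurability of `wGrad` follows. -/
lemma gradient_rpow_three_quarters {t : ℝ} (ht : t ∈ Set.Ioo 0 T) (v : V) :
    gradient (fun v => f t v ^ (3 / 4 : ℝ)) v = (3 / 4 * f t v ^ (-(1 / 4) : ℝ)) •
      (InnerProductSpace.toDual ℝ V).symm
        ((fderiv ℝ (fun p : ℝ × V => f p.1 p.2) (t, v)).comp (ContinuousLinearMap.inr ℝ ℝ V)) := by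
  have h2 := contDiff_slice hs ht
  have e : fderiv ℝ (f t) v =
      (fderiv ℝ (fun p : ℝ × V => f p.1 p.2) (t, v)).comp (ContinuousLinearMap.inr ℝ ℝ V) := by
    refine HasFDerivAt.fderiv ?_
    exact HasFDerivAt.comp (f := fun w : V => (t, w)) v (hasFDerivAt_uncurry hs ht v)
      (hasFDerivAt_prodMk_right t v)
  rw [gradient, (hasFDerivAt_rpow_three_quarters h2 (hs.nonneg t ht) v).fderiv, e, map_smul]

lemma aestronglyMeasurable_wGrad : AEStronglyMeasurable (wGrad k f) (slab T) := by
  have hU : MeasurableSet (Set.Ioo 0 T ×ˢ (Set.univ : Set V)) := measurableSet_Ioo.prod .univ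
  have h1 : AEStronglyMeasurable (fun p : ℝ × V => f p.1 p.2) (slab T) :=
    (continuousOn_uncurry hs).aestronglyMeasurable hU
  have h2 : AEStronglyMeasurable (fun p : ℝ × V => (InnerProductSpace.toDual ℝ V).symm
        ((fderiv ℝ (fun p : ℝ × V => f p.1 p.2) p).comp (ContinuousLinearMap.inr ℝ ℝ V))) (slab T) := by
    refine ContinuousOn.aestronglyMeasurable ?_ hU
    refine (LinearIsometryEquiv.continuous _).comp_continuousOn ?_
    exact (continuousOn_fderiv_uncurry hs).clm_comp continuousOn_const
  have h3 : AEStronglyMeasurable (fun p : ℝ × V => bracket p.2 ^ (-3 / 2 + 3 * k / 4) •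
      (3 / 4 * f p.1 p.2 ^ (-(1 / 4) : ℝ)) • (InnerProductSpace.toDual ℝ V).symm
        ((fderiv ℝ (fun p : ℝ × V => f p.1 p.2) p).comp (ContinuousLinearMap.inr ℝ ℝ V))) (slab T) := by
    have h4 : AEStronglyMeasurable (fun p : ℝ × V => bracket p.2 ^ (-3 / 2 + 3 * k / 4)) (slab T) :=
      ((continuous_bracket_rpow _).comp continuous_snd).aestronglyMeasurable
    have h5 : AEStronglyMeasurable (fun p : ℝ × V => 3 / 4 * f p.1 p.2 ^ (-(1 / 4) : ℝ)) (slab T) :=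
      ((h1.aemeasurable.pow_const _).const_mul _).aestronglyMeasurable
    exact h4.smul (h5.smul h2)
  refine h3.congr ?_
  rw [slab, EventuallyEq, ae_restrict_iff' hU]
  refine Eventually.of_forall fun p hp => ?_
  rw [wGrad, gradient_rpow_three_quarters hs hp.1]

lemma ofReal_dissip_eq {t R : ℝ} (ht : t ∈ Set.Ioo 0 T) (hR : 0 < R) :
    ENNReal.ofReal (dissip (3 * k / 4) R (f t)) =
      ∫⁻ v, ENNReal.ofReal (trunc R v ^ 4) * ‖wGrad k f (t, v)‖ₑ ^ 2 := by
  have hg := contDiff_rpow_three_quarters (contDiff_slice hs ht) (hs.nonneg t ht)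
  rw [dissip, ofReal_integral_eq_lintegral_ofReal]
  · refine lintegral_congr fun v => ?_
    rw [← trunc_mul_norm_wGrad_sq, ENNReal.ofReal_mul (pow_nonneg (trunc_nonneg R v) 4),
      ENNReal.ofReal_pow (norm_nonneg _), ofReal_norm]
  · refine Continuous.integrable_of_hasCompactSupport ?_ ?_
    · have h1 := (contDiff_cutoff (3 * k / 4) R).continuous
      have h3 : ∀ i, Continuous (pd i fun w => f t w ^ (3 / 4 : ℝ)) := fun i => continuous_pd hg i
      refine (h1.div (continuous_bracket.pow 3) fun v => (pow_pos (bracket_pos v) 3).ne').mul ?_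
      fun_prop
    · refine HasCompactSupport.mul_right ?_
      simp only [div_eq_mul_inv]
      exact (hasCompactSupport_cutoff hR).mul_right
  · refine Eventually.of_forall fun v => ?_
    have := cutoff_nonneg (3 * k / 4) R v; have := bracket_pos v
    simp only [Pi.zero_apply]; positivity

/-- Fatou's lemma along growing cutoffs and time windows exhausting (0,T); the bound B must not
depend on either. -/
lemma eLpNorm_wGrad_sq_le (hT : 0 < T) {B : ℝ≥0∞}
    (h : ∀ R, 1 ≤ R → ∀ a b, 0 < a → a ≤ b → b < T →
      ∫⁻ t in Set.Ioo a b, ENNReal.ofReal (dissip (3 * k / 4) R (f t)) ≤ B) :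
    eLpNorm (wGrad k f) 2 (slab T) ^ 2 ≤ B := by
  have hm : AEMeasurable (fun p => ‖wGrad k f p‖ₑ ^ 2) (slab T) :=
    (aestronglyMeasurable_wGrad hs).enorm.pow_const 2
  have e : eLpNorm (wGrad k f) 2 (slab T) ^ 2 = ∫⁻ p, ‖wGrad k f p‖ₑ ^ 2 ∂(slab T) := by
    have := eLpNorm_nnreal_pow_eq_lintegral (f := wGrad k f) (μ := slab T) (p := 2) (by norm_num)
    simpa using this
  -- The shift by 2 gives a n ≤ T/2, so that the window (a n, T − a n) has ordered endpoints for
  -- every n.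
  set a : ℕ → ℝ := fun n => T / (n + 2) with ha
  have hn : ∀ n : ℕ, (0 : ℝ) ≤ n := fun n => Nat.cast_nonneg n
  have ha0 : ∀ n, 0 < a n := fun n => by have := hn n; simp only [ha]; positivity
  have ha2 : ∀ n, a n ≤ T / 2 := fun n => by
    have := hn n; simp only [ha]; gcongr; linarith
  set F : ℕ → ℝ × V → ℝ≥0∞ := fun n p => (Set.Ioo (a n) (T - a n)).indicator (fun _ => 1) p.1 *
    (ENNReal.ofReal (trunc (n + 1) p.2 ^ 4) * ‖wGrad k f p‖ₑ ^ 2) with hF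
  have hFm : ∀ n, AEMeasurable (F n) (slab T) := fun n => by
    refine AEMeasurable.mul ?_ (AEMeasurable.mul ?_ hm)
    · exact ((measurable_const.indicator measurableSet_Ioo).comp measurable_fst).aemeasurable
    · exact (((continuous_trunc _).comp continuous_snd).pow 4).measurable.ennreal_ofReal.aemeasurable
  have hlim : ∀ᵐ p ∂(slab T), ‖wGrad k f p‖ₑ ^ 2 = liminf (fun n => F n p) atTop := by
    rw [slab, ae_restrict_iff' (measurableSet_Ioo.prod .univ)]
    refine Eventually.of_forall fun p hp => (Tendsto.liminf_eq ?_).symm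
    have h1 : Tendsto a atTop (𝓝 0) := by
      refine tendsto_const_nhds.div_atTop ?_
      exact tendsto_atTop_add_const_right _ _ tendsto_natCast_atTop_atTop
    have h2 : ∀ᶠ n in atTop, (Set.Ioo (a n) (T - a n)).indicator (fun _ => (1 : ℝ≥0∞)) p.1 = 1 := by
      filter_upwards [h1.eventually_lt_const hp.1.1, h1.eventually_lt_const (sub_pos.2 hp.1.2)] with n h3 h4
      exact Set.indicator_of_mem (show p.1 ∈ Set.Ioo (a n) (T - a n) from ⟨h3, by linarith⟩) _
    have h5 : Tendsto (fun n : ℕ => ENNReal.ofReal (trunc (n + 1) p.2 ^ 4)) atTop (𝓝 1) := by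
      have := tendsto_cutoff (p := 0) p.2
      simp only [cutoff, Real.rpow_zero, one_mul] at this
      simpa [Function.comp_def] using (ENNReal.continuous_ofReal.tendsto _).comp this
    have h6 : Tendsto (fun n : ℕ => ENNReal.ofReal (trunc (n + 1) p.2 ^ 4) * ‖wGrad k f p‖ₑ ^ 2) atTop
        (𝓝 (1 * ‖wGrad k f p‖ₑ ^ 2)) :=
      ENNReal.Tendsto.mul_const h5 (Or.inl one_ne_zero)
    rw [one_mul] at h6
    refine h6.congr' ?_
    filter_upwards [h2] with n h3
    simp only [hF, h3, one_mul]
  rw [e, lintegral_congr_ae hlim]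
  refine (lintegral_liminf_le' hFm).trans ?_
  refine liminf_le_of_le (by isBoundedDefault) fun c hc => ?_
  obtain ⟨n, hc⟩ := hc.exists
  refine hc.trans ?_
  have hsub : Set.Ioo (a n) (T - a n) ⊆ Set.Ioo 0 T := fun t ht =>
    ⟨(ha0 n).trans ht.1, ht.2.trans (by linarith [ha0 n])⟩
  refine le_trans (le_of_eq ?_) (h (n + 1) (by linarith [hn n]) (a n) (T - a n) (ha0 n)
    (by linarith [ha2 n]) (by linarith [ha0 n]))
  have hFm' := hFm n
  rw [slab_eq] at hFm' ⊢
  rw [lintegral_prod _ hFm']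
  have e2 : ∀ t ∈ Set.Ioo 0 T, ∫⁻ v, F n (t, v) = (Set.Ioo (a n) (T - a n)).indicator
      (fun t => ENNReal.ofReal (dissip (3 * k / 4) (n + 1) (f t))) t := by
    intro t ht
    by_cases hta : t ∈ Set.Ioo (a n) (T - a n)
    · rw [Set.indicator_of_mem hta, ofReal_dissip_eq hs ht (by linarith [hn n])]
      refine lintegral_congr fun v => ?_
      simp only [hF]
      rw [Set.indicator_of_mem hta, one_mul]
    · rw [Set.indicator_of_notMem hta]
      simp only [hF]
      simp [Set.indicator_of_notMem hta]
  rw [setLIntegral_congr_fun measurableSet_Ioo e2, lintegral_indicator measurableSet_Ioo,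
    Measure.restrict_restrict measurableSet_Ioo, Set.inter_eq_left.2 hsub]

/-- Integrates the rate inequality in time and drops the nonnegative final energy. The dissipation
is dominated by a continuous function of t before any integral is evaluated, so its own regularity
in t plays no part. -/
lemma lintegral_dissip_le (hw : WeightedContinuous k T f) {c L : ℝ} (hc : 0 < c) (hL : 0 ≤ L)
    {R : ℝ} (hR : 1 ≤ R)
    (h : ∀ t ∈ Set.Ioo 0 T, energyRate (3 * k / 4) R (f t) ≤ - (c * dissip (3 * k / 4) R (f t)) + L)
    {a b : ℝ} (ha : 0 < a) (hab : a ≤ b) (hb : b < T) :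
    ∫⁻ t in Set.Ioo a b, ENNReal.ofReal (dissip (3 * k / 4) R (f t)) ≤
      ENNReal.ofReal ((T * L + (wSup k T f).toReal ^ (3 / 2 : ℝ)) / c) := by
  set p := 3 * k / 4
  set M := (wSup k T f).toReal
  have hM0 : 0 ≤ M := ENNReal.toReal_nonneg
  have mem : ∀ t ∈ Set.Icc a b, t ∈ Set.Ioo 0 T := fun t ht => ⟨ha.trans_le ht.1, ht.2.trans_lt hb⟩
  have hφ := (contDiff_cutoff p R).continuous
  have hφc := hasCompactSupport_cutoff (p := p) (R := R) (by linarith)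
  have hG : ∀ x : ℝ, HasDerivAt (fun x : ℝ => x ^ (3 / 2 : ℝ)) (3 / 2 * x ^ (1 / 2 : ℝ)) x := fun x => by
    have := Real.hasDerivAt_rpow_const (x := x) (p := 3 / 2) (Or.inr (by norm_num))
    rwa [show (3 / 2 : ℝ) - 1 = 1 / 2 by norm_num] at this
  have hG' : Continuous fun x : ℝ => 3 / 2 * x ^ (1 / 2 : ℝ) :=
    continuous_const.mul (continuous_id.rpow_const fun _ => Or.inr (by norm_num))
  have hftc := integral_rate_eq hs hφ hφc hG hG' ha hab hb
  have hJ : ContinuousOn (fun t => energyRate p R (f t)) (Set.Icc a b) :=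
    (continuousOn_rate hs hφ hφc hG').mono mem
  change ∫ t in a..b, energyRate p R (f t) = _ at hftc
  have hya : ∫ v, cutoff p R v * f a v ^ (3 / 2 : ℝ) ≤ M ^ (3 / 2 : ℝ) := by
    have hta := mem a ⟨le_rfl, hab⟩
    have hn := hs.nonneg a hta
    obtain ⟨h1, h2⟩ := weight_mul_rpow_bound (contDiff_slice hs hta).continuous hn hM0
      (wNorm_le_wSup hw (Set.Ioo_subset_Icc_self hta))
    refine le_trans (integral_mono_of_nonneg (Eventually.of_forall fun v => ?_) h1
      (Eventually.of_forall fun v => ?_)) h2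
    · exact mul_nonneg (cutoff_nonneg p R v) (Real.rpow_nonneg (hn v) _)
    · exact mul_le_mul_of_nonneg_right (cutoff_le _) (Real.rpow_nonneg (hn v) _)
  have hyb : 0 ≤ ∫ v, cutoff p R v * f b v ^ (3 / 2 : ℝ) := integral_nonneg fun v =>
    mul_nonneg (cutoff_nonneg p R v) (Real.rpow_nonneg (hs.nonneg b (mem b ⟨hab, le_rfl⟩) v) _)
  have hJi : IntegrableOn (fun t => c⁻¹ * (L - energyRate p R (f t))) (Set.Ioo a b) :=
    (((continuousOn_const.sub hJ).const_mul c⁻¹).integrableOn_Icc).mono_set Set.Ioo_subset_Icc_self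
  have hpt : ∀ t ∈ Set.Ioo a b, dissip p R (f t) ≤ c⁻¹ * (L - energyRate p R (f t)) := by
    intro t ht
    rw [inv_mul_eq_div, le_div_iff₀ hc]
    linarith [h t (mem t (Set.Ioo_subset_Icc_self ht))]
  have hD0 : ∀ t ∈ Set.Ioo a b, 0 ≤ dissip p R (f t) := fun t _ => integral_nonneg fun v => by
    have := cutoff_nonneg p R v; have := bracket_pos v; positivity
  calc _ ≤ ∫⁻ t in Set.Ioo a b, ENNReal.ofReal (c⁻¹ * (L - energyRate p R (f t))) :=
        setLIntegral_mono' measurableSet_Ioo fun t ht => ENNReal.ofReal_le_ofReal (hpt t ht)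
    _ = ENNReal.ofReal (∫ t in Set.Ioo a b, c⁻¹ * (L - energyRate p R (f t))) := by
        refine (ofReal_integral_eq_lintegral_ofReal hJi ?_).symm
        exact (ae_restrict_iff' measurableSet_Ioo).2 (Eventually.of_forall fun t ht =>
          (hD0 t ht).trans (hpt t ht))
    _ ≤ _ := by
        refine ENNReal.ofReal_le_ofReal ?_
        rw [← integral_Ioc_eq_integral_Ioo, ← intervalIntegral.integral_of_le hab,
          intervalIntegral.integral_const_mul, intervalIntegral.integral_sub intervalIntegrable_const
            ((by rwa [Set.uIcc_of_le hab] : ContinuousOn _ (Set.uIcc a b)).intervalIntegrable), hftc,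
          intervalIntegral.integral_const, inv_mul_eq_div]
        gcongr
        rw [smul_eq_mul]
        have : (b - a) * L ≤ T * L := mul_le_mul_of_nonneg_right (by linarith) hL
        linarith

end

/-! ### Mollifiers and the choice of δ -/

lemma exists_isMollifier : ∃ η : V → ℝ, IsMollifier η := by
  -- The ball of radius 9/10 has volume greater than one, so the normalised bump stays below 1.
  let b : ContDiffBump (0 : V) := ⟨9 / 10, 1, by norm_num, by norm_num⟩
  have h1 : 1 ≤ ∫ v, b v := by
    refine le_trans ?_ (b.measure_closedBall_le_integral volume)
    have : volume (Metric.ball (0 : V) (9 / 10)) ≤ volume (Metric.closedBall (0 : V) b.rIn) :=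
      measure_mono Metric.ball_subset_closedBall
    have h2 : (1 : ℝ) ≤ (volume (Metric.ball (0 : V) (9 / 10))).toReal := by
      rw [EuclideanSpace.volume_ball_fin_three, ENNReal.toReal_mul, ENNReal.toReal_pow,
        ENNReal.toReal_ofReal (by norm_num), ENNReal.toReal_ofReal (by positivity)]
      nlinarith [Real.pi_gt_three]
    exact h2.trans (ENNReal.toReal_mono (isCompact_closedBall _ _).measure_lt_top.ne this)
  refine ⟨b.normed volume, b.contDiff_normed, fun v => b.nonneg_normed v, fun v => ?_, fun v hv => ?_,
    b.integral_normed⟩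
  · rw [ContDiffBump.normed_def, div_le_one (by linarith)]
    exact b.le_one.trans h1
  · rw [ContDiffBump.normed_def, b.zero_of_le_dist (by simpa using hv.le), zero_div]

/-- The rescaled profile `δ^{-3} η(· / δ)`. -/
noncomputable def scaled (η : V → ℝ) (δ : ℝ) (u : V) : ℝ := (δ ^ 3)⁻¹ * η (δ⁻¹ • u)

section

variable {η : V → ℝ} (hη : IsMollifier η) {δ : ℝ} (hδ : 0 < δ)
include hη

lemma continuous_scaled : Continuous (scaled η δ) := by
  have := hη.smooth.continuous
  unfold scaled; fun_prop

include hδ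

lemma scaled_nonneg (u : V) : 0 ≤ scaled η δ u := mul_nonneg (by positivity) (hη.nonneg _)

lemma scaled_eq_zero {u : V} (hu : δ < ‖u‖) : scaled η δ u = 0 := by
  rw [scaled, hη.support, mul_zero]
  rw [norm_smul, norm_inv, Real.norm_of_nonneg hδ.le, inv_mul_eq_div, one_lt_div hδ]
  exact hu

lemma integral_scaled : ∫ u, scaled η δ u = 1 := by
  unfold scaled
  rw [integral_const_mul, Measure.integral_comp_smul, hη.integral]
  simp only [finrank_euclideanSpace, Fintype.card_fin, smul_eq_mul, mul_one, inv_pow, inv_inv]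
  rw [abs_of_pos (by positivity)]
  exact inv_mul_cancel₀ (by positivity)

lemma integrable_scaled : Integrable (scaled η δ) := by
  by_contra h
  have := integral_scaled hη hδ
  rw [integral_undef h] at this
  exact zero_ne_one this

lemma lintegral_scaled : ∫⁻ u, ENNReal.ofReal (scaled η δ u) = 1 := by
  rw [← ofReal_integral_eq_lintegral_ofReal (integrable_scaled hη hδ)
    (Eventually.of_forall (scaled_nonneg hη hδ)), integral_scaled hη hδ, ENNReal.ofReal_one]

end

/-- The case `L¹ * L^{3/2} ⊆ L^{3/2}` of Young's convolution inequality. -/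
lemma lintegral_conv_rpow_le {F K : V → ℝ≥0∞} (hF : AEMeasurable F) (hK : Measurable K)
    (h1 : ∫⁻ u, K u = 1) :
    ∫⁻ v, (∫⁻ z, K (v - z) * F z) ^ (3 / 2 : ℝ) ≤ ∫⁻ v, F v ^ (3 / 2 : ℝ) := by
  have hKm : ∀ v : V, Measurable fun z => K (v - z) := fun v => hK.comp (measurable_const.sub measurable_id)
  have hpt : ∀ v, (∫⁻ z, K (v - z) * F z) ^ (3 / 2 : ℝ) ≤ ∫⁻ z, K (v - z) * F z ^ (3 / 2 : ℝ) := by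
    intro v
    -- Jensen for the probability density K, obtained from Hölder after splitting K = K^{2/3} ·
    -- K^{1/3}.
    have h := lintegral_mul_le_three_halves (((hKm v).pow_const (2 / 3 : ℝ)).aemeasurable.mul hF)
      ((hKm v).pow_const (1 / 3 : ℝ)).aemeasurable
    have e1 : ∀ z, (K (v - z) ^ (2 / 3 : ℝ) * F z) * K (v - z) ^ (1 / 3 : ℝ) = K (v - z) * F z := by
      intro z
      have : K (v - z) ^ (2 / 3 : ℝ) * K (v - z) ^ (1 / 3 : ℝ) = K (v - z) := by
        rw [← ENNReal.rpow_add_of_nonneg _ _ (by norm_num) (by norm_num)]; norm_num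
      calc _ = (K (v - z) ^ (2 / 3 : ℝ) * K (v - z) ^ (1 / 3 : ℝ)) * F z := by ring
        _ = _ := by rw [this]
    have e2 : ∀ z, (K (v - z) ^ (2 / 3 : ℝ) * F z) ^ (3 / 2 : ℝ) = K (v - z) * F z ^ (3 / 2 : ℝ) := by
      intro z
      rw [ENNReal.mul_rpow_of_nonneg _ _ (by norm_num), ← ENNReal.rpow_mul]; norm_num
    have e3 : ∀ z, (K (v - z) ^ (1 / 3 : ℝ)) ^ (3 : ℝ) = K (v - z) := by
      intro z
      rw [← ENNReal.rpow_mul]; norm_num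
    simp only [Pi.mul_apply, e1, e2, e3] at h
    rw [lintegral_sub_left_eq_self K v, h1, ENNReal.one_rpow, mul_one] at h
    calc _ ≤ ((∫⁻ z, K (v - z) * F z ^ (3 / 2 : ℝ)) ^ (2 / 3 : ℝ)) ^ (3 / 2 : ℝ) :=
          ENNReal.rpow_le_rpow h (by norm_num)
      _ = _ := by rw [← ENNReal.rpow_mul]; norm_num
  refine (lintegral_mono hpt).trans (le_of_eq ?_)
  have hprod : AEMeasurable (Function.uncurry fun v z : V => K (v - z) * F z ^ (3 / 2 : ℝ))
      (volume.prod volume) :=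
    (hK.comp (measurable_fst.sub measurable_snd)).aemeasurable.mul
      ((hF.comp_quasiMeasurePreserving Measure.quasiMeasurePreserving_snd).pow_const _)
  rw [lintegral_lintegral_swap hprod]
  refine lintegral_congr fun z => ?_
  rw [lintegral_mul_const _ (show Measurable fun v => K (v - z) from
    hK.comp (measurable_id.sub_const z)), lintegral_sub_right_eq_self K z, h1,
    one_mul]

lemma wNorm_eq (k : ℝ) (g : V → ℝ) :
    wNorm k g = (∫⁻ v, ‖bracket v ^ k * g v‖ₑ ^ (3 / 2 : ℝ)) ^ (2 / 3 : ℝ) := by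
  rw [wNorm, eLpNorm_eq_lintegral_rpow_enorm_toReal (by norm_num)
    (ENNReal.div_ne_top (by norm_num) (by norm_num))]
  have e : (3 / 2 : ℝ≥0∞).toReal = 3 / 2 := by simp
  rw [e, show (1 : ℝ) / (3 / 2) = 2 / 3 by norm_num]

lemma wNorm_neg (k : ℝ) (g : V → ℝ) : wNorm k (fun v => -g v) = wNorm k g := by
  simp only [wNorm_eq, mul_neg, enorm_neg]

section

variable {η : V → ℝ} (hη : IsMollifier η) {k : ℝ} (hk : 0 ≤ k)
include hη hk

/-- For δ ≤ 1 the kernel only sees points at distance at most one, so the weight passes from v to z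
at the cost of 2^k; the rest is Young's inequality with a kernel of mass one. -/
lemma wNorm_mollify_le {δ : ℝ} (hδ : δ ∈ Set.Ioc (0 : ℝ) 1) {g : V → ℝ} (hg : AEStronglyMeasurable g) :
    wNorm k (mollify η δ g) ≤ ENNReal.ofReal (2 ^ k) * wNorm k g := by
  rw [wNorm_eq, wNorm_eq]
  have hpt : ∀ v, ‖bracket v ^ k * mollify η δ g v‖ₑ ≤
      ∫⁻ z, ENNReal.ofReal (scaled η δ (v - z)) * (ENNReal.ofReal (2 ^ k) * ‖bracket z ^ k * g z‖ₑ) := by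
    intro v
    have hb : 0 ≤ bracket v ^ k := Real.rpow_nonneg (bracket_pos v).le _
    rw [enorm_mul, Real.enorm_of_nonneg hb]
    calc _ ≤ ENNReal.ofReal (bracket v ^ k) * ∫⁻ z, ‖scaled η δ (v - z) * g z‖ₑ :=
          mul_le_mul' le_rfl (enorm_integral_le_lintegral_enorm _)
      _ = ∫⁻ z, ENNReal.ofReal (bracket v ^ k) * ‖scaled η δ (v - z) * g z‖ₑ :=
          (lintegral_const_mul' _ _ ENNReal.ofReal_ne_top).symm
      _ ≤ _ := by
          refine lintegral_mono fun z => ?_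
          rw [enorm_mul, Real.enorm_of_nonneg (scaled_nonneg hη hδ.1 _), enorm_mul,
            Real.enorm_of_nonneg (Real.rpow_nonneg (bracket_pos z).le k)]
          rcases le_or_gt ‖v - z‖ δ with h | h
          · have h1 : bracket v ^ k ≤ 2 ^ k * bracket z ^ k := by
              rw [← Real.mul_rpow (by norm_num) (bracket_pos z).le]
              exact Real.rpow_le_rpow (bracket_pos v).le (bracket_le_two_mul (h.trans hδ.2)) hk
            calc _ = ENNReal.ofReal (scaled η δ (v - z)) * (ENNReal.ofReal (bracket v ^ k) * ‖g z‖ₑ) := by ring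
              _ ≤ ENNReal.ofReal (scaled η δ (v - z)) * (ENNReal.ofReal (2 ^ k * bracket z ^ k) * ‖g z‖ₑ) := by
                  gcongr
              _ = _ := by rw [ENNReal.ofReal_mul (by positivity)]; ring
          · rw [scaled_eq_zero hη hδ.1 h]; simp
  have hw : AEMeasurable fun z => ENNReal.ofReal (2 ^ k) * ‖bracket z ^ k * g z‖ₑ :=
    (aestronglyMeasurable_weight_mul k hg).enorm.const_mul _
  have hconv := lintegral_conv_rpow_le hw (continuous_scaled hη (δ := δ)).measurable.ennreal_ofReal
    (lintegral_scaled hη hδ.1)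
  calc _ ≤ (∫⁻ v, (ENNReal.ofReal (2 ^ k) * ‖bracket v ^ k * g v‖ₑ) ^ (3 / 2 : ℝ)) ^ (2 / 3 : ℝ) :=
        ENNReal.rpow_le_rpow ((lintegral_mono fun v =>
          ENNReal.rpow_le_rpow (hpt v) (by norm_num)).trans hconv) (by norm_num)
    _ = _ := by
        have e : ∀ v, (ENNReal.ofReal (2 ^ k) * ‖bracket v ^ k * g v‖ₑ) ^ (3 / 2 : ℝ) =
            ENNReal.ofReal (2 ^ k) ^ (3 / 2 : ℝ) * ‖bracket v ^ k * g v‖ₑ ^ (3 / 2 : ℝ) := fun v =>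
          ENNReal.mul_rpow_of_nonneg _ _ (by norm_num)
        simp only [e]
        rw [lintegral_const_mul' _ _ (ENNReal.rpow_ne_top_of_nonneg (by norm_num) ENNReal.ofReal_ne_top),
          ENNReal.mul_rpow_of_nonneg _ _ (by norm_num), ← ENNReal.rpow_mul]
        norm_num

/-- The error g − g*η_δ is Lipschitz in g for the weighted norm, uniformly in δ ≤ 1. This serves
twice: to pass from continuous functions of compact support to general ones, and from one time to
nearby ones. -/
lemma wNorm_sub_mollify_le {δ : ℝ} (hδ : δ ∈ Set.Ioc (0 : ℝ) 1) {g h : V → ℝ} (hg : Integrable g)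
    (hh : Integrable h) :
    wNorm k (fun v => g v - mollify η δ g v) ≤ wNorm k (fun v => h v - mollify η δ h v) +
      (1 + ENNReal.ofReal (2 ^ k)) * wNorm k (fun v => g v - h v) := by
  have hd : Integrable fun v => g v - h v := hg.sub hh
  have e : ∀ v, mollify η δ (fun v => g v - h v) v = mollify η δ g v - mollify η δ h v := by
    intro v
    unfold mollify
    rw [← integral_sub (integrable_mollify_kernel hη hg v) (integrable_mollify_kernel hη hh v)]
    simp only [mul_sub]
  have m1 := aestronglyMeasurable_mollify hη δ hh.1
  have m2 := aestronglyMeasurable_mollify hη δ hd.1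
  have e2 : (fun v => g v - mollify η δ g v) = fun v => (h v - mollify η δ h v) +
      ((g v - h v) + -mollify η δ (fun v => g v - h v) v) := by
    funext v; rw [e]; ring
  rw [e2]
  refine (wNorm_add_le k (hh.1.sub m1) (hd.1.add m2.neg)).trans (add_le_add le_rfl ?_)
  refine (wNorm_add_le k (h := fun v => -mollify η δ (fun v => g v - h v) v) hd.1 m2.neg).trans ?_
  rw [add_mul, one_mul, wNorm_neg]
  exact add_le_add le_rfl (wNorm_mollify_le hη hk hδ hd.1)

/-- Uniform continuity makes the error uniformly small, and it is supported in the ball enlarged by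
one, where the weight is bounded. -/
lemma exists_wNorm_sub_mollify_le_of_hasCompactSupport {g : V → ℝ} (hg : Continuous g)
    (hc : HasCompactSupport g) {ε : ℝ≥0∞} (hε : 0 < ε) :
    ∃ δ₀ ∈ Set.Ioc (0 : ℝ) 1, ∀ δ ∈ Set.Ioc (0 : ℝ) δ₀,
      wNorm k (fun v => g v - mollify η δ g v) ≤ ε := by
  obtain ⟨ρ, hρ⟩ := hc.isCompact.isBounded.subset_closedBall (0 : V)
  have hz : ∀ v : V, ρ < ‖v‖ → g v = 0 := fun v hv => by
    refine image_eq_zero_of_notMem_tsupport fun h => ?_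
    have := hρ h
    simp at this
    linarith
  set S := Metric.closedBall (0 : V) (max ρ 0 + 1) with hS
  set B : ℝ := (max ρ 0 + 2) ^ k with hB
  have hB0 : 0 < B := by have := le_max_right ρ 0; positivity
  have hSv : volume S ≠ ⊤ := (isCompact_closedBall _ _).measure_lt_top.ne
  have hlim : Tendsto (fun ω : ℝ => ENNReal.ofReal (B * ω) * volume S ^ (2 / 3 : ℝ)) (𝓝[>] 0) (𝓝 0) := by
    have h1 : Tendsto (fun ω : ℝ => ENNReal.ofReal (B * ω)) (𝓝[>] 0) (𝓝 0) := by
      have : Continuous fun ω : ℝ => ENNReal.ofReal (B * ω) :=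
        ENNReal.continuous_ofReal.comp (continuous_const.mul continuous_id)
      simpa using (this.tendsto 0).mono_left nhdsWithin_le_nhds
    have := ENNReal.Tendsto.mul_const h1 (b := volume S ^ (2 / 3 : ℝ))
      (Or.inr (ENNReal.rpow_ne_top_of_nonneg (by norm_num) hSv))
    simpa using this
  obtain ⟨ω, hω, hω0⟩ := ((hlim.eventually_lt_const hε).and self_mem_nhdsWithin).exists
  have hω0 : 0 < ω := hω0
  obtain ⟨d, hd, hd'⟩ := Metric.uniformContinuous_iff.1 (hc.uniformContinuous_of_continuous hg) ω hω0
  refine ⟨min 1 (d / 2), ⟨by positivity, min_le_left _ _⟩, fun δ hδ => ?_⟩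
  have hδ0 := hδ.1
  have hδ1 : δ ≤ 1 := hδ.2.trans (min_le_left _ _)
  have hδd : δ < d := (hδ.2.trans (min_le_right _ _)).trans_lt (by linarith)
  have hgi : Integrable g := hg.integrable_of_hasCompactSupport hc
  have hsi : ∀ v, Integrable fun z => scaled η δ (v - z) := fun v =>
    (integrable_scaled hη hδ0).comp_sub_left v
  have hrep : ∀ v, g v - mollify η δ g v = ∫ z, scaled η δ (v - z) * (g v - g z) := by
    intro v
    have h1 : ∫ z, scaled η δ (v - z) = 1 := by
      rw [integral_sub_left_eq_self (scaled η δ) volume v, integral_scaled hη hδ0]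
    have h2 : Integrable fun z => scaled η δ (v - z) * g z := integrable_mollify_kernel hη hgi v
    simp only [mul_sub]
    rw [integral_sub ((hsi v).mul_const _) h2, integral_mul_const, h1, one_mul]
    rfl
  have hsmall : ∀ v, |g v - mollify η δ g v| ≤ ω := by
    intro v
    rw [hrep, ← Real.norm_eq_abs]
    have h1 : ∫ z, scaled η δ (v - z) * ω = ω := by
      rw [integral_mul_const, integral_sub_left_eq_self (scaled η δ) volume v, integral_scaled hη hδ0, one_mul]
    refine (norm_integral_le_of_norm_le ((hsi v).mul_const ω) (Eventually.of_forall fun z => ?_)).trans h1.le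
    rw [norm_mul, Real.norm_of_nonneg (scaled_nonneg hη hδ0 _)]
    rcases le_or_gt ‖v - z‖ δ with h | h
    · refine mul_le_mul_of_nonneg_left ?_ (scaled_nonneg hη hδ0 _)
      have := hd' (a := v) (b := z) (by rw [dist_eq_norm]; linarith)
      rw [dist_eq_norm] at this; exact this.le
    · rw [scaled_eq_zero hη hδ0 h]; simp
  have hzero : ∀ v ∉ S, g v - mollify η δ g v = 0 := by
    intro v hv
    have hv' : max ρ 0 + 1 < ‖v‖ := by simpa [hS] using hv
    have h1 := le_max_left ρ 0
    rw [hz v (by linarith), zero_sub, neg_eq_zero, mollify]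
    refine integral_eq_zero_of_ae (Eventually.of_forall fun z => ?_)
    rcases le_or_gt ‖v - z‖ δ with h | h
    · have : ‖v‖ - ‖z‖ ≤ ‖v - z‖ := norm_sub_norm_le v z
      simp [hz z (by linarith)]
    · change scaled η δ (v - z) * g z = 0
      rw [scaled_eq_zero hη hδ0 h, zero_mul]
  refine le_trans ?_ hω.le
  have hmono : wNorm k (fun v => g v - mollify η δ g v) ≤ eLpNorm (S.indicator fun _ => B * ω) (3 / 2) volume := by
    refine eLpNorm_mono fun v => ?_
    by_cases hv : v ∈ S
    · rw [Set.indicator_of_mem hv, norm_mul, Real.norm_of_nonneg (Real.rpow_nonneg (bracket_pos v).le _),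
        Real.norm_of_nonneg (mul_pos hB0 hω0).le]
      have hbr : bracket v ≤ max ρ 0 + 2 := by
        have h1 : ‖v‖ ≤ max ρ 0 + 1 := by simpa [hS] using hv
        have h2 := bracket_sq v
        have h3 := bracket_pos v
        have h4 := norm_nonneg v
        nlinarith
      exact mul_le_mul (Real.rpow_le_rpow (bracket_pos v).le hbr hk) (hsmall v) (abs_nonneg _) hB0.le
    · rw [Set.indicator_of_notMem hv]; simp [hzero v hv]
  refine hmono.trans (le_of_eq ?_)
  rw [eLpNorm_indicator_const measurableSet_closedBall (by norm_num)
    (ENNReal.div_ne_top (by norm_num) (by norm_num)), Real.enorm_of_nonneg (mul_pos hB0 hω0).le]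
  have e : (3 / 2 : ℝ≥0∞).toReal = 3 / 2 := by simp
  rw [e, show (1 : ℝ) / (3 / 2) = 2 / 3 by norm_num]

lemma exists_wNorm_sub_mollify_le (hk2 : 2 < k) {g : V → ℝ}
    (hg : MemLp (fun v => bracket v ^ k * g v) (3 / 2) volume) {ε : ℝ≥0∞} (hε : 0 < ε) :
    ∃ δ₀ ∈ Set.Ioc (0 : ℝ) 1, ∀ δ ∈ Set.Ioc (0 : ℝ) δ₀,
      wNorm k (fun v => g v - mollify η δ g v) ≤ ε := by
  set A : ℝ≥0∞ := 1 + ENNReal.ofReal (2 ^ k) with hA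
  have hA0 : A ≠ 0 := by simp [hA]
  have hAt : A ≠ ⊤ := by simp [hA]
  have hε2 : 0 < ε / 2 / A := by
    refine ENNReal.div_pos (ENNReal.div_pos hε.ne' (by simp)).ne' hAt
  obtain ⟨h, hc, hle, hcont, -⟩ := hg.exists_hasCompactSupport_eLpNorm_sub_le
    (ENNReal.div_ne_top (by norm_num) (by norm_num)) hε2.ne'
  set h' : V → ℝ := fun v => bracket v ^ (-k) * h v with hh'
  have hh'c : Continuous h' := (continuous_bracket_rpow (-k)).mul hcont
  have hh's : HasCompactSupport h' := hc.mul_left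
  obtain ⟨δ₀, hδ₀, H⟩ := exists_wNorm_sub_mollify_le_of_hasCompactSupport hη hk hh'c hh's
    (ENNReal.half_pos hε.ne')
  have hgm := aestronglyMeasurable_of_weight hg.1
  have hgi : Integrable g := integrable_of_wNorm_lt_top hk2 hgm hg.2
  have hd : wNorm k (fun v => g v - h' v) ≤ ε / 2 / A := by
    refine le_trans (le_of_eq ?_) hle
    unfold wNorm
    congr 1
    funext v
    simp only [hh', Pi.sub_apply, mul_sub]
    rw [← mul_assoc, ← Real.rpow_add (bracket_pos v)]; simp
  refine ⟨δ₀, hδ₀, fun δ hδ => ?_⟩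
  refine (wNorm_sub_mollify_le hη hk ⟨hδ.1, hδ.2.trans hδ₀.2⟩ hgi
    (hh'c.integrable_of_hasCompactSupport hh's)).trans ?_
  calc _ ≤ ε / 2 + A * (ε / 2 / A) := add_le_add (H δ hδ) (mul_le_mul' le_rfl hd)
    _ = ε := by rw [ENNReal.mul_div_cancel hA0 hAt, ENNReal.add_halves]

lemma exists_forall_wNorm_sub_mollify_le (hk2 : 2 < k) {T : ℝ} {f : ℝ → V → ℝ}
    (hw : WeightedContinuous k T f) {ε : ℝ≥0∞} (hε : 0 < ε) :
    ∃ δ ∈ Set.Ioc (0 : ℝ) 1, ∀ t ∈ Set.Icc 0 T,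
      wNorm k (fun v => f t v - mollify η δ (f t) v) ≤ ε := by
  set A : ℝ≥0∞ := 1 + ENNReal.ofReal (2 ^ k) with hA
  have hA0 : A ≠ 0 := by simp [hA]
  have hAt : A ≠ ⊤ := by simp [hA]
  have hε2 : 0 < ε / 2 / A := ENNReal.div_pos (ENNReal.div_pos hε.ne' (by simp)).ne' hAt
  -- The claim is made for all δ ≤ δ₀, so that minima can be taken over the finitely many pieces of
  -- a cover of [0,T].
  have : ∃ δ₀ ∈ Set.Ioc (0 : ℝ) 1, ∀ δ ∈ Set.Ioc (0 : ℝ) δ₀, ∀ t ∈ Set.Icc 0 T,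
      wNorm k (fun v => f t v - mollify η δ (f t) v) ≤ ε := by
    refine (isCompact_Icc (a := (0 : ℝ)) (b := T)).induction_on
      (p := fun s => ∃ δ₀ ∈ Set.Ioc (0 : ℝ) 1, ∀ δ ∈ Set.Ioc (0 : ℝ) δ₀, ∀ t ∈ s,
        wNorm k (fun v => f t v - mollify η δ (f t) v) ≤ ε)
      ⟨1, by simp, by simp⟩ ?_ ?_ ?_
    · rintro s s' hss ⟨δ₀, h0, h⟩
      exact ⟨δ₀, h0, fun δ hδ t ht => h δ hδ t (hss ht)⟩
    · rintro s s' ⟨a, ha, h⟩ ⟨b, hb, h'⟩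
      refine ⟨min a b, ⟨lt_min ha.1 hb.1, (min_le_left _ _).trans ha.2⟩, ?_⟩
      rintro δ hδ t (ht | ht)
      · exact h δ ⟨hδ.1, hδ.2.trans (min_le_left _ _)⟩ t ht
      · exact h' δ ⟨hδ.1, hδ.2.trans (min_le_right _ _)⟩ t ht
    · intro t ht
      obtain ⟨δ₀, hδ₀, H⟩ := exists_wNorm_sub_mollify_le hη hk hk2 (hw.memLp t ht)
        (ENNReal.half_pos hε.ne')
      refine ⟨_, inter_mem self_mem_nhdsWithin ((hw.tendsto t ht).eventually_lt_const hε2), δ₀, hδ₀, ?_⟩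
      rintro δ hδ s ⟨hs, hs'⟩
      refine (wNorm_sub_mollify_le hη hk ⟨hδ.1, hδ.2.trans hδ₀.2⟩ (integrable_slice hw hk2 hs)
        (integrable_slice hw hk2 ht)).trans ?_
      calc _ ≤ ε / 2 + A * (ε / 2 / A) := add_le_add (H δ hδ) (mul_le_mul' le_rfl (le_of_lt hs'))
        _ = ε := by rw [ENNReal.mul_div_cancel hA0 hAt, ENNReal.add_halves]
  obtain ⟨δ₀, hδ₀, H⟩ := this
  exact ⟨δ₀, hδ₀, H δ₀ ⟨hδ₀.1, le_rfl⟩⟩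

end

/-! ### Conclusion -/

section

variable {k T : ℝ} {f : ℝ → V → ℝ} (hk : 3 ≤ k) (hT : 0 < T) (hs : IsClassicalSolution T f)
  (hw : WeightedContinuous k T f)
include hk hT hs hw

lemma mass_nonneg : 0 ≤ mass f := by
  have ht : T / 2 ∈ Set.Ioo 0 T := ⟨by linarith, by linarith⟩
  rw [← integral_slice_eq_mass hw (by linarith) hs ht]
  exact integral_nonneg (hs.nonneg _ ht)

omit hT in
-- Without mass there is no coercivity, but a nonnegative continuous function of zero integral
-- vanishes, and mass conservation gives this at every t in (0,T).
lemma memLp_wGrad_of_mass_eq_zero (hm : mass f = 0) : MemLp (wGrad k f) 2 (slab T) := by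
  have h : wGrad k f =ᵐ[slab T] fun _ => 0 := by
    rw [slab, EventuallyEq, ae_restrict_iff' (measurableSet_Ioo.prod .univ)]
    refine Eventually.of_forall fun p hp => ?_
    have hc := (contDiff_slice hs hp.1).continuous
    have hi := integrable_slice hw (by linarith) (Set.Ioo_subset_Icc_self hp.1)
    have h0 := integral_slice_eq_mass hw (by linarith) hs hp.1
    rw [hm, integral_eq_zero_iff_of_nonneg (hs.nonneg _ hp.1) hi] at h0
    have h1 : f p.1 = 0 := (hc.ae_eq_iff_eq volume continuous_const).1 h0
    have h2 : (fun v => f p.1 v ^ (3 / 4 : ℝ)) = fun _ => 0 := by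
      funext v; rw [h1]; simp
    rw [wGrad, h2]; simp
  exact (memLp_congr_ae h).2 MemLp.zero'

lemma eLpNorm_wGrad_sq_le_of_mollify (hm : 0 < mass f) {η : V → ℝ} (hη : IsMollifier η) {δ : ℝ}
    (hδ : δ ∈ Set.Ioc (0 : ℝ) 1)
    (h : ∀ t ∈ Set.Icc 0 T, wNorm k (fun v => f t v - mollify η δ (f t) v) ≤
      ENNReal.ofReal (smallConst k / size k T f ^ 12)) :
    eLpNorm (wGrad k f) 2 (slab T) ^ 2 ≤
      ENNReal.ofReal (2 / coerConst k * (lowerConst k + 1) * (1 + T) * (size k T f / δ) ^ 12) := by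
  have hk0 : 0 ≤ k := by linarith
  have hcc := coerConst_pos k
  have hlc := lowerConst_nonneg hk0
  have hM0 : 0 ≤ (wSup k T f).toReal := ENNReal.toReal_nonneg
  have hδ0 := hδ.1
  set M := (wSup k T f).toReal with hM
  set m := mass f with hmdef
  set X := size k T f with hX
  have hXe : X = (1 + M) * (1 + 1 / m) := rfl
  -- This product form is what `size` is designed for: it yields both M ≤ Xm and 1 ≤ Xm, the two
  -- hypotheses of coercivity.
  have hXm : X * m = (1 + M) * (m + 1) := by rw [hXe]; field_simp
  have h1m : 0 ≤ 1 / m := by positivity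
  have hX1 : 1 ≤ X := by rw [hXe]; nlinarith
  have hMX : M ≤ X := by rw [hXe]; nlinarith
  have hMX2 : M ≤ X * m := by rw [hXm]; nlinarith
  have hXm1 : 1 ≤ X * m := by rw [hXm]; nlinarith
  set c := coerConst k / (2 * X ^ 8) with hc
  have hc0 : 0 < c := by positivity
  have hZ0 : 0 ≤ X / δ := by positivity
  refine (eLpNorm_wGrad_sq_le hs hT (B := ENNReal.ofReal
    ((T * (lowerConst k * (X / δ) ^ 3) + M ^ (3 / 2 : ℝ)) / c)) fun R hR a b ha hab hb =>
    lintegral_dissip_le hs hw hc0 (by positivity) hR (fun t ht => ?_) ha hab hb).trans ?_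
  · have hti := Set.Ioo_subset_Icc_self ht
    have hmt := integral_slice_eq_mass hw (by linarith) hs ht
    rw [← hmdef] at hmt
    exact energyRate_le hk hR (contDiff_slice hs ht) (hs.nonneg t ht) hM0 (wNorm_le_wSup hw hti) hX1 hMX
      (by rwa [hmt]) (by rwa [hmt]) hη hδ (h t hti)
  · refine ENNReal.ofReal_le_ofReal ?_
    have hXZ : X ≤ X / δ := le_div_self (by linarith) hδ0 hδ.2
    have hZ1 : 1 ≤ X / δ := hX1.trans hXZ
    set Z := X / δ
    have hM32 : M ^ (3 / 2 : ℝ) ≤ Z ^ 3 := by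
      calc M ^ (3 / 2 : ℝ) ≤ Z ^ (3 / 2 : ℝ) := Real.rpow_le_rpow hM0 (hMX.trans hXZ) (by norm_num)
        _ ≤ Z ^ (3 : ℝ) := Real.rpow_le_rpow_of_exponent_le hZ1 (by norm_num)
        _ = Z ^ 3 := by rw [← Real.rpow_natCast]; norm_num
    have e : ∀ y : ℝ, y / c = 2 / coerConst k * (X ^ 8 * y) := fun y => by
      rw [hc]; field_simp
    rw [e]
    -- Dividing by the coercivity costs X⁸ and the lower-order terms are of order (X/δ)³, eleven
    -- powers in all; 12 is the common exponent N.
    calc 2 / coerConst k * (X ^ 8 * (T * (lowerConst k * Z ^ 3) + M ^ (3 / 2 : ℝ)))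
        ≤ 2 / coerConst k * (Z ^ 8 * (T * (lowerConst k * Z ^ 3) + Z ^ 3)) := by gcongr
      _ = 2 / coerConst k * (T * lowerConst k + 1) * Z ^ 11 := by ring
      _ ≤ 2 / coerConst k * ((lowerConst k + 1) * (1 + T)) * Z ^ 12 := by
          refine mul_le_mul (mul_le_mul_of_nonneg_left ?_ (by positivity))
            (pow_le_pow_right₀ hZ1 (by norm_num)) (by positivity) (by positivity)
          nlinarith
      _ = _ := by ring

omit hT hs in
lemma exists_delta (hm : 0 < mass f) {η : V → ℝ} (hη : IsMollifier η) :
    ∃ δ ∈ Set.Ioc (0 : ℝ) 1, ∀ t ∈ Set.Icc 0 T,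
      wNorm k (fun v => f t v - mollify η δ (f t) v) ≤
        ENNReal.ofReal (smallConst k / size k T f ^ 12) := by
  refine exists_forall_wNorm_sub_mollify_le hη (by linarith) (by linarith) hw ?_
  have h1 := smallConst_pos (k := k) (by linarith)
  have h2 : 0 < size k T f := by
    unfold size
    have : 0 ≤ (wSup k T f).toReal := ENNReal.toReal_nonneg
    positivity
  rw [ENNReal.ofReal_pos]; positivity

/-- Qualitative membership involves no mollifier, so any admissible profile may be chosen for the
quantitative bound. -/
lemma memLp_wGrad : MemLp (wGrad k f) 2 (slab T) := by
  rcases (mass_nonneg hk hT hs hw).eq_or_lt with hm | hm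
  · exact memLp_wGrad_of_mass_eq_zero hk hs hw hm.symm
  obtain ⟨η, hη⟩ := exists_isMollifier
  obtain ⟨δ, hδ, h⟩ := exists_delta hk hw hm hη
  refine ⟨aestronglyMeasurable_wGrad hs, ?_⟩
  have := (eLpNorm_wGrad_sq_le_of_mollify hk hT hs hw hm hη hδ h).trans_lt ENNReal.ofReal_lt_top
  rw [lt_top_iff_ne_top] at this ⊢
  intro h'
  rw [h'] at this
  simp at this

end

end Landau

theorem mainTheorem3 (k : ℝ) (hk : 18 / 5 < k) :
    ∃ C : ℝ, 0 < C ∧ ∃ κ : ℝ, 0 < κ ∧ ∃ N : ℕ,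
      ∀ (T : ℝ) (f : ℝ → Landau.V → ℝ), 0 < T →
        Landau.IsClassicalSolution T f → Landau.WeightedContinuous k T f →
        (∀ t ∈ Set.Ioo 0 T, Differentiable ℝ (fun v => f t v ^ (3 / 4 : ℝ))) ∧
        MeasureTheory.MemLp (Landau.wGrad k f) 2 (Landau.slab T) ∧
        Landau.wSup k T f < ⊤ ∧
        (0 < Landau.mass f → ∀ η : Landau.V → ℝ, Landau.IsMollifier η →
          (∃ δ ∈ Set.Ioc (0 : ℝ) 1, ∀ t ∈ Set.Icc 0 T,
            Landau.wNorm k (fun v => f t v - Landau.mollify η δ (f t) v) ≤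
              ENNReal.ofReal (κ / Landau.size k T f ^ N)) ∧
          (∀ δ ∈ Set.Ioc (0 : ℝ) 1,
            (∀ t ∈ Set.Icc 0 T,
              Landau.wNorm k (fun v => f t v - Landau.mollify η δ (f t) v) ≤
                ENNReal.ofReal (κ / Landau.size k T f ^ N)) →
            MeasureTheory.eLpNorm (Landau.wGrad k f) 2 (Landau.slab T) ^ 2 ≤
              ENNReal.ofReal (C * (1 + T) * (Landau.size k T f / δ) ^ N))) := by
  have hk3 : 3 ≤ k := by linarith
  have hk0 : 0 ≤ k := by linarith
  -- The 2 in C is the reciprocal of the half of the coercivity that survives absorption, and adding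
  -- 1 to `lowerConst` accounts for the initial energy.
  refine ⟨2 / Landau.coerConst k * (Landau.lowerConst k + 1), ?_, Landau.smallConst k,
    Landau.smallConst_pos hk0, 12, fun T f hT hs hw => ⟨fun t ht => ?_,
      Landau.memLp_wGrad hk3 hT hs hw, Landau.wSup_lt_top hw, fun hm η hη =>
      ⟨Landau.exists_delta hk3 hw hm hη, fun δ hδ h =>
        Landau.eLpNorm_wGrad_sq_le_of_mollify hk3 hT hs hw hm hη hδ h⟩⟩⟩
  · have h1 := Landau.coerConst_pos k
    have h2 := Landau.lowerConst_nonneg hk0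
    positivity
  · exact (Landau.contDiff_rpow_three_quarters (Landau.contDiff_slice hs ht)
      (hs.nonneg t ht)).differentiable (by simp)
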